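/- Let $k$ be an algebraically closed field of characteristic $p>0$ and let $\mathbb F$ be an algebraically closed field of characteristic $0$. Fix an injective homomorphism from the group of roots of unity of $k$ to $\mathbb F^\times$, used to define $\mathbb F$-valued Brauer characters. All modules are finitely generated. A $p$-permutation module is a direct summand of a permutation module. For a finite group $G$, let $T(G)$ be the Grothendieck group, with respect to direct sums, of $p$-permutation $kG$-modules, and $\mathbb FT(G)=\mathbb F\otimes_{\mathbb Z}T(G)$. For finite groups $G$ and $H$, $(kG,kH)$-bimodules are identified with $k[G\times H]$-modules via $(g,h)m=gmh^{-1}$, and $-\otimes_{kH}-$ is extended $\mathbb F$-bilinearly to $\mathbb FT(G\times H)\times\mathbb FT(H\times K)\to\mathbb FT(G\times K)$. A pair $(P,r)$ of $G$ consists of a $p$-subgroup $P$ of $G$ and a $p'$-element $r$ of $N_G(P)$. For a $p$-permutation $kG$-module $M$, let $\tau^G_{P,r}(M)\in\mathbb F$ be the value at $r$ of the Brauer character of the Brauer construction $M[P]$, and extend $\tau^G_{P,r}$ to an $\mathbb F$-linear map on $\mathbb FT(G)$. Let $F^G_{P,r}\in\mathbb FT(G)$ be the element such that, for every pair $(Q,t)$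 of $G$, $\tau^G_{Q,t}(F^G_{P,r})$ is $1$ if $(Q,t)$ is $G$-conjugate to $(P,r)$ and $0$ otherwise. Let $\widetilde{F^G_{P,r}}=\mathrm{Ind}_{\Delta G}^{G\times G}F^G_{P,r}\in\mathbb FT(G\times G)$, where $\Delta G\cong G$ is the diagonal subgroup of $G\times G$. Put $P\langle r\rangle=P\rtimes\langle r\rangle\le G$ and let $(\tilde P,\tilde r)=\big(P\,C_{\langle r\rangle}(P)/C_{\langle r\rangle}(P),\ r\,C_{\langle r\rangle}(P)\big)$, a pair of $P\langle r\rangle/C_{\langle r\rangle}(P)$, be the $D^\Delta$-pair associated with $(P,r)$. Two pairs $(P,s)$ and $(Q,t)$ are isomorphic, $(P,s)\cong(Q,t)$, if there is a group isomorphism $P\langle s\rangle\to Q\langle t\rangle$ that sends $s$ to a conjugate of $t$. **Theorem.** Let $G$ and $K$ be finite groups, let $(P,r)$ be a pair of $G$ and $(Q,u)$ a pair of $K$. There exists a $p$-permutation $(kG,kK)$-bimodule $M$, all of whose indecomposable direct summands have vertices of the form $\{(\gamma(w),w): w\in W\}$ for subgroups $U\le G$, $W\le K$ and a group isomorphism $\gamma:W\to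 U$, such that $$\widetilde{F^G_{P,r}}\otimes_{kG}M\otimes_{kK}\widetilde{F^K_{Q,u}}\neq 0$$ if and only if $(\tilde P,\tilde r)\cong(\tilde Q,\tilde u)$. -/

import Mathlib

/-!
Conventions.  `k` is a field of characteristic `p`, `F` a field of characteristic zero, and a
`kG`-module is a representation of `G` on a `k`-vector space.  A `(kG, kH)`-bimodule is a
representation of `G × H`, where `(g, h)` acts as `m ↦ g m h⁻¹`.
-/

universe u v

open scoped TensorProduct

namespace PPermutation

/-! ### Direct summands, permutation modules and p-permutation modules -/

section Modules

variable {k : Type u} {G : Type u} [Field k] [Group G]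

/-- `ρ` is (isomorphic to) a direct summand of `σ`. -/
def IsDirectSummand {V W : Type u} [AddCommGroup V] [Module k V] [AddCommGroup W] [Module k W]
    (ρ : Representation k G V) (σ : Representation k G W) : Prop :=
  ∃ (i : ρ.IntertwiningMap σ) (q : σ.IntertwiningMap ρ),
    q.comp i = Representation.IntertwiningMap.id ρ

/-- A permutation module: it has a finite `k`-basis that is permuted by `G`. -/
def IsPermutation {V : Type u} [AddCommGroup V] [Module k V] (ρ : Representation k G V) : Prop :=
  ∃ (X : Type u) (_ : Finite X) (b : Module.Basis X k V), ∀ (g : G) (x : X), ∃ y, ρ g (b x) = b y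

/-- A p-permutation module: a direct summand of a permutation module. -/
def IsPPermutation {V : Type u} [AddCommGroup V] [Module k V] (ρ : Representation k G V) : Prop :=
  ∃ (W : Type u) (_ : AddCommGroup W) (_ : Module k W) (σ : Representation k G W),
    IsPermutation σ ∧ IsDirectSummand ρ σ

/-- An indecomposable module: non-zero, and in every decomposition as an internal direct sum of two
submodules one of the two is zero. -/
def IsIndecomposable {V : Type u} [AddCommGroup V] [Module k V] (ρ : Representation k G V) : Prop :=
  Nontrivial V ∧ ∀ A B : Subrepresentation ρ, IsCompl A B → A = ⊥ ∨ B = ⊥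

/-- `ρ` is relatively `Q`-projective: it is a direct summand of a module induced from a finitely
generated `kQ`-module. -/
def IsRelProjective (Q : Subgroup G) {V : Type u} [AddCommGroup V] [Module k V]
    (ρ : Representation k G V) : Prop :=
  ∃ (W : Type u) (_ : AddCommGroup W) (_ : Module k W) (_ : Module.Finite k W)
    (σ : Representation k Q W), IsDirectSummand ρ (Representation.ind Q.subtype σ)

/-- `Q` is a vertex of the (indecomposable) module `ρ`: it is minimal among the subgroups relative
to which `ρ` is projective. -/
def IsVertex (Q : Subgroup G) {V : Type u} [AddCommGroup V] [Module k V]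
    (ρ : Representation k G V) : Prop :=
  Minimal (fun R : Subgroup G => IsRelProjective R ρ) Q

end Modules

/-- The twisted diagonal subgroup `{(γ w, w) | w ∈ W}` of `G × K`. -/
def twistedDiagonal {G K : Type*} [Group G] [Group K] (U : Subgroup G) (W : Subgroup K)
    (γ : W ≃* U) : Subgroup (G × K) :=
  (U.subtype.comp γ.toMonoidHom |>.prod W.subtype).range

/-- All indecomposable direct summands of the bimodule `ρ` have twisted diagonal vertices. -/
def HasTwistedDiagonalVertices {k G K : Type u} [Field k] [Group G] [Group K] {V : Type u}
    [AddCommGroup V] [Module k V] (ρ : Representation k (G × K) V) : Prop :=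
  ∀ (W : Type u) [AddCommGroup W] [Module k W] (σ : Representation k (G × K) W),
    IsIndecomposable σ → IsDirectSummand σ ρ → ∀ D : Subgroup (G × K), IsVertex D σ →
      ∃ (U : Subgroup G) (R : Subgroup K) (γ : R ≃* U), D = twistedDiagonal U R γ

/-! ### Auxiliary facts on direct sums -/

section Aux

variable {k : Type*} {G : Type*} [Field k] [Group G]

/-- A biproduct diagram of representations gives an isomorphism with the direct sum. -/
theorem nonempty_equiv_prod {U V W : Type*} [AddCommGroup U] [Module k U] [AddCommGroup V]
    [Module k V] [AddCommGroup W] [Module k W] {υ : Representation k G U}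
    {ρ : Representation k G V} {σ : Representation k G W}
    (i₁ : ρ.IntertwiningMap υ) (i₂ : σ.IntertwiningMap υ)
    (q₁ : υ.IntertwiningMap ρ) (q₂ : υ.IntertwiningMap σ)
    (h₁ : q₁.comp i₁ = .id ρ) (h₂ : q₂.comp i₂ = .id σ)
    (h₁₂ : q₁.comp i₂ = 0) (h₂₁ : q₂.comp i₁ = 0)
    (h : i₁.comp q₁ + i₂.comp q₂ = .id υ) :
    Nonempty (υ.Equiv (ρ.prod σ)) := by
  have e₁ : ∀ x, q₁ (i₁ x) = x := fun x => congrArg (fun f => f x) h₁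
  have e₂ : ∀ x, q₂ (i₂ x) = x := fun x => congrArg (fun f => f x) h₂
  have e₁₂ : ∀ x, q₁ (i₂ x) = 0 := fun x => congrArg (fun f => f x) h₁₂
  have e₂₁ : ∀ x, q₂ (i₁ x) = 0 := fun x => congrArg (fun f => f x) h₂₁
  have e : ∀ x, i₁ (q₁ x) + i₂ (q₂ x) = x := fun x => congrArg (fun f => f x) h
  refine ⟨Representation.Equiv.mk
    (LinearEquiv.ofLinearMap (q₁.toLinearMap.prod q₂.toLinearMap)
      (i₁.toLinearMap.coprod i₂.toLinearMap) ?_ ?_) ?_⟩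
  · refine LinearMap.ext fun x => ?_
    simp [e₁, e₂, e₁₂, e₂₁]
  · refine LinearMap.ext fun x => ?_
    simp [e]
  · intro g
    refine LinearMap.ext fun x => ?_
    simp [q₁.isIntertwining, q₂.isIntertwining]

variable {V W : Type*} [AddCommGroup V] [Module k V] [AddCommGroup W] [Module k W]
  (ρ : Representation k G V) (σ : Representation k G W)

theorem fst_comp_inl : (Representation.IntertwiningMap.fst k ρ σ).comp
    (Representation.IntertwiningMap.inl k ρ σ) = .id ρ := rfl

theorem snd_comp_inr : (Representation.IntertwiningMap.snd k ρ σ).comp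
    (Representation.IntertwiningMap.inr k ρ σ) = .id σ := rfl

theorem fst_comp_inr : (Representation.IntertwiningMap.fst k ρ σ).comp
    (Representation.IntertwiningMap.inr k ρ σ) = 0 := rfl

theorem snd_comp_inl : (Representation.IntertwiningMap.snd k ρ σ).comp
    (Representation.IntertwiningMap.inl k ρ σ) = 0 := rfl

end Aux

/-! ### Closure properties of permutation and p-permutation modules -/

section Closure

variable {k : Type u} {G : Type u} [Field k] [Group G]
variable {V W : Type u} [AddCommGroup V] [Module k V] [AddCommGroup W] [Module k W]

theorem IsPPermutation.of_equiv {ρ : Representation k G V} {σ : Representation k G W}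
    (e : ρ.Equiv σ) (h : IsPPermutation ρ) : IsPPermutation σ := by
  obtain ⟨U, _, _, υ, hυ, i, q, hiq⟩ := h
  refine ⟨U, _, _, υ, hυ, i.comp e.symm.toIntertwiningMap, e.toIntertwiningMap.comp q, ?_⟩
  refine DFunLike.ext _ _ fun x => ?_
  have : ∀ x, q (i x) = x := fun x => congrArg (fun f => f x) hiq
  simp [this]

theorem IsPPermutation.prod {ρ : Representation k G V} {σ : Representation k G W}
    (h : IsPPermutation ρ) (h₂ : IsPPermutation σ) : IsPPermutation (ρ.prod σ) := by
  obtain ⟨A, _, _, α, ⟨X, _, b, hb⟩, i, q, hiq⟩ := h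
  obtain ⟨B, _, _, β, ⟨Y, _, c, hc⟩, i₂, q₂, hiq₂⟩ := h₂
  refine ⟨A × B, inferInstance, inferInstance, α.prod β, ⟨X ⊕ Y, inferInstance, b.prod c, ?_⟩,
    (i.comp (.fst k ρ σ)).prod (i₂.comp (.snd k ρ σ)),
    (q.comp (.fst k α β)).prod (q₂.comp (.snd k α β)), ?_⟩
  · rintro g (x | y)
    · obtain ⟨x', hx⟩ := hb g x
      exact ⟨.inl x', by simp [Module.Basis.prod_apply, hx]⟩
    · obtain ⟨y', hy⟩ := hc g y
      exact ⟨.inr y', by simp [Module.Basis.prod_apply, hy]⟩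
  · have e₁ : ∀ x, q (i x) = x := fun x => congrArg (fun f => f x) hiq
    have e₂ : ∀ x, q₂ (i₂ x) = x := fun x => congrArg (fun f => f x) hiq₂
    refine DFunLike.ext _ _ fun x => ?_
    exact Prod.ext (e₁ x.1) (e₂ x.2)

/-- If `G` and `H` permute a basis of `V`, then `G` permutes a basis of the `H`-coinvariants. -/
theorem isPermutation_coinvariants {H : Type u} [Group H] (σ : Representation k H V)
    (R : Representation k G σ.Coinvariants) {X : Type u} [Finite X] (b : Module.Basis X k V)
    (hσ : ∀ h x, ∃ y, σ h (b x) = b y)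
    (hR : ∀ g x, ∃ y, R g (Representation.Coinvariants.mk σ (b x)) =
      Representation.Coinvariants.mk σ (b y)) : IsPermutation R := by
  let s : Setoid X :=
    { r := fun x y => ∃ h, σ h (b x) = b y
      iseqv :=
        { refl := fun x => ⟨1, by simp⟩
          symm := by
            rintro x y ⟨h, e⟩
            exact ⟨h⁻¹, by rw [← e, Representation.inv_self_apply]⟩
          trans := by
            rintro x y z ⟨h, e⟩ ⟨h', e'⟩
            exact ⟨h' * h, by rw [map_mul, Module.End.mul_apply, e, e']⟩ } }
  let f : σ.Coinvariants →ₗ[k] (Quotient s →₀ k) :=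
    Representation.Coinvariants.lift σ
      (Finsupp.lmapDomain k k (Quotient.mk s) ∘ₗ b.repr.toLinearMap) (by
        intro h
        refine b.ext fun x => ?_
        obtain ⟨y, hy⟩ := hσ h x
        have : Quotient.mk s x = Quotient.mk s y := Quotient.sound ⟨h, hy⟩
        simp [hy, Finsupp.mapDomain_single, this])
  let t : Quotient s → σ.Coinvariants :=
    Quotient.lift (fun x => Representation.Coinvariants.mk σ (b x)) (by
      rintro x y ⟨h, e⟩
      rw [← e, Representation.Coinvariants.mk_self_apply])
  let f' : (Quotient s →₀ k) →ₗ[k] σ.Coinvariants := Finsupp.linearCombination k t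
  let e : σ.Coinvariants ≃ₗ[k] (Quotient s →₀ k) := LinearEquiv.ofLinearMap f f'
    (by
      refine Finsupp.lhom_ext' fun q => LinearMap.ext_ring ?_
      induction q using Quotient.inductionOn with | h x => ?_
      simp [f, f', t, Finsupp.mapDomain_single])
    (by
      refine Representation.Coinvariants.hom_ext (b.ext fun x => ?_)
      simp [f, f', t, Finsupp.mapDomain_single])
  have he : ∀ q, Module.Basis.ofRepr e q = t q := by
    intro q
    simp [Module.Basis.coe_ofRepr, e, f']
  refine ⟨Quotient s, inferInstance, Module.Basis.ofRepr e, fun g q => ?_⟩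
  induction q using Quotient.inductionOn with | h x => ?_
  obtain ⟨y, hy⟩ := hR g x
  exact ⟨Quotient.mk s y, by rw [he, he]; exact hy⟩

end Closure

/-! ### Induction -/

section Induction

variable {k : Type u} {G H : Type u} [Field k] [Group G] [Group H] (φ : G →* H)
variable {V W U : Type u} [AddCommGroup V] [Module k V] [AddCommGroup W] [Module k W]
  [AddCommGroup U] [Module k U]

/-- Functoriality of induction. -/
noncomputable def indMap {ρ : Representation k G V} {σ : Representation k G W}
    (f : ρ.IntertwiningMap σ) :
    (Representation.ind φ ρ).IntertwiningMap (Representation.ind φ σ) :=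
  ⟨Representation.Coinvariants.map _ _ ⟨f.toLinearMap.lTensor _, by
    intro g
    ext
    simp [f.isIntertwining]⟩, fun g => by ext; simp⟩

theorem indMap_id (ρ : Representation k G V) :
    indMap φ (Representation.IntertwiningMap.id ρ) = .id _ := by
  refine Representation.IntertwiningMap.ext ?_
  ext; simp [indMap]

theorem indMap_comp {ρ : Representation k G V} {σ : Representation k G W}
    {υ : Representation k G U} (f : σ.IntertwiningMap υ) (g : ρ.IntertwiningMap σ) :
    indMap φ (f.comp g) = (indMap φ f).comp (indMap φ g) := by
  refine Representation.IntertwiningMap.ext ?_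
  ext; simp [indMap]

theorem indMap_add {ρ : Representation k G V} {σ : Representation k G W}
    (f g : ρ.IntertwiningMap σ) : indMap φ (f + g) = indMap φ f + indMap φ g := by
  refine Representation.IntertwiningMap.ext ?_
  ext; simp [indMap]

theorem indMap_zero (ρ : Representation k G V) (σ : Representation k G W) :
    indMap φ (0 : ρ.IntertwiningMap σ) = 0 := by
  have := indMap_add φ (0 : ρ.IntertwiningMap σ) 0
  simpa using this

theorem ind_prod (ρ : Representation k G V) (σ : Representation k G W) :
    Nonempty ((Representation.ind φ (ρ.prod σ)).Equiv
      ((Representation.ind φ ρ).prod (Representation.ind φ σ))) := by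
  refine nonempty_equiv_prod (indMap φ (.inl k ρ σ)) (indMap φ (.inr k ρ σ))
    (indMap φ (.fst k ρ σ)) (indMap φ (.snd k ρ σ)) ?_ ?_ ?_ ?_ ?_
  · rw [← indMap_comp, fst_comp_inl, indMap_id]
  · rw [← indMap_comp, snd_comp_inr, indMap_id]
  · rw [← indMap_comp, fst_comp_inr, indMap_zero]
  · rw [← indMap_comp, snd_comp_inl, indMap_zero]
  · rw [← indMap_comp, ← indMap_comp, ← indMap_add,
      Representation.IntertwiningMap.coprod_inl_inr, indMap_id]

theorem ind_equiv {ρ : Representation k G V} {σ : Representation k G W} (e : ρ.Equiv σ) :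
    Nonempty ((Representation.ind φ ρ).Equiv (Representation.ind φ σ)) := by
  have h1 : e.toIntertwiningMap.comp e.symm.toIntertwiningMap = .id σ :=
    DFunLike.ext _ _ fun x => by simp
  have h2 : e.symm.toIntertwiningMap.comp e.toIntertwiningMap = .id ρ :=
    DFunLike.ext _ _ fun x => by simp
  have h3 := indMap_comp φ e.toIntertwiningMap e.symm.toIntertwiningMap
  have h4 := indMap_comp φ e.symm.toIntertwiningMap e.toIntertwiningMap
  rw [h1, indMap_id] at h3
  rw [h2, indMap_id] at h4
  exact ⟨Representation.Equiv.mk (LinearEquiv.ofLinearMap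
    (indMap φ e.toIntertwiningMap).toLinearMap (indMap φ e.symm.toIntertwiningMap).toLinearMap
    (congrArg (fun f => f.toLinearMap) h3.symm) (congrArg (fun f => f.toLinearMap) h4.symm))
    (indMap φ e.toIntertwiningMap).isIntertwining'⟩

theorem IsPPermutation.ind [Finite H] {ρ : Representation k G V} (h : IsPPermutation ρ) :
    IsPPermutation (Representation.ind φ ρ) := by
  obtain ⟨A, _, _, α, ⟨X, _, b, hb⟩, i, q, hiq⟩ := h
  refine ⟨_, _, _, Representation.ind φ α, ?_, indMap φ i, indMap φ q, ?_⟩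
  · refine isPermutation_coinvariants _ _ ((MonoidAlgebra.basis H k).tensorProduct b) ?_ ?_
    · rintro g ⟨y, x⟩
      obtain ⟨x', hx⟩ := hb g x
      exact ⟨(φ g * y, x'), by simp [Module.Basis.tensorProduct_apply, hx]⟩
    · rintro g ⟨y, x⟩
      exact ⟨(y * g⁻¹, x), by simp [Module.Basis.tensorProduct_apply]⟩
  · rw [← indMap_comp, hiq, indMap_id]

end Induction

/-! ### The tensor product of bimodules over `kH` -/

section Tensor

variable {k : Type u} {G H K : Type u} [Field k] [Group G] [Group H] [Group K]
variable {V W V' W' V'' W'' : Type u} [AddCommGroup V] [Module k V] [AddCommGroup W] [Module k W]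
  [AddCommGroup V'] [Module k V'] [AddCommGroup W'] [Module k W']
  [AddCommGroup V''] [Module k V''] [AddCommGroup W''] [Module k W'']

/-- The action `h ↦ (l ⊗ m ↦ l h⁻¹ ⊗ h m)` of `H` on `L ⊗ M`, for a `(kG, kH)`-bimodule `L` and a
`(kH, kK)`-bimodule `M`. -/
noncomputable def midAction (L : Representation k (G × H) V) (M : Representation k (H × K) W) :
    Representation k H (V ⊗[k] W) :=
  Representation.tprod (L.comp (MonoidHom.inr G H)) (M.comp (MonoidHom.inl H K))

/-- The map on `H`-coinvariants induced by a pair of bimodule morphisms. -/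
noncomputable def tensorMapAux {L : Representation k (G × H) V} {M : Representation k (H × K) W}
    {L' : Representation k (G × H) V'} {M' : Representation k (H × K) W'}
    (f : V →ₗ[k] V') (f' : W →ₗ[k] W')
    (hf : ∀ h x, f (L (1, h) x) = L' (1, h) (f x))
    (hf' : ∀ h x, f' (M (h, 1) x) = M' (h, 1) (f' x)) :
    (midAction L M).Coinvariants →ₗ[k] (midAction L' M').Coinvariants :=
  Representation.Coinvariants.map _ _ ⟨TensorProduct.map f f', fun h => by
    ext x y
    simp [midAction, hf, hf']⟩

/-- The `(kG, kK)`-bimodule `L ⊗_{kH} M`: the quotient of `L ⊗_k M` by the relations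
`l h⁻¹ ⊗ h m = l ⊗ m`, with the action of `G × K` induced by that of `G` on `L` and of `K` on
`M`. -/
noncomputable def tensorOver (L : Representation k (G × H) V) (M : Representation k (H × K) W) :
    Representation k (G × K) (midAction L M).Coinvariants where
  toFun x := tensorMapAux (L (x.1, 1)) (M (1, x.2))
    (fun h v => by simp only [← Module.End.mul_apply, ← map_mul]; simp)
    (fun h v => by simp only [← Module.End.mul_apply, ← map_mul]; simp)
  map_one' := by
    refine Representation.Coinvariants.hom_ext (TensorProduct.ext' fun v w => ?_)
    have h1 : L (1, 1) = 1 := map_one L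
    have h2 : M (1, 1) = 1 := map_one M
    simp [tensorMapAux, h1, h2]
  map_mul' x y := by
    refine Representation.Coinvariants.hom_ext (TensorProduct.ext' fun v w => ?_)
    have h1 : L (x.1 * y.1, 1) = L (x.1, 1) * L (y.1, 1) := by rw [← map_mul]; simp
    have h2 : M (1, x.2 * y.2) = M (1, x.2) * M (1, y.2) := by rw [← map_mul]; simp
    simp [tensorMapAux, h1, h2]

/-- Functoriality of the tensor product of bimodules. -/
noncomputable def tensorMap {L : Representation k (G × H) V} {M : Representation k (H × K) W}
    {L' : Representation k (G × H) V'} {M' : Representation k (H × K) W'}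
    (f : L.IntertwiningMap L') (f' : M.IntertwiningMap M') :
    (tensorOver L M).IntertwiningMap (tensorOver L' M') :=
  ⟨tensorMapAux f.toLinearMap f'.toLinearMap (fun h x => f.isIntertwining _ _ _ x)
    (fun h x => f'.isIntertwining _ _ _ x), fun x => by
    refine Representation.Coinvariants.hom_ext (TensorProduct.ext' fun v w => ?_)
    simp [tensorMapAux, tensorOver, f.isIntertwining, f'.isIntertwining]⟩

theorem tensorMap_mk {L : Representation k (G × H) V} {M : Representation k (H × K) W}
    {L' : Representation k (G × H) V'} {M' : Representation k (H × K) W'}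
    (f : L.IntertwiningMap L') (f' : M.IntertwiningMap M') (v : V) (w : W) :
    tensorMap f f' (Representation.Coinvariants.mk _ (v ⊗ₜ[k] w)) =
      Representation.Coinvariants.mk _ (f v ⊗ₜ[k] f' w) := rfl

theorem tensor_hom_ext {L : Representation k (G × H) V} {M : Representation k (H × K) W}
    {υ : Representation k (G × K) V'} {f g : (tensorOver L M).IntertwiningMap υ}
    (h : ∀ v w, f (Representation.Coinvariants.mk _ (v ⊗ₜ[k] w)) =
      g (Representation.Coinvariants.mk _ (v ⊗ₜ[k] w))) : f = g :=
  Representation.IntertwiningMap.ext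
    (Representation.Coinvariants.hom_ext (TensorProduct.ext' h))

theorem tensorMap_id (L : Representation k (G × H) V) (M : Representation k (H × K) W) :
    tensorMap (.id L) (.id M) = .id (tensorOver L M) :=
  tensor_hom_ext fun _ _ => rfl

theorem tensorMap_comp {L : Representation k (G × H) V} {M : Representation k (H × K) W}
    {L' : Representation k (G × H) V'} {M' : Representation k (H × K) W'}
    {L'' : Representation k (G × H) V''} {M'' : Representation k (H × K) W''}
    (f : L'.IntertwiningMap L'') (g : L.IntertwiningMap L')
    (f' : M'.IntertwiningMap M'') (g' : M.IntertwiningMap M') :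
    tensorMap (f.comp g) (f'.comp g') = (tensorMap f f').comp (tensorMap g g') :=
  tensor_hom_ext fun _ _ => rfl

theorem tensorMap_add_left {L : Representation k (G × H) V} {M : Representation k (H × K) W}
    {L' : Representation k (G × H) V'} {M' : Representation k (H × K) W'}
    (f g : L.IntertwiningMap L') (f' : M.IntertwiningMap M') :
    tensorMap (f + g) f' = tensorMap f f' + tensorMap g f' :=
  tensor_hom_ext fun v w => by
    change _ = tensorMap f f' _ + tensorMap g f' _
    rw [tensorMap_mk, tensorMap_mk, tensorMap_mk, ← map_add, ← TensorProduct.add_tmul]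
    rfl

theorem tensorMap_add_right {L : Representation k (G × H) V} {M : Representation k (H × K) W}
    {L' : Representation k (G × H) V'} {M' : Representation k (H × K) W'}
    (f : L.IntertwiningMap L') (f' g' : M.IntertwiningMap M') :
    tensorMap f (f' + g') = tensorMap f f' + tensorMap f g' :=
  tensor_hom_ext fun v w => by
    change _ = tensorMap f f' _ + tensorMap f g' _
    rw [tensorMap_mk, tensorMap_mk, tensorMap_mk, ← map_add, ← TensorProduct.tmul_add]
    rfl

theorem tensorMap_zero_left {L : Representation k (G × H) V} {M : Representation k (H × K) W}
    {L' : Representation k (G × H) V'} {M' : Representation k (H × K) W'}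
    (f' : M.IntertwiningMap M') : tensorMap (0 : L.IntertwiningMap L') f' = 0 := by
  simpa using tensorMap_add_left (0 : L.IntertwiningMap L') 0 f'

theorem tensorMap_zero_right {L : Representation k (G × H) V} {M : Representation k (H × K) W}
    {L' : Representation k (G × H) V'} {M' : Representation k (H × K) W'}
    (f : L.IntertwiningMap L') : tensorMap f (0 : M.IntertwiningMap M') = 0 := by
  simpa using tensorMap_add_right f (0 : M.IntertwiningMap M') 0

theorem tensorOver_prod_left (L : Representation k (G × H) V) (L' : Representation k (G × H) V')
    (M : Representation k (H × K) W) :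
    Nonempty ((tensorOver (L.prod L') M).Equiv ((tensorOver L M).prod (tensorOver L' M))) := by
  refine nonempty_equiv_prod (tensorMap (.inl k L L') (.id M)) (tensorMap (.inr k L L') (.id M))
    (tensorMap (.fst k L L') (.id M)) (tensorMap (.snd k L L') (.id M)) ?_ ?_ ?_ ?_ ?_
  · rw [← tensorMap_comp, fst_comp_inl]; exact tensorMap_id _ _
  · rw [← tensorMap_comp, snd_comp_inr]; exact tensorMap_id _ _
  · rw [← tensorMap_comp, fst_comp_inr, tensorMap_zero_left]
  · rw [← tensorMap_comp, snd_comp_inl, tensorMap_zero_left]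
  · rw [← tensorMap_comp, ← tensorMap_comp]
    refine (tensorMap_add_left _ _ _).symm.trans ?_
    rw [Representation.IntertwiningMap.coprod_inl_inr]
    exact tensorMap_id _ _

theorem tensorOver_prod_right (L : Representation k (G × H) V) (M : Representation k (H × K) W)
    (M' : Representation k (H × K) W') :
    Nonempty ((tensorOver L (M.prod M')).Equiv ((tensorOver L M).prod (tensorOver L M'))) := by
  refine nonempty_equiv_prod (tensorMap (.id L) (.inl k M M')) (tensorMap (.id L) (.inr k M M'))
    (tensorMap (.id L) (.fst k M M')) (tensorMap (.id L) (.snd k M M')) ?_ ?_ ?_ ?_ ?_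
  · rw [← tensorMap_comp, fst_comp_inl]; exact tensorMap_id _ _
  · rw [← tensorMap_comp, snd_comp_inr]; exact tensorMap_id _ _
  · rw [← tensorMap_comp, fst_comp_inr, tensorMap_zero_right]
  · rw [← tensorMap_comp, snd_comp_inl, tensorMap_zero_right]
  · rw [← tensorMap_comp, ← tensorMap_comp]
    refine (tensorMap_add_right _ _ _).symm.trans ?_
    rw [Representation.IntertwiningMap.coprod_inl_inr]
    exact tensorMap_id _ _

theorem tensorOver_equiv {L : Representation k (G × H) V} {L' : Representation k (G × H) V'}
    {M : Representation k (H × K) W} {M' : Representation k (H × K) W'}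
    (e : L.Equiv L') (f : M.Equiv M') :
    Nonempty ((tensorOver L M).Equiv (tensorOver L' M')) := by
  have h1 : e.toIntertwiningMap.comp e.symm.toIntertwiningMap = .id L' :=
    DFunLike.ext _ _ fun x => by simp
  have h2 : e.symm.toIntertwiningMap.comp e.toIntertwiningMap = .id L :=
    DFunLike.ext _ _ fun x => by simp
  have h3 : f.toIntertwiningMap.comp f.symm.toIntertwiningMap = .id M' :=
    DFunLike.ext _ _ fun x => by simp
  have h4 : f.symm.toIntertwiningMap.comp f.toIntertwiningMap = .id M :=
    DFunLike.ext _ _ fun x => by simp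
  have h5 := tensorMap_comp e.toIntertwiningMap e.symm.toIntertwiningMap
    f.toIntertwiningMap f.symm.toIntertwiningMap
  have h6 := tensorMap_comp e.symm.toIntertwiningMap e.toIntertwiningMap
    f.symm.toIntertwiningMap f.toIntertwiningMap
  rw [h1, h3, tensorMap_id] at h5
  rw [h2, h4, tensorMap_id] at h6
  exact ⟨Representation.Equiv.mk (LinearEquiv.ofLinearMap
    (tensorMap e.toIntertwiningMap f.toIntertwiningMap).toLinearMap
    (tensorMap e.symm.toIntertwiningMap f.symm.toIntertwiningMap).toLinearMap
    (congrArg (fun f => f.toLinearMap) h5.symm) (congrArg (fun f => f.toLinearMap) h6.symm))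
    (tensorMap e.toIntertwiningMap f.toIntertwiningMap).isIntertwining'⟩

theorem IsPPermutation.tensorOver {L : Representation k (G × H) V}
    {M : Representation k (H × K) W} (hL : IsPPermutation L) (hM : IsPPermutation M) :
    IsPPermutation (tensorOver L M) := by
  obtain ⟨A, _, _, α, ⟨X, _, b, hb⟩, i, q, hiq⟩ := hL
  obtain ⟨B, _, _, β, ⟨Y, _, c, hc⟩, i', q', hiq'⟩ := hM
  refine ⟨_, _, _, PPermutation.tensorOver α β, ?_, tensorMap i i', tensorMap q q', ?_⟩
  · refine isPermutation_coinvariants _ _ (b.tensorProduct c) ?_ ?_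
    · rintro h ⟨x, y⟩
      obtain ⟨x', hx⟩ := hb (1, h) x
      obtain ⟨y', hy⟩ := hc (h, 1) y
      exact ⟨(x', y'), by simp [Module.Basis.tensorProduct_apply, midAction, hx, hy]⟩
    · rintro ⟨g, z⟩ ⟨x, y⟩
      obtain ⟨x', hx⟩ := hb (g, 1) x
      obtain ⟨y', hy⟩ := hc (1, z) y
      exact ⟨(x', y'), by
        simp [Module.Basis.tensorProduct_apply, PPermutation.tensorOver, tensorMapAux, hx, hy]⟩
  · rw [← tensorMap_comp, hiq, hiq', tensorMap_id]

end Tensor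

/-! ### The Brauer construction -/

section Brauer

variable {k G : Type*} [Field k] [Group G]
variable {V W U : Type*} [AddCommGroup V] [Module k V] [AddCommGroup W] [Module k W]
  [AddCommGroup U] [Module k U]

/-- The `P`-fixed points of a `kG`-module. -/
noncomputable def fixedPoints (ρ : Representation k G V) (P : Subgroup G) : Submodule k V :=
  Representation.invariants (ρ.comp P.subtype)

theorem mem_fixedPoints {ρ : Representation k G V} {P : Subgroup G} {m : V} :
    m ∈ fixedPoints ρ P ↔ ∀ g ∈ P, ρ g m = m := by
  simp [fixedPoints, Representation.mem_invariants]

/-- The relative trace `∑ ρ(x) m`, where `x` runs over representatives of the cosets `P / Q`. -/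
noncomputable def relTrace (ρ : Representation k G V) (P : Subgroup G) (Q : Subgroup P) (m : V) :
    V :=
  ∑ᶠ x : P ⧸ Q, ρ ((Quotient.out x : P) : G) m

/-- The sum over all proper subgroups `Q` of `P` of the images of the relative traces from `Q` to
`P`. -/
noncomputable def traceSubmodule (ρ : Representation k G V) (P : Subgroup G) : Submodule k V :=
  Submodule.span k {t | ∃ Q : Subgroup P, Q ≠ ⊤ ∧
    ∃ m ∈ fixedPoints ρ (Q.map P.subtype), t = relTrace ρ P Q m}

/-- The Brauer construction `M[P]`: the fixed points of `P` modulo traces from proper subgroups. -/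
abbrev BrauerQuotient (ρ : Representation k G V) (P : Subgroup G) : Type _ :=
  fixedPoints ρ P ⧸ (traceSubmodule ρ P).submoduleOf (fixedPoints ρ P)

theorem map_mem_fixedPoints {ρ : Representation k G V} {P : Subgroup G}
    (n : Subgroup.normalizer (P : Set G)) {m : V} (hm : m ∈ fixedPoints ρ P) :
    ρ n m ∈ fixedPoints ρ P := by
  rw [mem_fixedPoints] at hm ⊢
  intro g hg
  have h1 : (n : G)⁻¹ * g * n ∈ P := (Subgroup.mem_set_normalizer_iff''.1 n.2 g).1 hg
  have h2 := hm _ h1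
  have h3 : g * n = n * ((n : G)⁻¹ * g * n) := by group
  rw [← Module.End.mul_apply, ← map_mul, h3, map_mul, Module.End.mul_apply, h2]

theorem relTrace_normalizer [Finite G] {ρ : Representation k G V} {P : Subgroup G}
    (n : Subgroup.normalizer (P : Set G)) (Q : Subgroup P) {m : V}
    (hm : m ∈ fixedPoints ρ (Q.map P.subtype)) :
    ρ n (relTrace ρ P Q m) =
      relTrace ρ P (Q.map (P.normalizerMonoidHom n).toMonoidHom) (ρ n m) := by
  have : Finite (P ⧸ Q) := inferInstance
  set a : P ≃* P := P.normalizerMonoidHom n with ha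
  have hav : ∀ x : P, ((a x : P) : G) = n * x * (n : G)⁻¹ := fun x => rfl
  set Q' : Subgroup P := Q.map a.toMonoidHom with hQ'
  have hQ : ∀ x : P, a x ∈ Q' ↔ x ∈ Q := fun x => by
    rw [hQ']
    exact Subgroup.mem_map_iff_mem (f := a.toMonoidHom) a.injective
  have hm' : ∀ q ∈ Q, ρ (q : G) m = m := fun q hq =>
    mem_fixedPoints.1 hm q ⟨q, hq, rfl⟩
  have hind : ∀ x y : P, x⁻¹ * y ∈ Q → ρ (x : G) m = ρ (y : G) m := fun x y h => by
    have e : (y : G) = x * ((x⁻¹ * y : P) : G) := by simp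
    rw [e, map_mul, Module.End.mul_apply, hm' _ h]
  let e : P ⧸ Q → P ⧸ Q' := fun x => QuotientGroup.mk (a (Quotient.out x))
  have hout : ∀ x : P ⧸ Q, QuotientGroup.mk (Quotient.out x) = x := fun x => Quotient.out_eq x
  have hout' : ∀ x : P ⧸ Q', QuotientGroup.mk (Quotient.out x) = x := fun x => Quotient.out_eq x
  have he : Function.Bijective e := by
    constructor
    · intro x y hxy
      have h1 := QuotientGroup.eq.1 hxy
      rw [← map_inv, ← map_mul, hQ] at h1
      rw [← hout x, ← hout y]
      exact QuotientGroup.eq.2 h1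
    · intro y
      refine ⟨QuotientGroup.mk (a.symm (Quotient.out y)), ?_⟩
      rw [← hout' y]
      refine QuotientGroup.eq.2 ?_
      rw [hout' y]
      have h1 := QuotientGroup.eq.1 (hout (QuotientGroup.mk (a.symm (Quotient.out y))))
      rw [← hQ] at h1
      simpa using h1
  have hfin : ∀ (f : P ⧸ Q → V), (Function.support f).Finite := fun f => Set.toFinite _
  rw [relTrace, relTrace, map_finsum _ (hfin _)]
  refine finsum_eq_of_bijective e he fun x => ?_
  have h1 := QuotientGroup.eq.1 (hout' (e x)).symm
  obtain ⟨q, hq⟩ := a.surjective ((Quotient.out x)⁻¹ |> a |> fun z => z * Quotient.out (e x))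
  have hqQ : q ∈ Q := by
    rw [← hQ, hq]
    simpa using h1
  have h2 : Quotient.out (e x) = a (Quotient.out x * q) := by
    rw [map_mul, hq]
    simp
  rw [h2, hav, ← Module.End.mul_apply, ← map_mul, ← Module.End.mul_apply, ← map_mul,
    inv_mul_cancel_right, Subgroup.coe_mul, map_mul, map_mul, map_mul]
  simp only [Module.End.mul_apply, hm' q hqQ]

theorem map_mem_traceSubmodule [Finite G] {ρ : Representation k G V} {P : Subgroup G}
    (n : Subgroup.normalizer (P : Set G)) {m : V} (hm : m ∈ traceSubmodule ρ P) :
    ρ n m ∈ traceSubmodule ρ P := by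
  suffices h : traceSubmodule ρ P ≤ (traceSubmodule ρ P).comap (ρ n) from h hm
  refine Submodule.span_le.2 ?_
  rintro _ ⟨Q, hQ, m, hm, rfl⟩
  refine Submodule.subset_span ⟨Q.map (P.normalizerMonoidHom n).toMonoidHom, ?_, ρ n m, ?_,
    relTrace_normalizer n Q hm⟩
  · intro h
    refine hQ ((Subgroup.eq_top_iff' Q).2 fun x => ?_)
    have h1 : P.normalizerMonoidHom n x ∈ Q.map (P.normalizerMonoidHom n).toMonoidHom := by
      rw [h]; trivial
    exact (Subgroup.mem_map_iff_mem (f := (P.normalizerMonoidHom n).toMonoidHom)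
      (P.normalizerMonoidHom n).injective).1 h1
  · rw [mem_fixedPoints] at hm ⊢
    rintro _ ⟨_, ⟨q, hq, rfl⟩, rfl⟩
    have h1 := hm q ⟨q, hq, rfl⟩
    have h2 : P.subtype ((P.normalizerMonoidHom n).toMonoidHom q) = n * q * (n : G)⁻¹ := rfl
    rw [h2, ← Module.End.mul_apply, ← map_mul, inv_mul_cancel_right, map_mul,
      Module.End.mul_apply, h1]

/-- The action of the normalizer of `P` on the Brauer construction `M[P]`. -/
noncomputable def brauerRep [Finite G] (ρ : Representation k G V) (P : Subgroup G) :
    Representation k (Subgroup.normalizer (P : Set G)) (BrauerQuotient ρ P) where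
  toFun n := Submodule.mapQ _ _ ((ρ n).restrict fun _ hm => map_mem_fixedPoints n hm)
    fun _ hm => map_mem_traceSubmodule n hm
  map_one' := by
    refine Submodule.linearMap_qext _ (LinearMap.ext fun x => ?_)
    simp
    rfl
  map_mul' a b := by
    refine Submodule.linearMap_qext _ (LinearMap.ext fun x => ?_)
    simp
    rfl

theorem map_fixedPoints {ρ : Representation k G V} {σ : Representation k G W} (P : Subgroup G)
    (f : ρ.IntertwiningMap σ) {m : V} (hm : m ∈ fixedPoints ρ P) :
    f.toLinearMap m ∈ fixedPoints σ P := by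
  rw [mem_fixedPoints] at hm ⊢
  intro g hg
  have := f.isIntertwining _ _ g m
  rw [hm g hg] at this
  exact this.symm

theorem map_traceSubmodule [Finite G] {ρ : Representation k G V} {σ : Representation k G W}
    (P : Subgroup G) (f : ρ.IntertwiningMap σ) {m : V} (hm : m ∈ traceSubmodule ρ P) :
    f.toLinearMap m ∈ traceSubmodule σ P := by
  suffices h : traceSubmodule ρ P ≤ (traceSubmodule σ P).comap f.toLinearMap from h hm
  refine Submodule.span_le.2 ?_
  rintro _ ⟨Q, hQ, m, hm, rfl⟩
  refine Submodule.subset_span ⟨Q, hQ, f.toLinearMap m, map_fixedPoints _ f hm, ?_⟩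
  have hfin : ∀ (g : P ⧸ Q → V), (Function.support g).Finite := fun g => Set.toFinite _
  rw [relTrace, relTrace, map_finsum _ (hfin _)]
  exact finsum_congr fun x => f.isIntertwining _ _ _ m

/-- Functoriality of the Brauer construction. -/
noncomputable def brauerMap [Finite G] {ρ : Representation k G V} {σ : Representation k G W}
    (P : Subgroup G) (f : ρ.IntertwiningMap σ) :
    (brauerRep ρ P).IntertwiningMap (brauerRep σ P) :=
  ⟨Submodule.mapQ _ _ (f.toLinearMap.restrict fun _ hm => map_fixedPoints P f hm)
    fun _ hm => map_traceSubmodule P f hm, fun n => by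
    refine Submodule.linearMap_qext _ (LinearMap.ext fun x => ?_)
    refine congrArg (Submodule.mkQ _) (Subtype.ext ?_)
    exact f.isIntertwining _ _ _ _⟩

theorem brauer_hom_ext [Finite G] {ρ : Representation k G V} {P : Subgroup G}
    {υ : Representation k (Subgroup.normalizer (P : Set G)) U}
    {f g : (brauerRep ρ P).IntertwiningMap υ}
    (h : ∀ x, f (Submodule.Quotient.mk x) = g (Submodule.Quotient.mk x)) : f = g :=
  Representation.IntertwiningMap.ext (Submodule.linearMap_qext _ (LinearMap.ext h))

theorem brauerMap_id [Finite G] (ρ : Representation k G V) (P : Subgroup G) :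
    brauerMap P (.id ρ) = .id _ := brauer_hom_ext fun _ => rfl

theorem brauerMap_comp [Finite G] {ρ : Representation k G V} {σ : Representation k G W}
    {υ : Representation k G U} (P : Subgroup G) (f : σ.IntertwiningMap υ)
    (g : ρ.IntertwiningMap σ) :
    brauerMap P (f.comp g) = (brauerMap P f).comp (brauerMap P g) :=
  brauer_hom_ext fun _ => rfl

theorem brauerMap_add [Finite G] {ρ : Representation k G V} {σ : Representation k G W}
    (P : Subgroup G) (f g : ρ.IntertwiningMap σ) :
    brauerMap P (f + g) = brauerMap P f + brauerMap P g :=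
  brauer_hom_ext fun _ => rfl

theorem brauerMap_zero [Finite G] (ρ : Representation k G V) (σ : Representation k G W)
    (P : Subgroup G) : brauerMap P (0 : ρ.IntertwiningMap σ) = 0 :=
  brauer_hom_ext fun _ => rfl

theorem brauerRep_equiv [Finite G] {ρ : Representation k G V} {σ : Representation k G W}
    (e : ρ.Equiv σ) (P : Subgroup G) : Nonempty ((brauerRep ρ P).Equiv (brauerRep σ P)) := by
  have h1 : e.toIntertwiningMap.comp e.symm.toIntertwiningMap = .id σ :=
    DFunLike.ext _ _ fun x => by simp
  have h2 : e.symm.toIntertwiningMap.comp e.toIntertwiningMap = .id ρ :=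
    DFunLike.ext _ _ fun x => by simp
  have h3 := brauerMap_comp P e.toIntertwiningMap e.symm.toIntertwiningMap
  have h4 := brauerMap_comp P e.symm.toIntertwiningMap e.toIntertwiningMap
  rw [h1, brauerMap_id] at h3
  rw [h2, brauerMap_id] at h4
  exact ⟨Representation.Equiv.mk (LinearEquiv.ofLinearMap
    (brauerMap P e.toIntertwiningMap).toLinearMap (brauerMap P e.symm.toIntertwiningMap).toLinearMap
    (congrArg (fun f => f.toLinearMap) h3.symm) (congrArg (fun f => f.toLinearMap) h4.symm))
    (brauerMap P e.toIntertwiningMap).isIntertwining'⟩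

theorem brauerRep_prod [Finite G] (ρ : Representation k G V) (σ : Representation k G W)
    (P : Subgroup G) :
    Nonempty ((brauerRep (ρ.prod σ) P).Equiv ((brauerRep ρ P).prod (brauerRep σ P))) := by
  refine nonempty_equiv_prod (brauerMap P (.inl k ρ σ)) (brauerMap P (.inr k ρ σ))
    (brauerMap P (.fst k ρ σ)) (brauerMap P (.snd k ρ σ)) ?_ ?_ ?_ ?_ ?_
  · rw [← brauerMap_comp, fst_comp_inl, brauerMap_id]
  · rw [← brauerMap_comp, snd_comp_inr, brauerMap_id]
  · rw [← brauerMap_comp, fst_comp_inr, brauerMap_zero]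
  · rw [← brauerMap_comp, snd_comp_inl, brauerMap_zero]
  · rw [← brauerMap_comp, ← brauerMap_comp, ← brauerMap_add,
      Representation.IntertwiningMap.coprod_inl_inr, brauerMap_id]

end Brauer

/-! ### Brauer characters -/

section BrauerCharacter

variable {k F : Type*} [Field k] [Field F]

open Classical in
/-- The lift to `F` of a root of unity of `k`, given by a homomorphism `φ` from the group of roots
of unity of `k` to `Fˣ`. -/
noncomputable def liftRoot (φ : CommGroup.torsion kˣ →* Fˣ) (x : k) : F :=
  if h : ∃ z : CommGroup.torsion kˣ, ((z : kˣ) : k) = x then (φ h.choose : Fˣ) else 0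

/-- The sum of the lifts of the eigenvalues of `f`, counted with multiplicities. -/
noncomputable def liftTrace (φ : CommGroup.torsion kˣ →* Fˣ) {V : Type*} [AddCommGroup V]
    [Module k V] [Module.Finite k V] (f : Module.End k V) : F :=
  (f.charpoly.roots.map (liftRoot φ)).sum

/-- `τ_{P,u}(ρ)`: the value at `u` of the Brauer character of the Brauer construction of `ρ` at
`P`. -/
noncomputable def tau (φ : CommGroup.torsion kˣ →* Fˣ) {G : Type*} [Group G] [Finite G]
    (P : Subgroup G) (u : Subgroup.normalizer (P : Set G)) {V : Type*} [AddCommGroup V]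
    [Module k V] [Module.Finite k V] (ρ : Representation k G V) : F :=
  liftTrace φ (brauerRep ρ P u)

variable (φ : CommGroup.torsion kˣ →* Fˣ) {V W : Type*} [AddCommGroup V]
  [Module k V] [Module.Finite k V] [AddCommGroup W] [Module k W] [Module.Finite k W]

theorem liftTrace_equiv {G : Type*} [Group G] {ρ : Representation k G V}
    {σ : Representation k G W} (e : ρ.Equiv σ) (g : G) :
    liftTrace φ (ρ g) = liftTrace φ (σ g) := by
  have : σ g = e.toLinearEquiv.conj (ρ g) := by
    refine LinearMap.ext fun x => ?_
    rw [LinearEquiv.conj_apply_apply]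
    have h := e.toIntertwiningMap.isIntertwining _ _ g (e.toLinearEquiv.symm x)
    have h2 : e.toIntertwiningMap (e.toLinearEquiv.symm x) = x :=
      e.toLinearEquiv.apply_symm_apply x
    rw [h2] at h
    exact h.symm
  rw [liftTrace, liftTrace, this, LinearEquiv.charpoly_conj]

theorem liftTrace_prodMap (f : Module.End k V) (g : Module.End k W) :
    liftTrace φ (f.prodMap g) = liftTrace φ f + liftTrace φ g := by
  rw [liftTrace, LinearMap.charpoly_prodMap, Polynomial.roots_mul
    ((LinearMap.charpoly_monic f).mul (LinearMap.charpoly_monic g)).ne_zero]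
  simp [liftTrace]

variable {G : Type*} [Group G] [Finite G] (P : Subgroup G)
  (u : Subgroup.normalizer (P : Set G))

theorem tau_equiv {ρ : Representation k G V} {σ : Representation k G W} (e : ρ.Equiv σ) :
    tau φ P u ρ = tau φ P u σ := by
  obtain ⟨e'⟩ := brauerRep_equiv e P
  exact liftTrace_equiv φ e' u

theorem tau_prod (ρ : Representation k G V) (σ : Representation k G W) :
    tau φ P u (ρ.prod σ) = tau φ P u ρ + tau φ P u σ := by
  obtain ⟨e⟩ := brauerRep_prod ρ σ P
  rw [tau, liftTrace_equiv φ e u]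
  exact liftTrace_prodMap φ _ _

end BrauerCharacter

/-! ### The Grothendieck group of p-permutation modules -/

/-- A finitely generated p-permutation `kG`-module. -/
structure PPerm (k G : Type u) [Field k] [Group G] where
  /-- The underlying space. -/
  V : Type u
  [instAddCommGroup : AddCommGroup V]
  [instModule : Module k V]
  [instFinite : Module.Finite k V]
  /-- The action of `G`. -/
  ρ : Representation k G V
  isPPermutation : IsPPermutation ρ

attribute [instance] PPerm.instAddCommGroup PPerm.instModule PPerm.instFinite

section Grothendieck

variable {k G : Type u} [Field k] [Group G]

/-- Isomorphism of p-permutation modules. -/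
instance PPerm.setoid : Setoid (PPerm k G) where
  r M N := Nonempty (M.ρ.Equiv N.ρ)
  iseqv :=
    { refl := fun M => ⟨.refl M.ρ⟩
      symm := fun ⟨e⟩ => ⟨e.symm⟩
      trans := fun ⟨e⟩ ⟨f⟩ => ⟨e.trans f⟩ }

/-- The direct sum of p-permutation modules. -/
noncomputable def PPerm.prod (M N : PPerm k G) : PPerm k G where
  V := M.V × N.V
  ρ := M.ρ.prod N.ρ
  isPPermutation := M.isPPermutation.prod N.isPPermutation

/-- The zero module. -/
noncomputable def PPerm.zero : PPerm k G where
  V := PUnit.{u + 1}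
  ρ := 1
  isPPermutation := ⟨PUnit.{u + 1}, inferInstance, inferInstance, 1,
    ⟨PEmpty, inferInstance, Module.Basis.empty _, fun _ x => x.elim⟩, .id _, .id _, rfl⟩

variable (k G) in
/-- Isomorphism classes of p-permutation modules. -/
def IsoClass : Type (u + 1) := Quotient (PPerm.setoid (k := k) (G := G))

/-- The isomorphism class of a p-permutation module. -/
def IsoClass.mk (M : PPerm k G) : IsoClass k G := Quotient.mk _ M

noncomputable instance : Add (IsoClass k G) where
  add := Quotient.map₂ PPerm.prod (by
    rintro M M' ⟨e⟩ N N' ⟨f⟩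
    refine ⟨Representation.Equiv.mk (e.toLinearEquiv.prodCongr f.toLinearEquiv) fun g => ?_⟩
    refine LinearMap.ext fun x => Prod.ext ?_ ?_
    · exact e.toIntertwiningMap.isIntertwining _ _ g x.1
    · exact f.toIntertwiningMap.isIntertwining _ _ g x.2)

noncomputable instance : Zero (IsoClass k G) where
  zero := IsoClass.mk PPerm.zero

/-- The commutative monoid of isomorphism classes, under direct sum. -/
noncomputable instance : AddCommMonoid (IsoClass k G) where
  add_assoc := by
    rintro ⟨L⟩ ⟨M⟩ ⟨N⟩
    exact Quotient.sound ⟨Representation.Equiv.mk (LinearEquiv.prodAssoc k L.V M.V N.V)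
      fun g => rfl⟩
  add_comm := by
    rintro ⟨M⟩ ⟨N⟩
    exact Quotient.sound ⟨Representation.Equiv.mk (LinearEquiv.prodComm k M.V N.V) fun g => rfl⟩
  zero_add := by
    rintro ⟨M⟩
    exact Quotient.sound ⟨Representation.Equiv.mk (LinearEquiv.uniqueProd (R := k) (M := M.V)
      (M₂ := PUnit.{u + 1})) fun g => rfl⟩
  add_zero := by
    rintro ⟨M⟩
    exact Quotient.sound ⟨Representation.Equiv.mk (LinearEquiv.prodUnique (R := k) (M := M.V)
      (M₂ := PUnit.{u + 1})) fun g => rfl⟩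
  nsmul := nsmulRec

variable (k G) in
/-- `T(G)`: the Grothendieck group of p-permutation `kG`-modules with respect to direct sums. -/
abbrev T : Type (u + 1) := Algebra.GrothendieckAddGroup (IsoClass k G)

/-- The class of a p-permutation module in `T(G)`. -/
noncomputable def PPerm.cls (M : PPerm k G) : T k G :=
  Algebra.GrothendieckAddGroup.of (IsoClass.mk M)

theorem PPerm.cls_eq {M N : PPerm k G} (e : Nonempty (M.ρ.Equiv N.ρ)) : M.cls = N.cls :=
  congrArg Algebra.GrothendieckAddGroup.of (Quotient.sound (s := PPerm.setoid) e)

theorem PPerm.cls_prod (M N : PPerm k G) : (M.prod N).cls = M.cls + N.cls :=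
  map_add Algebra.GrothendieckAddGroup.of (IsoClass.mk M) (IsoClass.mk N)

/-- An additive isomorphism invariant of p-permutation modules, as a homomorphism on the monoid of
isomorphism classes. -/
noncomputable def IsoClass.lift {A : Type*} [AddCommGroup A] (f : PPerm k G → A)
    (hiso : ∀ M N : PPerm k G, Nonempty (M.ρ.Equiv N.ρ) → f M = f N)
    (hadd : ∀ M N : PPerm k G, f (M.prod N) = f M + f N) : IsoClass k G →+ A where
  toFun := Quotient.lift f hiso
  map_zero' := by
    have h : f PPerm.zero = f (PPerm.prod PPerm.zero PPerm.zero) :=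
      hiso _ _ ⟨Representation.Equiv.mk (LinearEquiv.uniqueProd (R := k) (M := PUnit.{u + 1})
        (M₂ := PUnit.{u + 1})).symm fun g => rfl⟩
    rw [hadd] at h
    exact left_eq_add.1 h
  map_add' := by
    rintro ⟨M⟩ ⟨N⟩
    exact hadd M N

/-- The extension of an additive isomorphism invariant of p-permutation modules to `T(G)`. -/
noncomputable def T.lift {A : Type*} [AddCommGroup A] (f : PPerm k G → A)
    (hiso : ∀ M N : PPerm k G, Nonempty (M.ρ.Equiv N.ρ) → f M = f N)
    (hadd : ∀ M N : PPerm k G, f (M.prod N) = f M + f N) : T k G →+ A :=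
  Algebra.GrothendieckAddGroup.lift (IsoClass.lift f hiso hadd)

theorem T.lift_cls {A : Type*} [AddCommGroup A] (f : PPerm k G → A)
    (hiso : ∀ M N : PPerm k G, Nonempty (M.ρ.Equiv N.ρ) → f M = f N)
    (hadd : ∀ M N : PPerm k G, f (M.prod N) = f M + f N) (M : PPerm k G) :
    T.lift f hiso hadd M.cls = f M :=
  DFunLike.congr_fun (Algebra.GrothendieckAddGroup.lift.symm_apply_apply
    (IsoClass.lift f hiso hadd)) (IsoClass.mk M)

/-- Homomorphisms on `T(G)` that agree on classes of modules are equal. -/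
theorem T.hom_ext {A : Type*} [AddCommGroup A] {f g : T k G →+ A}
    (h : ∀ M : PPerm k G, f M.cls = g M.cls) : f = g := by
  refine Algebra.GrothendieckAddGroup.lift.symm.injective (AddMonoidHom.ext ?_)
  rintro ⟨M⟩
  exact h M

variable (F : Type v) [Field F]

variable (k G) in
/-- `F T(G) = F ⊗ T(G)`. -/
abbrev FT : Type _ := F ⊗[ℤ] T k G

/-- The class of a p-permutation module in `F T(G)`. -/
noncomputable def PPerm.clsF (M : PPerm k G) : FT k G F := (1 : F) ⊗ₜ[ℤ] M.cls

variable {F}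

/-- The `F`-linear extension of `τ_{P,u}` to `F T(G)`. -/
noncomputable def tauF [Finite G] (φ : CommGroup.torsion kˣ →* Fˣ) (P : Subgroup G)
    (u : Subgroup.normalizer (P : Set G)) : FT k G F →ₗ[F] F :=
  (T.lift (fun M : PPerm k G => tau φ P u M.ρ) (fun _ _ ⟨e⟩ => tau_equiv φ P u e)
    (fun M N => tau_prod φ P u M.ρ N.ρ)).toIntLinearMap.liftBaseChange F

end Grothendieck

section Operations

variable {k G H K : Type u} [Field k] [Group G] [Group H] [Group K]

/-- `Ind_{ΔG}^{G×G} M`, where `G` is identified with the diagonal subgroup `ΔG` of `G × G`. -/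
noncomputable def PPerm.indDiag [Finite G] (M : PPerm k G) : PPerm k (G × G) where
  V := Representation.IndV ((MonoidHom.id G).prod (MonoidHom.id G)) M.ρ
  instFinite := by
    have : Module.Finite k (MonoidAlgebra k (G × G)) :=
      Module.Finite.of_basis (MonoidAlgebra.basis (G × G) k)
    infer_instance
  ρ := Representation.ind ((MonoidHom.id G).prod (MonoidHom.id G)) M.ρ
  isPPermutation := M.isPPermutation.ind _

theorem PPerm.indDiag_prod [Finite G] (M N : PPerm k G) :
    Nonempty ((M.prod N).indDiag.ρ.Equiv (M.indDiag.prod N.indDiag).ρ) :=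
  ind_prod _ M.ρ N.ρ

theorem PPerm.indDiag_equiv [Finite G] {M N : PPerm k G} (e : M.ρ.Equiv N.ρ) :
    Nonempty (M.indDiag.ρ.Equiv N.indDiag.ρ) :=
  ind_equiv _ e

/-- The map `F T(G) → F T(G × G)`, `W ↦ W̃ = Ind_{ΔG}^{G×G} W`. -/
noncomputable def tilde {F : Type v} [Field F] [Finite G] : FT k G F →ₗ[F] FT k (G × G) F :=
  (T.lift (fun M : PPerm k G => M.indDiag.cls)
    (fun _ _ ⟨e⟩ => PPerm.cls_eq (PPerm.indDiag_equiv e))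
    (fun M N => (PPerm.cls_eq (PPerm.indDiag_prod M N)).trans
      (PPerm.cls_prod _ _))).toIntLinearMap.baseChange F

/-- The p-permutation bimodule `L ⊗_{kH} M`. -/
noncomputable def PPerm.tensor (L : PPerm k (G × H)) (M : PPerm k (H × K)) : PPerm k (G × K) where
  V := (midAction L.ρ M.ρ).Coinvariants
  ρ := tensorOver L.ρ M.ρ
  isPPermutation := L.isPPermutation.tensorOver M.isPPermutation

theorem PPerm.tensor_prod_left (L L' : PPerm k (G × H)) (M : PPerm k (H × K)) :
    Nonempty (((L.prod L').tensor M).ρ.Equiv ((L.tensor M).prod (L'.tensor M)).ρ) :=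
  tensorOver_prod_left L.ρ L'.ρ M.ρ

theorem PPerm.tensor_prod_right (L : PPerm k (G × H)) (M M' : PPerm k (H × K)) :
    Nonempty ((L.tensor (M.prod M')).ρ.Equiv ((L.tensor M).prod (L.tensor M')).ρ) :=
  tensorOver_prod_right L.ρ M.ρ M'.ρ

theorem PPerm.tensor_equiv {L L' : PPerm k (G × H)} {M M' : PPerm k (H × K)}
    (e : L.ρ.Equiv L'.ρ) (f : M.ρ.Equiv M'.ρ) :
    Nonempty ((L.tensor M).ρ.Equiv (L'.tensor M').ρ) :=
  tensorOver_equiv e f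

/-- The biadditive map `T(G × H) × T(H × K) → T(G × K)` induced by `(L, M) ↦ L ⊗_{kH} M`. -/
noncomputable def tensorT : T k (G × H) →+ T k (H × K) →+ T k (G × K) :=
  T.lift (fun L => T.lift (fun M => (L.tensor M).cls)
      (fun _ _ ⟨e⟩ => PPerm.cls_eq (PPerm.tensor_equiv (.refl L.ρ) e))
      (fun M N => (PPerm.cls_eq (PPerm.tensor_prod_right L M N)).trans (PPerm.cls_prod _ _)))
    (fun L L' ⟨e⟩ => T.hom_ext fun M => by
      rw [T.lift_cls, T.lift_cls]
      exact PPerm.cls_eq (PPerm.tensor_equiv e (.refl M.ρ)))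
    (fun L L' => T.hom_ext fun M => by
      rw [AddMonoidHom.add_apply, T.lift_cls, T.lift_cls, T.lift_cls]
      exact (PPerm.cls_eq (PPerm.tensor_prod_left L L' M)).trans (PPerm.cls_prod _ _))

/-- The `F`-bilinear extension `F T(G × H) × F T(H × K) → F T(G × K)` of `- ⊗_{kH} -`. -/
noncomputable def tensorF {F : Type v} [Field F] :
    FT k (G × H) F →ₗ[F] FT k (H × K) F →ₗ[F] FT k (G × K) F :=
  (LinearMap.baseChangeHom ℤ F (T k (H × K)) (T k (G × K)) ∘ₗ
    (addMonoidHomLequivInt ℤ).toLinearMap ∘ₗ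
      (tensorT (k := k) (G := G) (H := H) (K := K)).toIntLinearMap).liftBaseChange F

end Operations

/-! ### Pairs and the associated idempotents -/

/-- A pair `(P, s)` of `G`: a `p`-subgroup `P` of `G` and a `p'`-element `s` of its normalizer. -/
structure Pair (p : ℕ) (G : Type*) [Group G] where
  /-- The `p`-subgroup. -/
  P : Subgroup G
  /-- The `p'`-element. -/
  s : G
  isPGroup : IsPGroup p P
  mem_normalizer : s ∈ Subgroup.normalizer (P : Set G)
  coprime : (orderOf s).Coprime p

namespace Pair

variable {p : ℕ} {G K : Type*} [Group G] [Group K]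

/-- Conjugacy of pairs of `G`. -/
def IsConj (x y : Pair p G) : Prop :=
  ∃ g : G, y.P = x.P.map (MulAut.conj g).toMonoidHom ∧ y.s = g * x.s * g⁻¹

/-- The group `P⟨s⟩`, as a subgroup of `G`. -/
def grp (x : Pair p G) : Subgroup G := x.P ⊔ Subgroup.zpowers x.s

/-- The element `s` of `P⟨s⟩`. -/
def gen (x : Pair p G) : x.grp :=
  ⟨x.s, (le_sup_right : Subgroup.zpowers x.s ≤ x.grp) (Subgroup.mem_zpowers x.s)⟩

/-- Two pairs are isomorphic if there is an isomorphism `P⟨s⟩ → Q⟨t⟩` sending `s` to a conjugate of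
`t`. -/
def Iso (x : Pair p G) (y : Pair p K) : Prop :=
  ∃ f : x.grp ≃* y.grp, _root_.IsConj (f x.gen) y.gen

/-- The subgroup `C_{⟨s⟩}(P)` of `P⟨s⟩`. -/
def cent (x : Pair p G) : Subgroup x.grp :=
  (Subgroup.zpowers x.s ⊓ Subgroup.centralizer (x.P : Set G)).subgroupOf x.grp

instance normal_cent (x : Pair p G) : x.cent.Normal := by
  have h : x.grp ≤ Subgroup.centralizer
      ((Subgroup.zpowers x.s ⊓ Subgroup.centralizer (x.P : Set G) : Subgroup G) : Set G) := by
    refine sup_le ?_ ?_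
    · intro a ha
      rw [Subgroup.mem_centralizer_iff]
      rintro b ⟨-, hb⟩
      exact (Subgroup.mem_centralizer_iff.1 hb a ha).symm
    · intro a ha
      rw [Subgroup.mem_centralizer_iff]
      rintro b ⟨hb, -⟩
      obtain ⟨m, rfl⟩ := Subgroup.mem_zpowers_iff.1 ha
      obtain ⟨n, rfl⟩ := Subgroup.mem_zpowers_iff.1 hb
      exact (Commute.refl x.s).zpow_zpow n m
  refine ⟨fun a ha g => ?_⟩
  have h1 : (a : G) * g = g * a := Subgroup.mem_centralizer_iff.1 (h g.2) a ha
  have h2 : g * a * g⁻¹ = a := by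
    rw [mul_inv_eq_iff_eq_mul]
    exact Subtype.ext h1.symm
  rw [h2]
  exact ha

/-- The pair `(P̃, s̃) = (P C_{⟨s⟩}(P) / C_{⟨s⟩}(P), s C_{⟨s⟩}(P))` of `P⟨s⟩ / C_{⟨s⟩}(P)` associated
with `(P, s)`. -/
def assoc (x : Pair p G) : Pair p (x.grp ⧸ x.cent) where
  P := (x.P.subgroupOf x.grp).map (QuotientGroup.mk' x.cent)
  s := QuotientGroup.mk' x.cent x.gen
  isPGroup := (x.isPGroup.comap_of_injective x.grp.subtype x.grp.subtype_injective).map _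
  mem_normalizer := by
    have h1 : x.gen ∈ Subgroup.normalizer ((x.P.subgroupOf x.grp : Subgroup x.grp) : Set x.grp) :=
      fun n => x.mem_normalizer n
    exact Subgroup.le_normalizer_map _ ⟨x.gen, h1, rfl⟩
  coprime := by
    have h1 : orderOf x.gen = orderOf x.s :=
      (orderOf_injective x.grp.subtype x.grp.subtype_injective x.gen).symm
    exact Nat.Coprime.coprime_dvd_left ((orderOf_map_dvd _ _).trans (dvd_of_eq h1)) x.coprime

end Pair

section Idempotents

variable {k G : Type u} [Field k] [Group G] [Finite G] {F : Type v} [Field F] {p : ℕ}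

/-- The defining property of the idempotent `F^G_{P,u}`: for every pair `(Q, t)` of `G`, the value
`τ_{Q,t}(e)` is `1` if `(Q, t)` is `G`-conjugate to `(P, u)`, and `0` otherwise. -/
def IsIdem (φ : CommGroup.torsion kˣ →* Fˣ) (x : Pair p G) (e : FT k G F) : Prop :=
  ∀ y : Pair p G, (x.IsConj y → tauF φ y.P ⟨y.s, y.mem_normalizer⟩ e = 1) ∧
    (¬ x.IsConj y → tauF φ y.P ⟨y.s, y.mem_normalizer⟩ e = 0)

open Classical in
/-- The idempotent `F^G_{P,u}` of `F T(G)`: the element with the defining property. -/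
noncomputable def idem (φ : CommGroup.torsion kˣ →* Fˣ) (x : Pair p G) : FT k G F :=
  if h : ∃ e : FT k G F, IsIdem φ x e then h.choose else 0

end Idempotents

end PPermutation

namespace PPermutation

/-! ### Lifted traces of diagonalizable maps -/

section LiftTrace

variable {k F : Type*} [Field k] [Field F] (φ : CommGroup.torsion kˣ →* Fˣ)

/-! The species τ_{D,d}, for pairs (D, d) of G × K, turn the statement into one about pairs.
Inducing from the diagonal and tensoring over kG is an ordinary tensor product: (Ind V) ⊗_{kG} W ≅ V
⊗_k W with K acting trivially on V, and likewise on the right (`nonempty_tensorOver_ind_equiv`,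
`nonempty_tensorOver_ind_equiv'`). The Brauer construction of p-permutation modules commutes with
tensor products (`brauerTensor`) and lifted traces multiply, so τ_{D,d} of the triple product is
τ_{D,d}(M) times the values of F_{P,r} and F_{Q,u} at the two projections of (D, d). This is
τ_{D,d}(M) if these projections are conjugate to (P, r) and (Q, u), and 0 otherwise. Since the
species separate the elements of FT(G × K), the triple product is nonzero exactly when some such (D,
d) has τ_{D,d}(M) ≠ 0.

If the vertices are twisted diagonal, a nonzero species at (D, d) forces D into a conjugate of a
twisted diagonal subgroup. Then D projects injectively to both factors and yields an isomorphism P ≅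
Q that intertwines conjugation by r and by u (`Pair.SubgroupIso`). Conversely, the graph D of such
an isomorphism gives a pair (D, (r, u)), and a suitable summand of k[(G × K)/D] has a nonzero
species there. Finally P⟨r⟩/C_{⟨r⟩}(P) is P extended by the group of automorphisms that r generates,
so an equivariant isomorphism P ≅ Q amounts to an isomorphism of the associated pairs
(`Pair.SubgroupIso.assoc_iso`, `Pair.Iso.subgroupIso`).

Two facts on species carry the argument. The idempotents exist (`exists_isIdem`) because, for a pair
(P, s), the eigenspaces of right multiplication by s⁻¹ on k[G/P], weighted by their lifted
eigenvalues, have species that count fixed cosets; this matrix is triangular in the order of P with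
nonzero diagonal. The species separate elements (`eq_zero_of_tauF_eq_zero`) because there are at
most as many indecomposable p-permutation modules as classes of pairs. Indeed, the trace of an
endomorphism of a permutation module on the multiplicity space of an indecomposable M is a
combination, with coefficients independent of M, of traces attached to pairs
(`mem_pairTraces_permRep`). Identity maps of indecomposables have multiplicity traces 0 or 1
according to isomorphism, so their coefficient vectors are linearly independent. -/

theorem liftRoot_coe (z : CommGroup.torsion kˣ) : liftRoot φ ((z : kˣ) : k) = (φ z : F) := by
  have h : ∃ w : CommGroup.torsion kˣ, ((w : kˣ) : k) = ((z : kˣ) : k) := ⟨z, rfl⟩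
  rw [liftRoot, dif_pos h]
  have : h.choose = z := Subtype.ext (Units.ext h.choose_spec)
  rw [this]

theorem exists_torsion_of_pow_eq_one {n : ℕ} (hn : n ≠ 0) {x : k} (hx : x ^ n = 1) :
    ∃ z : CommGroup.torsion kˣ, ((z : kˣ) : k) = x ∧ z ^ n = 1 := by
  have h1 : (Units.ofPowEqOne x n hx hn) ^ n = 1 := Units.ext (by simp)
  refine ⟨⟨Units.ofPowEqOne x n hx hn,
    isOfFinOrder_iff_pow_eq_one.2 ⟨n, Nat.pos_of_ne_zero hn, h1⟩⟩, rfl, Subtype.ext ?_⟩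
  simp

/-- Off the roots of unity `liftRoot` takes the default value 0 and need not be multiplicative;
hence the two exponents. -/
theorem liftRoot_mul {m n : ℕ} (hm : m ≠ 0) (hn : n ≠ 0) {x y : k} (hx : x ^ m = 1)
    (hy : y ^ n = 1) : liftRoot φ (x * y) = liftRoot φ x * liftRoot φ y := by
  obtain ⟨z, rfl, -⟩ := exists_torsion_of_pow_eq_one hm hx
  obtain ⟨w, rfl, -⟩ := exists_torsion_of_pow_eq_one hn hy
  have := liftRoot_coe φ (z * w)
  rw [Subgroup.coe_mul, Units.val_mul] at this
  rw [this, liftRoot_coe, liftRoot_coe, map_mul, Units.val_mul]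

theorem liftRoot_pow {n : ℕ} (hn : n ≠ 0) {x : k} (hx : x ^ n = 1) (m : ℕ) :
    liftRoot φ (x ^ m) = liftRoot φ x ^ m := by
  obtain ⟨z, rfl, -⟩ := exists_torsion_of_pow_eq_one hn hx
  have := liftRoot_coe φ (z ^ m)
  rw [Subgroup.coe_pow, Units.val_pow_eq_pow_val] at this
  rw [this, liftRoot_coe, map_pow, Units.val_pow_eq_pow_val]

variable {V W : Type*} [AddCommGroup V] [Module k V] [Module.Finite k V]
  [AddCommGroup W] [Module k W] [Module.Finite k W]

theorem charpoly_of_eigenbasis {ι : Type*} [Fintype ι] (b : Module.Basis ι k V)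
    {f : Module.End k V} {μ : ι → k} (h : ∀ i, f (b i) = μ i • b i) :
    f.charpoly = ∏ i, (Polynomial.X - Polynomial.C (μ i)) := by
  classical
  have : LinearMap.toMatrix b b f = Matrix.diagonal μ := by
    ext i j
    rw [LinearMap.toMatrix_apply, h, map_smul, Module.Basis.repr_self, Matrix.diagonal_apply]
    by_cases hij : i = j
    · subst hij; simp
    · simp [hij]
  rw [← LinearMap.charpoly_toMatrix f b, this, Matrix.charpoly_diagonal]

theorem roots_prod_univ_X_sub_C {ι : Type*} [Fintype ι] (μ : ι → k) :
    (∏ i, (Polynomial.X - Polynomial.C (μ i))).roots = Finset.univ.val.map μ := by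
  rw [← Polynomial.roots_multiset_prod_X_sub_C (Finset.univ.val.map μ), Multiset.map_map]
  rfl

theorem liftTrace_of_eigenbasis {ι : Type*} [Fintype ι] (b : Module.Basis ι k V)
    {f : Module.End k V} {μ : ι → k} (h : ∀ i, f (b i) = μ i • b i) :
    liftTrace φ f = ∑ i, liftRoot φ (μ i) := by
  rw [liftTrace, charpoly_of_eigenbasis b h, roots_prod_univ_X_sub_C]
  simp

/-- An endomorphism of finite order prime to the characteristic is diagonalizable. -/
theorem exists_eigenbasis [IsAlgClosed k] {n : ℕ} (hn : (n : k) ≠ 0) {f : Module.End k V}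
    (hf : f ^ n = 1) :
    ∃ (b : Module.Basis (Fin (Module.finrank k V)) k V) (μ : Fin (Module.finrank k V) → k),
      (∀ i, f (b i) = μ i • b i) ∧ ∀ i, μ i ^ n = 1 := by
  classical
  -- X^n - 1 annihilates f and is separable because n is invertible in k.
  have hss : f.IsSemisimple := by
    refine Module.End.isSemisimple_of_squarefree_aeval_eq_zero
      (p := Polynomial.X ^ n - 1) ?_ ?_
    · exact (Polynomial.separable_X_pow_sub_C (1 : k) hn one_ne_zero).squarefree
    · simp [hf]
  have hint : DirectSum.IsInternal fun μ : k => f.eigenspace μ :=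
    DirectSum.isInternal_submodule_of_iSupIndep_of_iSup_eq_top f.eigenspaces_iSupIndep
      hss.iSup_eigenspace_eq_top
  let b := hint.collectedBasis fun μ => Module.finBasis k (f.eigenspace μ)
  have : Finite (Σ μ : k, Fin (Module.finrank k (f.eigenspace μ))) :=
    Module.Finite.finite_basis b
  let e := Fintype.ofFinite (Σ μ : k, Fin (Module.finrank k (f.eigenspace μ)))
  have hcard : Fintype.card (Σ μ : k, Fin (Module.finrank k (f.eigenspace μ))) =
      Module.finrank k V := (Module.finrank_eq_card_basis b).symm
  let e' := Fintype.equivFinOfCardEq hcard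
  have h1 : ∀ i, f (b i) = i.1 • b i := fun i =>
    Module.End.mem_eigenspace_iff.1 (hint.collectedBasis_mem _ i)
  refine ⟨b.reindex e', fun i => (e'.symm i).1, fun i => ?_, fun i => ?_⟩
  · rw [Module.Basis.reindex_apply]
    exact h1 _
  · set j := e'.symm i
    have h2 : ∀ m : ℕ, (f ^ m) (b j) = j.1 ^ m • b j := by
      intro m
      induction m with
      | zero => simp
      | succ m ih => rw [pow_succ', Module.End.mul_apply, ih, map_smul, h1, smul_smul, pow_succ]
    have h3 := h2 n
    rw [hf, Module.End.one_apply] at h3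
    have h4 : (j.1 ^ n - 1) • b j = 0 := by rw [sub_smul, ← h3, one_smul, sub_self]
    exact sub_eq_zero.1 ((smul_eq_zero.1 h4).resolve_right (b.ne_zero j))

theorem natCast_ne_zero_of_coprime {p : ℕ} [CharP k p] (hp : p.Prime) {n : ℕ}
    (hn : n.Coprime p) : (n : k) ≠ 0 := by
  rw [Ne, CharP.cast_eq_zero_iff k p]
  exact fun h => hp.one_lt.ne' (Nat.Coprime.eq_one_of_dvd hn.symm h)

/-- Tensors of eigenvectors form an eigenbasis whose eigenvalues are products of roots of unity, and
`liftRoot` respects these products. -/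
theorem liftTrace_tensor [IsAlgClosed k] {n : ℕ} (hn : (n : k) ≠ 0) {f : Module.End k V}
    {g : Module.End k W} (hf : f ^ n = 1) (hg : g ^ n = 1) :
    liftTrace φ (TensorProduct.map f g) = liftTrace φ f * liftTrace φ g := by
  have hn0 : n ≠ 0 := by rintro rfl; simp at hn
  obtain ⟨b, μ, hb, hμ⟩ := exists_eigenbasis hn hf
  obtain ⟨c, ν, hc, hν⟩ := exists_eigenbasis hn hg
  rw [liftTrace_of_eigenbasis φ b hb, liftTrace_of_eigenbasis φ c hc,
    liftTrace_of_eigenbasis φ (b.tensorProduct c) (μ := fun i => μ i.1 * ν i.2),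
    Finset.sum_mul_sum, ← Finset.univ_product_univ, Finset.sum_product]
  · exact Finset.sum_congr rfl fun i _ => Finset.sum_congr rfl fun j _ =>
      liftRoot_mul φ hn0 hn0 (hμ i) (hν j)
  · rintro ⟨i, j⟩
    rw [Module.Basis.tensorProduct_apply, TensorProduct.map_tmul, hb, hc,
      TensorProduct.smul_tmul_smul]

/-- The lifted trace of a diagonalizable map that is a twist, by scalars `c i`, of a direct sum of
diagonalizable maps `g i`. -/
theorem liftTrace_of_equiv_pi [IsAlgClosed k] {ι : Type*} [Fintype ι] [DecidableEq ι]
    {U : ι → Type*}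
    [∀ i, AddCommGroup (U i)] [∀ i, Module k (U i)] [∀ i, Module.Finite k (U i)]
    (e : (∀ i, U i) ≃ₗ[k] V) {n : ℕ} (hn : (n : k) ≠ 0) (g : ∀ i, Module.End k (U i))
    (hg : ∀ i, g i ^ n = 1) (c : ι → k) (hc : ∀ i, c i ^ n = 1) {f : Module.End k V}
    (hf : ∀ i (x : U i), f (e (Pi.single i x)) = c i • e (Pi.single i (g i x))) :
    liftTrace φ f = ∑ i, liftRoot φ (c i) * liftTrace φ (g i) := by
  have hn0 : n ≠ 0 := by rintro rfl; simp at hn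
  choose b μ hb hμ using fun i => exists_eigenbasis hn (hg i)
  rw [liftTrace_of_eigenbasis φ ((Pi.basis b).map e) (μ := fun i => c i.1 * μ i.1 i.2)]
  · rw [Fintype.sum_sigma]
    refine Finset.sum_congr rfl fun i _ => ?_
    rw [liftTrace_of_eigenbasis φ (b i) (hb i), Finset.mul_sum]
    exact Finset.sum_congr rfl fun j _ => liftRoot_mul φ hn0 hn0 (hc i) (hμ i j)
  · rintro ⟨i, j⟩
    rw [Module.Basis.map_apply, Pi.basis_apply, hf, hb, Pi.single_smul, map_smul, smul_smul]

/-- The matrix of a permutation of the standard basis. -/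
def permutationMatrix {X : Type*} [DecidableEq X] (π : Equiv.Perm X) (R : Type*) [CommRing R] :
    Matrix X X R :=
  Matrix.of fun i j => if i = π j then 1 else 0

theorem permutationMatrix_map {X : Type*} [DecidableEq X] (π : Equiv.Perm X) {R S : Type*}
    [CommRing R] [CommRing S] (h : R →+* S) :
    (permutationMatrix π R).map h = permutationMatrix π S := by
  ext i j
  simp [permutationMatrix, apply_ite h]

/-- The lifted trace of a permutation of order prime to the characteristic is the number of fixed
points. -/
theorem liftTrace_permutation [IsAlgClosed k] [IsAlgClosed F] [CharZero F]
    (hφ : Function.Injective φ) {X : Type*} [Finite X] (b : Module.Basis X k V)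
    (π : Equiv.Perm X) {n : ℕ} (hn : (n : k) ≠ 0) (hπ : π ^ n = 1) {f : Module.End k V}
    (hf : ∀ x, f (b x) = b (π x)) : liftTrace φ f = Nat.card {x // π x = x} := by
  classical
  have := Fintype.ofFinite X
  have hn0 : n ≠ 0 := by rintro rfl; simp at hn
  have : NeZero n := ⟨hn0⟩
  have : NeZero (n : k) := ⟨hn⟩
  obtain ⟨ζ, hζ⟩ := HasEnoughRootsOfUnity.exists_primitiveRoot k n
  obtain ⟨z, hz, -⟩ := exists_torsion_of_pow_eq_one hn0 hζ.pow_eq_one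
  have hzp : IsPrimitiveRoot z n := by
    have h1 : IsPrimitiveRoot ((Units.coeHom k).comp (CommGroup.torsion kˣ).subtype z) n := by
      simpa [hz] using hζ
    exact h1.of_map_of_injective (Units.val_injective.comp Subtype.val_injective)
  have hξ : IsPrimitiveRoot ((φ z : Fˣ) : F) n :=
    (hzp.map_of_injective hφ).map_of_injective (f := Units.coeHom F) Units.val_injective
  set ξ : F := ↑(φ z) with hξdef
  -- The ring ℤ[X]/Φ_n maps to k by X ↦ ζ and to F by X ↦ ξ, the lift of ζ. The characteristic
  -- polynomial of the permutation is split over F, pulled back to O and reduced to k, which matches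
  -- its roots in k with its roots in F.
  let O := AdjoinRoot (Polynomial.cyclotomic n ℤ)
  have hOk : Polynomial.eval₂ (Int.castRingHom k) ζ (Polynomial.cyclotomic n ℤ) = 0 := by
    have := hζ.isRoot_cyclotomic (Nat.pos_of_ne_zero hn0)
    rw [Polynomial.eval₂_eq_eval_map, Polynomial.map_cyclotomic_int]
    exact this
  have hOF : Polynomial.eval₂ (Int.castRingHom F) ξ (Polynomial.cyclotomic n ℤ) = 0 := by
    have := hξ.isRoot_cyclotomic (Nat.pos_of_ne_zero hn0)
    rw [Polynomial.eval₂_eq_eval_map, Polynomial.map_cyclotomic_int]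
    exact this
  let ik : O →+* k := AdjoinRoot.lift (Int.castRingHom k) ζ hOk
  let iF : O →+* F := AdjoinRoot.lift (Int.castRingHom F) ξ hOF
  -- In characteristic zero Φ_n is the minimal polynomial of ξ over ℤ.
  have hinj : Function.Injective iF := by
    rw [injective_iff_map_eq_zero]
    intro x hx
    obtain ⟨q, rfl⟩ := AdjoinRoot.mk_surjective x
    rw [AdjoinRoot.mk_eq_zero, Polynomial.cyclotomic_eq_minpoly hξ (Nat.pos_of_ne_zero hn0)]
    refine minpoly.isIntegrallyClosed_dvd (hξ.isIntegral (Nat.pos_of_ne_zero hn0)) ?_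
    rw [AdjoinRoot.lift_mk] at hx
    rw [Polynomial.aeval_def]
    exact hx
  have hMk : LinearMap.toMatrix b b f = permutationMatrix π k := by
    ext i j
    rw [LinearMap.toMatrix_apply, hf, Module.Basis.repr_self, Finsupp.single_apply]
    simp [permutationMatrix, eq_comm]
  let fF : Module.End F (X → F) := Matrix.toLin' (permutationMatrix π F)
  have hfF : ∀ x, fF (Pi.basisFun F X x) = Pi.basisFun F X (π x) := by
    intro x
    ext i
    simp [fF, permutationMatrix, Matrix.toLin'_apply, Matrix.col_apply, Pi.single_apply]
  have hfFn : fF ^ n = 1 := by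
    have h1 : ∀ m : ℕ, ∀ x, (fF ^ m) (Pi.basisFun F X x) = Pi.basisFun F X ((π ^ m) x) := by
      intro m
      induction m with
      | zero => simp
      | succ m ih => intro x; rw [pow_succ', Module.End.mul_apply, ih, hfF, pow_succ']; rfl
    refine (Pi.basisFun F X).ext fun x => ?_
    rw [h1, hπ]; rfl
  obtain ⟨c, μ, hc, hμ⟩ := exists_eigenbasis (n := n) (by exact_mod_cast hn0) hfFn
  have hch : (permutationMatrix π F).charpoly = ∏ i, (Polynomial.X - Polynomial.C (μ i)) := by
    rw [← charpoly_of_eigenbasis c hc, ← LinearMap.charpoly_toMatrix fF (Pi.basisFun F X)]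
    congr 1
    exact (LinearMap.toMatrix'_toLin' _).symm
  choose a ha using fun i => hξ.eq_pow_of_pow_eq_one (hμ i)
  have hiF : iF (AdjoinRoot.root _) = ξ := AdjoinRoot.lift_root hOF
  have hik : ik (AdjoinRoot.root _) = ζ := AdjoinRoot.lift_root hOk
  have hO : (permutationMatrix π O).charpoly =
      ∏ i, (Polynomial.X - Polynomial.C ((AdjoinRoot.root (Polynomial.cyclotomic n ℤ)) ^ a i)) := by
    refine Polynomial.map_injective iF hinj ?_
    rw [← Matrix.charpoly_map, permutationMatrix_map, hch, Polynomial.map_prod]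
    refine Finset.prod_congr rfl fun i _ => ?_
    simp [hiF, ← (ha i).2]
  have hk : f.charpoly = ∏ i, (Polynomial.X - Polynomial.C (ζ ^ a i)) := by
    rw [← LinearMap.charpoly_toMatrix f b, hMk, ← permutationMatrix_map π ik, Matrix.charpoly_map, hO,
      Polynomial.map_prod]
    refine Finset.prod_congr rfl fun i _ => ?_
    simp [hik]
  -- The trace is taken over F, where the number of fixed points is not reduced modulo p.
  have htr : (permutationMatrix π F).trace = Nat.card {x // π x = x} := by
    simp [Matrix.trace, permutationMatrix, Fintype.card_subtype, eq_comm]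
  rw [← htr, Matrix.trace_eq_sum_roots_charpoly, hch, liftTrace, hk,
    roots_prod_univ_X_sub_C, roots_prod_univ_X_sub_C, Multiset.map_map]
  simp only [Finset.sum_map_val, Function.comp_apply]
  congr 1
  funext i
  rw [liftRoot_pow φ hn0 hζ.pow_eq_one, ← hz, liftRoot_coe, (ha i).2]

end LiftTrace

/-! ### The permutation module of a finite set -/

section PermRep

variable (k : Type*) {G : Type*} [Field k] [Group G]

/-- The permutation module of functions on a `G`-set. -/
def permRep (X : Type*) [MulAction G X] : Representation k G (X → k) where
  toFun g := LinearMap.funLeft k k fun x => g⁻¹ • x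
  map_one' := by ext; simp
  map_mul' g h := by
    refine LinearMap.ext fun f => funext fun x => ?_
    simp [LinearMap.funLeft_apply, mul_smul]

variable {k}

theorem permRep_apply {X : Type*} [MulAction G X] (g : G) (f : X → k) (x : X) :
    permRep k X g f x = f (g⁻¹ • x) := rfl

theorem permRep_single {X : Type*} [MulAction G X] [DecidableEq X] (g : G) (x : X) (c : k) :
    permRep k X g (Pi.single x c) = Pi.single (g • x) c := by
  funext y
  rw [permRep_apply, Pi.single_apply, Pi.single_apply]
  simp [inv_smul_eq_iff]

end PermRep

theorem isPermutation_permRep {k G : Type u} [Field k] [Group G] (X : Type u) [Finite X]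
    [MulAction G X] : IsPermutation (permRep (G := G) k X) := by
  classical
  exact ⟨X, inferInstance, Pi.basisFun k X, fun g x => ⟨g • x, by
    rw [Pi.basisFun_apply, Pi.basisFun_apply, permRep_single]⟩⟩

theorem IsPermutation.exists_equiv_permRep {k G : Type u} [Field k] [Group G] {V : Type u}
    [AddCommGroup V] [Module k V] {ρ : Representation k G V} (h : IsPermutation ρ) :
    ∃ (X : Type u) (_ : Finite X) (_ : MulAction G X), Nonempty (ρ.Equiv (permRep k X)) := by
  classical
  obtain ⟨X, hX, b, hb⟩ := h
  choose a ha using hb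
  let act : MulAction G X :=
    { smul := a
      one_smul := fun x => b.injective (by
        change b (a 1 x) = b x
        rw [← ha, map_one, Module.End.one_apply])
      mul_smul := fun g h x => b.injective (by
        change b (a (g * h) x) = b (a g (a h x))
        rw [← ha, ← ha, ← ha, map_mul, Module.End.mul_apply]) }
  refine ⟨X, hX, act, ⟨Representation.Equiv.mk b.equivFun fun g => b.ext fun x => ?_⟩⟩
  have h1 : ρ g (b x) = b (g • x) := ha g x
  have h2 : ∀ y, b.equivFun (b y) = Pi.single y 1 := fun y => by
    funext z; simp [Module.Basis.equivFun_self, Pi.single_apply, eq_comm]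
  change b.equivFun (ρ g (b x)) = permRep k X g (b.equivFun (b x))
  rw [h1, h2, h2, permRep_single]

theorem IsPPermutation.exists_permRep {k G : Type u} [Field k] [Group G] {V : Type u}
    [AddCommGroup V] [Module k V] {ρ : Representation k G V} (h : IsPPermutation ρ) :
    ∃ (X : Type u) (_ : Finite X) (_ : MulAction G X) (i : ρ.IntertwiningMap (permRep k X))
      (q : (permRep k X).IntertwiningMap ρ), ∀ v, q (i v) = v := by
  obtain ⟨W, _, _, σ, hσ, i, q, hiq⟩ := h
  obtain ⟨X, hX, act, ⟨e⟩⟩ := hσ.exists_equiv_permRep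
  refine ⟨X, hX, act, e.toIntertwiningMap.comp i, q.comp e.symm.toIntertwiningMap, fun v => ?_⟩
  have h1 : q (i v) = v := congrArg (fun f => f v) hiq
  simpa using h1

/-! ### Sums over orbits and relative traces -/

/-- The representatives `Quotient.out` are kept so that each inner sum has the shape of `relTrace`.
-/
theorem sum_eq_sum_orbits {P Z A : Type*} [Group P] [Finite P] [Fintype Z] [MulAction P Z]
    [AddCommMonoid A] (f : Z → A) :
    ∑ z, f z = ∑ᶠ ω : MulAction.orbitRel.Quotient P Z,
      ∑ᶠ x : P ⧸ MulAction.stabilizer P ω.out, f ((Quotient.out x : P) • ω.out) := by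
  classical
  have := Fintype.ofFinite (MulAction.orbitRel.Quotient P Z)
  have : ∀ ω : MulAction.orbitRel.Quotient P Z,
    Fintype (P ⧸ MulAction.stabilizer P ω.out) := fun ω => Fintype.ofFinite _
  rw [finsum_eq_sum_of_fintype]
  simp_rw [finsum_eq_sum_of_fintype]
  rw [← Fintype.sum_sigma']
  refine (Fintype.sum_equiv (MulAction.selfEquivSigmaOrbitsQuotientStabilizer P Z).symm _ _ ?_).symm
  rintro ⟨ω, x⟩
  congr 1
  conv_rhs => rw [← Quotient.out_eq x]
  rfl

section Trace

variable {k G : Type*} [Field k] [Group G] [Finite G] {V : Type*} [AddCommGroup V] [Module k V]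

/-- An equivariant sum over a finite `P`-set that vanishes on the fixed points is a sum of relative
traces from proper subgroups. -/
theorem sum_mem_traceSubmodule (ρ : Representation k G V) (P : Subgroup G) {Z : Type*} [Fintype Z]
    [MulAction P Z] (v : Z → V) (hv : ∀ (g : P) z, v (g • z) = ρ g (v z))
    (h0 : ∀ z, (∀ g : P, g • z = z) → v z = 0) : ∑ z, v z ∈ traceSubmodule ρ P := by
  rw [sum_eq_sum_orbits (P := P)]
  refine finsum_induction (· ∈ traceSubmodule ρ P) (zero_mem _) (fun _ _ => add_mem) fun ω => ?_
  by_cases h : MulAction.stabilizer P ω.out = ⊤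
  · have h1 : v ω.out = 0 := h0 _ fun g => by
      have : g ∈ MulAction.stabilizer P ω.out := by rw [h]; trivial
      exact this
    have h2 : ∀ x : P ⧸ MulAction.stabilizer P ω.out, v ((Quotient.out x : P) • ω.out) = 0 :=
      fun x => by rw [hv, h1, map_zero]
    rw [finsum_eq_zero_of_forall_eq_zero h2]
    exact zero_mem _
  -- An orbit with more than one point contributes the relative trace of `v ω.out` from the
  -- stabilizer, which is proper.
  · refine Submodule.subset_span ⟨_, h, v ω.out, ?_, ?_⟩
    · rw [mem_fixedPoints]
      rintro _ ⟨g, hg, rfl⟩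
      have h1 := hv g ω.out
      rw [MulAction.mem_stabilizer_iff.1 hg] at h1
      exact h1.symm
    · exact finsum_congr fun x => hv _ _

end Trace

/-! ### The Brauer construction of a permutation module -/

section BrauerPerm

variable {k G : Type*} [Field k] [Group G] (X : Type*) [MulAction G X] (P : Subgroup G)

theorem mem_fixedPoints_permRep {m : X → k} :
    m ∈ fixedPoints (permRep k X) P ↔ ∀ g ∈ P, ∀ x, m (g • x) = m x := by
  rw [mem_fixedPoints]
  refine ⟨fun h g hg x => ?_, fun h g hg => funext fun x => ?_⟩
  · have := congrFun (h g⁻¹ (inv_mem hg)) x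
    rwa [permRep_apply, inv_inv] at this
  · rw [permRep_apply]
    exact h _ (inv_mem hg) x

variable (k) in
/-- Restriction of invariant functions to the set of fixed points. -/
noncomputable def restrictFixed : fixedPoints (permRep k X) P →ₗ[k] (MulAction.fixedPoints P X → k) :=
  LinearMap.funLeft k k Subtype.val ∘ₗ (fixedPoints (permRep k X) P).subtype

theorem single_mem_fixedPoints [DecidableEq X] (x : MulAction.fixedPoints P X) (c : k) :
    (Pi.single (x : X) c : X → k) ∈ fixedPoints (permRep k X) P := by
  rw [mem_fixedPoints]
  intro g hg
  rw [permRep_single]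
  congr 1
  exact x.2 ⟨g, hg⟩

variable {P} in
theorem smul_mem_fixedPoints (n : Subgroup.normalizer (P : Set G)) {x : X}
    (hx : x ∈ MulAction.fixedPoints P X) : (n : G) • x ∈ MulAction.fixedPoints P X := by
  rintro ⟨g, hg⟩
  have h1 : (n : G)⁻¹ * g * n ∈ P := (Subgroup.mem_set_normalizer_iff''.1 n.2 g).1 hg
  have h2 : ((n : G)⁻¹ * g * n) • x = x := hx ⟨_, h1⟩
  change g • (n : G) • x = (n : G) • x
  rw [← inv_smul_eq_iff, ← mul_smul, ← mul_smul]
  exact h2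

variable [Finite X]

theorem restrictFixed_surjective : Function.Surjective (restrictFixed k X P) := by
  classical
  have := Fintype.ofFinite (MulAction.fixedPoints P X)
  rw [← LinearMap.range_eq_top, eq_top_iff, ← (Pi.basisFun k _).span_eq, Submodule.span_le]
  rintro _ ⟨x, rfl⟩
  refine ⟨⟨Pi.single (x : X) 1, single_mem_fixedPoints X P x 1⟩, funext fun y => ?_⟩
  simp [restrictFixed, LinearMap.funLeft_apply, Pi.single_apply, Subtype.ext_iff]

variable [Finite G]

-- At a P-fixed point, the relative trace from a proper subgroup Q multiplies the value by [P : Q],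
-- which is zero in k. Conversely, an invariant function is a sum of multiples of point masses
-- permuted by P; if it vanishes at the fixed points, `sum_mem_traceSubmodule` applies.
variable {P} in
theorem traceSubmodule_eq_ker {p : ℕ} [Fact p.Prime] [CharP k p] (hP : IsPGroup p P) :
    (traceSubmodule (permRep k X) P).submoduleOf (fixedPoints (permRep k X) P) =
      LinearMap.ker (restrictFixed k X P) := by
  classical
  have := Fintype.ofFinite X
  refine le_antisymm ?_ ?_
  · rintro ⟨m, hm⟩ h
    have h1 : m ∈ traceSubmodule (permRep k X) P := h
    suffices h2 : traceSubmodule (permRep k X) P ≤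
        LinearMap.ker (LinearMap.funLeft k k (Subtype.val : MulAction.fixedPoints P X → X)) from
      h2 h1
    refine Submodule.span_le.2 ?_
    rintro _ ⟨Q, hQ, m, hm, rfl⟩
    refine funext fun x => ?_
    have := Fintype.ofFinite (P ⧸ Q)
    obtain ⟨n, hn⟩ := hP.index Q
    have hn0 : n ≠ 0 := by
      rintro rfl
      exact hQ (Subgroup.index_eq_one.1 (by simpa using hn))
    have h3 : ((Fintype.card (P ⧸ Q) : ℕ) : k) = 0 := by
      rw [← Nat.card_eq_fintype_card]
      change ((Q.index : ℕ) : k) = 0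
      rw [hn, Nat.cast_pow, CharP.cast_eq_zero, zero_pow hn0]
    rw [LinearMap.funLeft_apply, relTrace, finsum_eq_sum_of_fintype, Finset.sum_apply]
    have h4 : ∀ y : P ⧸ Q, permRep k X ((Quotient.out y : P) : G) m x = m x := fun y => by
      rw [permRep_apply]
      congr 1
      exact x.2 (Quotient.out y)⁻¹
    simp [h4, h3]
  · rintro ⟨m, hm⟩ h
    have h1 : ∀ x, (∀ g : P, g • x = x) → m x = 0 := fun x hx => congrFun h ⟨x, hx⟩
    change m ∈ traceSubmodule (permRep k X) P
    have h2 : m = ∑ x, Pi.single x (m x) := (Finset.univ_sum_single m).symm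
    rw [h2]
    refine sum_mem_traceSubmodule (permRep k X) P (fun x => Pi.single x (m x)) ?_ ?_
    · intro g x
      rw [permRep_single]
      congr 1
      exact (mem_fixedPoints_permRep X P).1 hm g g.2 x
    · intro x hx
      rw [h1 x hx, Pi.single_zero]

variable {P}
variable {p : ℕ} [Fact p.Prime] [CharP k p] (hP : IsPGroup p P)

/-- The Brauer construction of a permutation module is the permutation module of the fixed
points. -/
noncomputable def brauerPermEquiv :
    BrauerQuotient (permRep k X) P ≃ₗ[k] (MulAction.fixedPoints P X → k) :=
  (Submodule.quotEquivOfEq _ _ (traceSubmodule_eq_ker X hP)).trans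
    ((restrictFixed k X P).quotKerEquivOfSurjective (restrictFixed_surjective X P))

theorem brauerPermEquiv_mk (m : fixedPoints (permRep k X) P) :
    brauerPermEquiv X hP (Submodule.Quotient.mk m) =
      fun x : MulAction.fixedPoints P X => m.1 (x : X) := rfl

/-- The basis of the Brauer construction of a permutation module given by the fixed points. -/
noncomputable def brauerBasis :
    Module.Basis (MulAction.fixedPoints P X) k (BrauerQuotient (permRep k X) P) :=
  Module.Basis.ofEquivFun (brauerPermEquiv X hP)

theorem brauerBasis_apply [DecidableEq X] (x : MulAction.fixedPoints P X) :
    brauerBasis X hP x =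
      Submodule.Quotient.mk ⟨Pi.single (x : X) (1 : k), single_mem_fixedPoints X P x 1⟩ := by
  refine (brauerPermEquiv X hP).injective ?_
  rw [brauerPermEquiv_mk, brauerBasis, Module.Basis.coe_ofEquivFun, LinearEquiv.apply_symm_apply]
  funext y
  simp [Pi.single_apply, Subtype.ext_iff]

theorem brauerRep_brauerBasis (n : Subgroup.normalizer (P : Set G))
    (x : MulAction.fixedPoints P X) :
    brauerRep (permRep k X) P n (brauerBasis X hP x) =
      brauerBasis X hP ⟨(n : G) • (x : X), smul_mem_fixedPoints X n x.2⟩ := by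
  classical
  rw [brauerBasis_apply, brauerBasis_apply]
  exact congrArg (Submodule.mkQ _) (Subtype.ext (permRep_single _ _ _))

theorem brauerMap_brauerBasis {V : Type*} [AddCommGroup V] [Module k V] {ρ : Representation k G V}
    (f : (permRep k X).IntertwiningMap ρ) [DecidableEq X] (x : MulAction.fixedPoints P X) :
    brauerMap P f (brauerBasis X hP x) =
      Submodule.Quotient.mk ⟨f (Pi.single (x : X) (1 : k)),
        map_fixedPoints P f (single_mem_fixedPoints X P x 1)⟩ := by
  rw [brauerBasis_apply]
  rfl

end BrauerPerm

/-! ### The Brauer construction of a tensor product -/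

theorem liftTrace_of_equiv {k F : Type*} [Field k] [Field F] (φ : CommGroup.torsion kˣ →* Fˣ)
    {V W : Type*} [AddCommGroup V] [Module k V] [Module.Finite k V] [AddCommGroup W] [Module k W]
    [Module.Finite k W] (e : V ≃ₗ[k] W) {f : Module.End k V} {g : Module.End k W}
    (h : ∀ v, g (e v) = e (f v)) : liftTrace φ f = liftTrace φ g := by
  have : g = e.conj f := by
    refine LinearMap.ext fun x => ?_
    rw [LinearEquiv.conj_apply_apply, ← h, LinearEquiv.apply_symm_apply]
  rw [liftTrace, liftTrace, this, LinearEquiv.charpoly_conj]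

theorem apply_out_mk {k G V : Type*} [Field k] [Group G] [AddCommGroup V] [Module k V]
    {ρ : Representation k G V} {P : Subgroup G} {Q : Subgroup P} {m : V}
    (hm : m ∈ fixedPoints ρ (Q.map P.subtype)) (x : P) :
    ρ ((Quotient.out (x : P ⧸ Q) : P) : G) m = ρ (x : G) m := by
  have h1 : x⁻¹ * Quotient.out (x : P ⧸ Q) ∈ Q := QuotientGroup.eq.1 (Quotient.out_eq _).symm
  have h2 := mem_fixedPoints.1 hm _ ⟨_, h1, rfl⟩
  have h3 : ((Quotient.out (x : P ⧸ Q) : P) : G) =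
      (x : G) * P.subtype (x⁻¹ * Quotient.out (x : P ⧸ Q)) := by simp
  rw [h3, map_mul, Module.End.mul_apply, h2]

section BrauerTensor

variable {k G H : Type*} [Field k] [Group G] [Finite G] [Group H] [Finite H] (π : H →* G)
variable {V W V' W' : Type*} [AddCommGroup V] [Module k V] [AddCommGroup W] [Module k W]
  [AddCommGroup V'] [Module k V'] [AddCommGroup W'] [Module k W']

/-- The tensor product of the restriction of `ρ` along `π` with `σ`. -/
noncomputable abbrev resTensor (ρ : Representation k G V) (σ : Representation k H W) :
    Representation k H (V ⊗[k] W) :=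
  Representation.tprod (ρ.comp π) σ

/-- Functoriality of `resTensor`. -/
noncomputable def resTensorMap {ρ : Representation k G V} {σ : Representation k H W}
    {ρ' : Representation k G V'} {σ' : Representation k H W'}
    (f : ρ.IntertwiningMap ρ') (g : σ.IntertwiningMap σ') :
    (resTensor π ρ σ).IntertwiningMap (resTensor π ρ' σ') :=
  ⟨TensorProduct.map f.toLinearMap g.toLinearMap, fun h => TensorProduct.ext' fun v w => by
    simp [f.isIntertwining, g.isIntertwining]⟩

variable (ρ : Representation k G V) (σ : Representation k H W) (D : Subgroup H)

omit [Finite G] [Finite H] in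
theorem tmul_mem_fixedPoints {ρ : Representation k G V} {σ : Representation k H W}
    {D : Subgroup H} {a : V} {b : W} (ha : a ∈ fixedPoints ρ (D.map π))
    (hb : b ∈ fixedPoints σ D) : a ⊗ₜ[k] b ∈ fixedPoints (resTensor π ρ σ) D := by
  rw [mem_fixedPoints] at *
  intro g hg
  rw [Representation.tprod_apply, TensorProduct.map_tmul, hb g hg]
  exact congrArg (· ⊗ₜ[k] b) (ha _ ⟨g, hg, rfl⟩)

-- An invariant factor passes through the relative trace: a ⊗ Tr(m) = Tr(a ⊗ m).
omit [Finite G] in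
theorem tmul_mem_traceSubmodule_right {a : V} {b : W} (ha : a ∈ fixedPoints ρ (D.map π))
    (hb : b ∈ traceSubmodule σ D) : a ⊗ₜ[k] b ∈ traceSubmodule (resTensor π ρ σ) D := by
  suffices h : traceSubmodule σ D ≤
    (traceSubmodule (resTensor π ρ σ) D).comap (TensorProduct.mk k V W a) from h hb
  refine Submodule.span_le.2 ?_
  rintro _ ⟨Q, hQ, m, hm, rfl⟩
  refine Submodule.subset_span ⟨Q, hQ, a ⊗ₜ m, ?_, ?_⟩
  · rw [mem_fixedPoints] at *
    rintro g hg
    rw [Representation.tprod_apply, TensorProduct.map_tmul, hm g hg]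
    refine congrArg (· ⊗ₜ[k] m) (ha _ ⟨g, ?_, rfl⟩)
    exact Subgroup.map_subtype_le Q hg
  · rw [relTrace, relTrace, map_finsum _ (Set.toFinite _)]
    refine finsum_congr fun x => ?_
    rw [Representation.tprod_apply, TensorProduct.map_tmul, TensorProduct.mk_apply]
    exact congrArg (· ⊗ₜ[k] _)
      (mem_fixedPoints.1 ha _ ⟨_, (Quotient.out x).2, rfl⟩).symm

/-- Here the trace is taken in π(D), not in D, so the sum over π(D)/Q is regrouped into D-orbits. A
coset fixed by D would be fixed by all of π(D), against Q being proper. -/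
theorem tmul_mem_traceSubmodule_left {a : V} {b : W} (ha : a ∈ traceSubmodule ρ (D.map π))
    (hb : b ∈ fixedPoints σ D) : a ⊗ₜ[k] b ∈ traceSubmodule (resTensor π ρ σ) D := by
  suffices h : traceSubmodule ρ (D.map π) ≤
    (traceSubmodule (resTensor π ρ σ) D).comap ((TensorProduct.mk k V W).flip b) from h ha
  refine Submodule.span_le.2 ?_
  rintro _ ⟨Q, hQ, m, hm, rfl⟩
  let act : MulAction D (D.map π ⧸ Q) := MulAction.compHom _ (π.subgroupMap D)
  have hact : ∀ (g : D) (z : D.map π ⧸ Q), g • z = π.subgroupMap D g • z := fun _ _ => rfl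
  have := Fintype.ofFinite (D.map π ⧸ Q)
  rw [SetLike.mem_coe, Submodule.mem_comap, relTrace, finsum_eq_sum_of_fintype, map_sum]
  refine sum_mem_traceSubmodule (resTensor π ρ σ) D (Z := D.map π ⧸ Q) _ ?_ ?_
  · intro g z
    induction z using QuotientGroup.induction_on with | H z => ?_
    rw [hact]
    change ρ (((π.subgroupMap D g * z : D.map π) : D.map π ⧸ Q).out : D.map π) m ⊗ₜ[k] b =
      TensorProduct.map (ρ (π g)) (σ g) (ρ ((z : D.map π ⧸ Q).out : D.map π) m ⊗ₜ[k] b)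
    rw [apply_out_mk hm, apply_out_mk hm, TensorProduct.map_tmul, mem_fixedPoints.1 hb g g.2,
      Subgroup.coe_mul, map_mul, Module.End.mul_apply]
    rfl
  · intro z hz
    refine absurd ((Subgroup.eq_top_iff' Q).2 fun x => ?_) hQ
    induction z using QuotientGroup.induction_on with | H z => ?_
    obtain ⟨g, hg⟩ := π.subgroupMap_surjective D (z * x * z⁻¹)
    have h1 := hz g
    rw [hact, hg] at h1
    have h2 := QuotientGroup.eq.1 h1
    change (z * x * z⁻¹ * z)⁻¹ * z ∈ Q at h2
    have h3 : (z * x * z⁻¹ * z)⁻¹ * z = x⁻¹ := by group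
    rw [h3] at h2
    exact inv_mem_iff.1 h2

/-- The bilinear map underlying `brauerTensor`. -/
noncomputable def brauerTensorAux :
    fixedPoints ρ (D.map π) →ₗ[k] fixedPoints σ D →ₗ[k] BrauerQuotient (resTensor π ρ σ) D :=
  LinearMap.mk₂ k (fun a b => Submodule.Quotient.mk
      ⟨(a : V) ⊗ₜ[k] (b : W), tmul_mem_fixedPoints π a.2 b.2⟩)
    (fun _ _ _ => congrArg (Submodule.mkQ _) (Subtype.ext (TensorProduct.add_tmul _ _ _)))
    (fun c _ _ => congrArg (Submodule.mkQ _) (Subtype.ext (TensorProduct.smul_tmul' c _ _).symm))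
    (fun _ _ _ => congrArg (Submodule.mkQ _) (Subtype.ext (TensorProduct.tmul_add _ _ _)))
    (fun c _ _ => congrArg (Submodule.mkQ _) (Subtype.ext (TensorProduct.tmul_smul c _ _)))

/-- The natural map from the tensor product of Brauer constructions to the Brauer construction of a
tensor product. -/
noncomputable def brauerTensor :
    BrauerQuotient ρ (D.map π) ⊗[k] BrauerQuotient σ D →ₗ[k]
      BrauerQuotient (resTensor π ρ σ) D :=
  TensorProduct.lift (Submodule.liftQ _ (Submodule.liftQ _ (brauerTensorAux π ρ σ D).flip (by
      intro b hb
      refine LinearMap.ext fun a => ?_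
      exact (Submodule.Quotient.mk_eq_zero _).2
        (tmul_mem_traceSubmodule_right π ρ σ D a.2 hb))).flip (by
    intro a ha
    refine Submodule.linearMap_qext _ (LinearMap.ext fun b => ?_)
    exact (Submodule.Quotient.mk_eq_zero _).2
      (tmul_mem_traceSubmodule_left π ρ σ D ha b.2)))

theorem brauerTensor_mk (a : fixedPoints ρ (D.map π)) (b : fixedPoints σ D) :
    brauerTensor π ρ σ D (Submodule.Quotient.mk a ⊗ₜ[k] Submodule.Quotient.mk b) =
      Submodule.Quotient.mk ⟨(a : V) ⊗ₜ[k] (b : W), tmul_mem_fixedPoints π a.2 b.2⟩ := rfl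

theorem brauerTensor_natural {ρ : Representation k G V} {σ : Representation k H W}
    {ρ' : Representation k G V'} {σ' : Representation k H W'}
    (f : ρ.IntertwiningMap ρ') (g : σ.IntertwiningMap σ')
    (x : BrauerQuotient ρ (D.map π) ⊗[k] BrauerQuotient σ D) :
    brauerTensor π ρ' σ' D (TensorProduct.map (brauerMap (D.map π) f).toLinearMap
        (brauerMap D g).toLinearMap x) =
      brauerMap D (resTensorMap π f g) (brauerTensor π ρ σ D x) := by
  induction x with
  | zero => simp
  | add x y hx hy => rw [map_add, map_add, map_add, map_add, hx, hy]
  | tmul a b =>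
    induction a using Submodule.Quotient.induction_on with | H a => ?_
    induction b using Submodule.Quotient.induction_on with | H b => ?_
    rfl

/-- The image in the normalizer of `π(D)` of an element of the normalizer of `D`. -/
def mapNormalizer (d : Subgroup.normalizer (D : Set H)) :
    Subgroup.normalizer ((D.map π : Subgroup G) : Set G) :=
  ⟨π d, Subgroup.le_normalizer_map π ⟨d, d.2, rfl⟩⟩

theorem brauerTensor_equivariant (d : Subgroup.normalizer (D : Set H))
    (x : BrauerQuotient ρ (D.map π) ⊗[k] BrauerQuotient σ D) :
    brauerTensor π ρ σ D (TensorProduct.map (brauerRep ρ (D.map π) (mapNormalizer π D d))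
        (brauerRep σ D d) x) =
      brauerRep (resTensor π ρ σ) D d (brauerTensor π ρ σ D x) := by
  induction x with
  | zero => simp
  | add x y hx hy => rw [map_add, map_add, map_add, map_add, hx, hy]
  | tmul a b =>
    induction a using Submodule.Quotient.induction_on with | H a => ?_
    induction b using Submodule.Quotient.induction_on with | H b => ?_
    rfl

-- By naturality the map for (ρ, σ) is a retract of the map for (ρ', σ'), and a retract of a
-- bijection is a bijection.
variable {D} in
theorem brauerTensor_bijective_of_retract {ρ : Representation k G V} {σ : Representation k H W}
    {ρ' : Representation k G V'} {σ' : Representation k H W'}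
    (h : Function.Bijective (brauerTensor π ρ' σ' D))
    (i : ρ.IntertwiningMap ρ') (q : ρ'.IntertwiningMap ρ) (hqi : ∀ v, q (i v) = v)
    (j : σ.IntertwiningMap σ') (r : σ'.IntertwiningMap σ) (hrj : ∀ v, r (j v) = v) :
    Function.Bijective (brauerTensor π ρ σ D) := by
  have h1 : (brauerMap (D.map π) q).toLinearMap ∘ₗ (brauerMap (D.map π) i).toLinearMap = .id :=
    Submodule.linearMap_qext _ (LinearMap.ext fun x =>
      congrArg (Submodule.mkQ _) (Subtype.ext (hqi x)))
  have h2 : (brauerMap D r).toLinearMap ∘ₗ (brauerMap D j).toLinearMap = .id :=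
    Submodule.linearMap_qext _ (LinearMap.ext fun x =>
      congrArg (Submodule.mkQ _) (Subtype.ext (hrj x)))
  have h3 : ∀ x, TensorProduct.map (brauerMap (D.map π) q).toLinearMap (brauerMap D r).toLinearMap
      (TensorProduct.map (brauerMap (D.map π) i).toLinearMap (brauerMap D j).toLinearMap x) = x := by
    intro x
    rw [← LinearMap.comp_apply, ← TensorProduct.map_comp, h1, h2, TensorProduct.map_id]
    rfl
  have h4 : ∀ x, brauerMap D (resTensorMap π q r) (brauerMap D (resTensorMap π i j) x) = x := by
    intro x
    induction x using Submodule.Quotient.induction_on with | H x => ?_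
    refine congrArg (Submodule.mkQ _) (Subtype.ext ?_)
    change TensorProduct.map q.toLinearMap r.toLinearMap
      (TensorProduct.map i.toLinearMap j.toLinearMap x) = x
    have h5 : q.toLinearMap ∘ₗ i.toLinearMap = .id := LinearMap.ext hqi
    have h6 : r.toLinearMap ∘ₗ j.toLinearMap = .id := LinearMap.ext hrj
    rw [← LinearMap.comp_apply, ← TensorProduct.map_comp, h5, h6, TensorProduct.map_id]
    rfl
  refine ⟨fun x y hxy => ?_, fun y => ?_⟩
  · have h5 := congrArg (brauerMap D (resTensorMap π i j)) hxy
    rw [← brauerTensor_natural, ← brauerTensor_natural] at h5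
    rw [← h3 x, h.1 h5, h3]
  · obtain ⟨x, hx⟩ := h.2 (brauerMap D (resTensorMap π i j) y)
    exact ⟨_, (brauerTensor_natural π D q r x).trans (by rw [hx, h4])⟩

/-- The D-fixed points of X × Y are the products of π(D)-fixed points of X and D-fixed points of Y,
so the map carries a basis to a basis. -/
theorem brauerTensor_bijective_permRep {D : Subgroup H} {p : ℕ} [Fact p.Prime] [CharP k p]
    (hD : IsPGroup p D) (X Y : Type*) [Finite X] [Finite Y] [MulAction G X]
    [MulAction H Y] :
    Function.Bijective (brauerTensor π (permRep k X) (permRep k Y) D) := by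
  classical
  have := Fintype.ofFinite X
  have := Fintype.ofFinite Y
  let actX : MulAction H X := MulAction.compHom X π
  have hact : ∀ (h : H) (x : X), h • x = π h • x := fun _ _ => rfl
  let B := (Pi.basisFun k X).tensorProduct (Pi.basisFun k Y)
  have hB : ∀ x y, B (x, y) = Pi.single x 1 ⊗ₜ Pi.single y 1 := fun x y => by
    rw [Module.Basis.tensorProduct_apply, Pi.basisFun_apply, Pi.basisFun_apply]
  have hBe : ∀ x y, B.equivFun (Pi.single x 1 ⊗ₜ Pi.single y 1) = Pi.single (x, y) 1 := by
    intro x y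
    rw [← hB]
    funext z
    simp [Module.Basis.equivFun_self, Pi.single_apply, eq_comm]
  let E : (resTensor π (permRep (G := G) k X) (permRep (G := H) k Y)).Equiv
      (permRep k (X × Y)) := Representation.Equiv.mk B.equivFun fun h => B.ext fun z => by
    obtain ⟨x, y⟩ := z
    rw [LinearMap.comp_apply, LinearMap.comp_apply, hB, LinearEquiv.coe_coe, hBe, permRep_single,
      Representation.tprod_apply, TensorProduct.map_tmul]
    change B.equivFun (permRep k X (π h) _ ⊗ₜ _) = _
    rw [permRep_single, permRep_single, hBe]
    rfl
  have hX : IsPGroup p (D.map π) := hD.map π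
  have hfix : ∀ x : X, (∀ g : D.map π, g • x = x) ↔ ∀ g : D, g • x = x := fun x =>
    ⟨fun h g => h ⟨π g, g, g.2, rfl⟩, by
      rintro h ⟨_, g, hg, rfl⟩
      exact h ⟨g, hg⟩⟩
  let e : MulAction.fixedPoints (D.map π) X × MulAction.fixedPoints D Y ≃
      MulAction.fixedPoints D (X × Y) :=
    { toFun := fun z => ⟨(z.1, z.2), fun g => Prod.ext ((hfix _).1 z.1.2 g) (z.2.2 g)⟩
      invFun := fun z => (⟨z.1.1, (hfix _).2 fun g => congrArg Prod.fst (z.2 g)⟩,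
        ⟨z.1.2, fun g => congrArg Prod.snd (z.2 g)⟩)
      left_inv := fun z => rfl
      right_inv := fun z => rfl }
  let Φ := ((brauerBasis (k := k) X hX).tensorProduct (brauerBasis (k := k) Y hD)).equiv
    (brauerBasis (X × Y) hD) e
  have hΦ : ∀ x, brauerMap D E.toIntertwiningMap (brauerTensor π (permRep k X) (permRep k Y) D x)
      = Φ x := by
    intro x
    refine LinearMap.congr_fun (f := (brauerMap D E.toIntertwiningMap).toLinearMap ∘ₗ
      brauerTensor π (permRep k X) (permRep k Y) D) (g := Φ.toLinearMap) ?_ x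
    refine ((brauerBasis (k := k) X hX).tensorProduct (brauerBasis (k := k) Y hD)).ext fun z => ?_
    rw [LinearEquiv.coe_coe, Module.Basis.equiv_apply, Module.Basis.tensorProduct_apply,
      brauerBasis_apply, brauerBasis_apply, brauerBasis_apply, LinearMap.comp_apply,
      brauerTensor_mk]
    exact congrArg (Submodule.mkQ _) (Subtype.ext (hBe _ _))
  have hE : Function.Injective (brauerMap D E.toIntertwiningMap) := by
    refine Function.LeftInverse.injective (g := brauerMap D E.symm.toIntertwiningMap) fun x => ?_
    have h2 : E.symm.toIntertwiningMap.comp E.toIntertwiningMap = .id _ :=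
      DFunLike.ext _ _ fun x => by simp
    have h4 := brauerMap_comp D E.symm.toIntertwiningMap E.toIntertwiningMap
    rw [h2, brauerMap_id] at h4
    exact (congrArg (fun f => f x) h4).symm
  refine ⟨fun x y hxy => Φ.injective ?_, fun y => ?_⟩
  · rw [← hΦ, ← hΦ, hxy]
  · obtain ⟨x, hx⟩ := Φ.surjective (brauerMap D E.toIntertwiningMap y)
    exact ⟨x, hE (by rw [hΦ, hx])⟩

end BrauerTensor

/-! ### Species of a tensor product -/

theorem brauerRep_pow_orderOf {k G V : Type*} [Field k] [Group G]
    [Finite G] [AddCommGroup V] [Module k V] (ρ : Representation k G V) (P : Subgroup G)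
    (u : Subgroup.normalizer (P : Set G)) : brauerRep ρ P u ^ orderOf (u : G) = 1 := by
  have h : u ^ orderOf (u : G) = 1 := Subtype.ext (by simp)
  rw [← map_pow, h, map_one]

section TauTensor

variable {k : Type u} {G H : Type u} [Field k] [IsAlgClosed k] [Group G] [Finite G] [Group H]
  [Finite H] (π : H →* G) {F : Type v} [Field F] (φ : CommGroup.torsion kˣ →* Fˣ)
  {V W : Type u} [AddCommGroup V] [Module k V] [Module.Finite k V] [AddCommGroup W] [Module k W]
  [Module.Finite k W] {p : ℕ} [Fact p.Prime] [CharP k p]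

/-- Both modules are retracts of permutation modules, so the Brauer constructions multiply. The
order of d is a common exponent, prime to p, of the two actions, which makes the lifted traces
multiply as well. -/
theorem tau_resTensor {ρ : Representation k G V} {σ : Representation k H W}
    (hρ : IsPPermutation ρ) (hσ : IsPPermutation σ) {D : Subgroup H} (hD : IsPGroup p D)
    (d : Subgroup.normalizer (D : Set H)) (hd : (orderOf (d : H)).Coprime p) :
    tau φ D d (resTensor π ρ σ) = tau φ (D.map π) (mapNormalizer π D d) ρ * tau φ D d σ := by
  obtain ⟨X, _, _, i, q, hqi⟩ := hρ.exists_permRep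
  obtain ⟨Y, _, _, j, r, hrj⟩ := hσ.exists_permRep
  have hb := brauerTensor_bijective_of_retract π
    (brauerTensor_bijective_permRep π hD X Y) i q hqi j r hrj
  have hn : ((orderOf (d : H) : ℕ) : k) ≠ 0 :=
    natCast_ne_zero_of_coprime (p := p) (Fact.out : p.Prime) hd
  have h1 : brauerRep ρ (D.map π) (mapNormalizer π D d) ^ orderOf (d : H) = 1 := by
    have h : (mapNormalizer π D d) ^ orderOf (d : H) = 1 := Subtype.ext (by
      change (π d) ^ orderOf (d : H) = 1
      rw [← map_pow, pow_orderOf_eq_one, map_one])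
    rw [← map_pow, h, map_one]
  rw [tau, tau, tau, ← liftTrace_tensor φ hn h1 (brauerRep_pow_orderOf σ D d)]
  exact (liftTrace_of_equiv φ (LinearEquiv.ofBijective _ hb) fun x =>
    (brauerTensor_equivariant π ρ σ D d x).symm).symm

end TauTensor

/-! ### Tensoring with a module induced from the diagonal -/

section IndDiag

variable {k G K : Type u} [Field k] [Group G] [Group K]
  {V W : Type u} [AddCommGroup V] [Module k V] [AddCommGroup W] [Module k W]

/-- The diagonal embedding. -/
abbrev diag (G : Type*) [Group G] : G →* G × G := (MonoidHom.id G).prod (MonoidHom.id G)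

theorem indDiag_mk_eq (ρ : Representation k G V) (y : G × G) (g : G) (v : V) :
    Representation.IndV.mk (diag G) ρ ((g, g) * y) (ρ g v) =
      Representation.IndV.mk (diag G) ρ y v := by
  have := Representation.Coinvariants.mk_self_apply
    (Representation.tprod ((Representation.leftRegular k (G × G)).comp (diag G)) ρ) g
    (MonoidAlgebra.single y 1 ⊗ₜ[k] v)
  simpa using this

theorem midAction_mk_eq {H : Type u} [Group H] (L : Representation k (G × H) V)
    (M : Representation k (H × K) W) (h : H) (v : V) (w : W) :
    Representation.Coinvariants.mk (midAction L M) (L (1, h) v ⊗ₜ[k] M (h, 1) w) =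
      Representation.Coinvariants.mk (midAction L M) (v ⊗ₜ[k] w) := by
  have := Representation.Coinvariants.mk_self_apply (midAction L M) h (v ⊗ₜ[k] w)
  simpa [midAction] using this

theorem tensorOver_mk {H : Type u} [Group H] (L : Representation k (G × H) V)
    (M : Representation k (H × K) W) (g : G) (x : K) (v : V) (w : W) :
    tensorOver L M (g, x) (Representation.Coinvariants.mk (midAction L M) (v ⊗ₜ[k] w)) =
      Representation.Coinvariants.mk (midAction L M) (L (g, 1) v ⊗ₜ[k] M (1, x) w) := rfl

section Left

variable (ρ : Representation k G V) (σ : Representation k (G × K) W)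

/-- The map `kG ⊗ V → Hom(W, V ⊗ W)` underlying `indTensorHom`. -/
noncomputable def indTensorAux :
    MonoidAlgebra k (G × G) ⊗[k] V →ₗ[k] W →ₗ[k] V ⊗[k] W :=
  -- In the induced module y ⊗ v = (1, y.1⁻¹ y.2) ⊗ y.1⁻¹ v, and the element y.1⁻¹ y.2 crosses the
  -- tensor product over kG to act on w.
  TensorProduct.lift ((MonoidAlgebra.basis (G × G) k).constr k fun y =>
    (TensorProduct.mk k V W).compl₁₂ (ρ y.1⁻¹) (σ (y.1⁻¹ * y.2, 1)))

theorem indTensorAux_single (y : G × G) (v : V) (w : W) :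
    indTensorAux ρ σ (MonoidAlgebra.single y 1 ⊗ₜ v) w = ρ y.1⁻¹ v ⊗ₜ σ (y.1⁻¹ * y.2, 1) w := by
  have h : (MonoidAlgebra.basis (G × G) k) y = MonoidAlgebra.single y 1 := by simp
  rw [indTensorAux, TensorProduct.lift.tmul, ← h, Module.Basis.constr_basis]
  rfl

/-- The canonical map `(Ind V) ⊗_{kG} W → V ⊗ W`. -/
noncomputable def indTensorHom :
    (midAction (Representation.ind (diag G) ρ) σ).Coinvariants →ₗ[k] V ⊗[k] W :=
  Representation.Coinvariants.lift _ (TensorProduct.lift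
    (Representation.Coinvariants.lift _ (indTensorAux ρ σ) (by
      intro g
      refine TensorProduct.ext (MonoidAlgebra.lhom_ext' fun y => LinearMap.ext_ring ?_)
      refine LinearMap.ext fun v => LinearMap.ext fun w => ?_
      simp [indTensorAux_single, mul_assoc]))) (by
    intro h
    refine TensorProduct.ext (Representation.IndV.hom_ext (diag G) ρ fun y =>
      LinearMap.ext fun v => LinearMap.ext fun w => ?_)
    simp [midAction, indTensorAux_single]
    rw [← Module.End.mul_apply, ← map_mul]
    simp [mul_assoc])

theorem indTensorHom_mk (y : G × G) (v : V) (w : W) :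
    indTensorHom ρ σ (Representation.Coinvariants.mk _
      (Representation.IndV.mk (diag G) ρ y v ⊗ₜ[k] w)) =
      ρ y.1⁻¹ v ⊗ₜ σ (y.1⁻¹ * y.2, 1) w :=
  indTensorAux_single ρ σ y v w

/-- The map `V ⊗ W → (Ind V) ⊗_{kG} W` inverse to `indTensorHom`. -/
noncomputable def indTensorInv :
    V ⊗[k] W →ₗ[k] (midAction (Representation.ind (diag G) ρ) σ).Coinvariants :=
  Representation.Coinvariants.mk _ ∘ₗ
    TensorProduct.map (Representation.IndV.mk (diag G) ρ 1) LinearMap.id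

theorem indTensorInv_tmul (v : V) (w : W) :
    indTensorInv ρ σ (v ⊗ₜ w) = Representation.Coinvariants.mk _
      (Representation.IndV.mk (diag G) ρ 1 v ⊗ₜ[k] w) := rfl

/-- `(Ind_{ΔG}^{G × G} V) ⊗_{kG} W` is isomorphic to `V ⊗ W`, where `K` acts trivially on `V`. -/
theorem nonempty_tensorOver_ind_equiv :
    Nonempty ((tensorOver (Representation.ind (diag G) ρ) σ).Equiv
      (resTensor (MonoidHom.fst G K) ρ σ)) := by
  refine ⟨Representation.Equiv.mk
    (LinearEquiv.ofLinearMap (indTensorHom ρ σ) (indTensorInv ρ σ) ?_ ?_) ?_⟩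
  · refine TensorProduct.ext' fun v w => ?_
    rw [LinearMap.comp_apply, indTensorInv_tmul, indTensorHom_mk]
    simp [← Prod.one_eq_mk]
  · refine Representation.Coinvariants.hom_ext (TensorProduct.ext
      (Representation.IndV.hom_ext (diag G) ρ fun y =>
      LinearMap.ext fun v => LinearMap.ext fun w => ?_))
    change indTensorInv ρ σ (indTensorHom ρ σ (Representation.Coinvariants.mk _
      (Representation.IndV.mk (diag G) ρ y v ⊗ₜ[k] w))) = Representation.Coinvariants.mk _
      (Representation.IndV.mk (diag G) ρ y v ⊗ₜ[k] w)
    -- The element y.1⁻¹ y.2 is moved back across the tensor product; the diagonal relation for y.1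
    -- then restores y ⊗ v.
    rw [indTensorHom_mk, indTensorInv_tmul,
      ← midAction_mk_eq _ _ (y.1⁻¹ * y.2)⁻¹, ← Module.End.mul_apply, ← map_mul]
    rw [Representation.ind_mk, ← indDiag_mk_eq ρ _ y.1, ← Module.End.mul_apply, ← map_mul]
    simp [← Prod.one_eq_mk]
  · rintro ⟨g, x⟩
    refine Representation.Coinvariants.hom_ext (TensorProduct.ext
      (Representation.IndV.hom_ext (diag G) ρ fun y =>
      LinearMap.ext fun v => LinearMap.ext fun w => ?_))
    change indTensorHom ρ σ (tensorOver _ _ (g, x) (Representation.Coinvariants.mk _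
      (Representation.IndV.mk (diag G) ρ y v ⊗ₜ[k] w))) =
      resTensor (MonoidHom.fst G K) ρ σ (g, x) (indTensorHom ρ σ (Representation.Coinvariants.mk _
      (Representation.IndV.mk (diag G) ρ y v ⊗ₜ[k] w)))
    rw [tensorOver_mk, Representation.ind_mk, indTensorHom_mk, indTensorHom_mk,
      Representation.tprod_apply, TensorProduct.map_tmul, ← Module.End.mul_apply, ← map_mul]
    rw [← Module.End.mul_apply, MonoidHom.comp_apply, ← map_mul, ← Module.End.mul_apply, ← map_mul]
    simp [mul_assoc]

end Left

section Right

variable (ρ : Representation k K V) (σ : Representation k (G × K) W)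

/-- The map `kK ⊗ V → Hom(W, V ⊗ W)` underlying `tensorIndHom`. -/
noncomputable def tensorIndAux :
    MonoidAlgebra k (K × K) ⊗[k] V →ₗ[k] W →ₗ[k] V ⊗[k] W :=
  TensorProduct.lift ((MonoidAlgebra.basis (K × K) k).constr k fun y =>
    (TensorProduct.mk k V W).compl₁₂ (ρ y.2⁻¹) (σ (1, y.2⁻¹ * y.1)))

theorem tensorIndAux_single (y : K × K) (v : V) (w : W) :
    tensorIndAux ρ σ (MonoidAlgebra.single y 1 ⊗ₜ v) w = ρ y.2⁻¹ v ⊗ₜ σ (1, y.2⁻¹ * y.1) w := by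
  have h : (MonoidAlgebra.basis (K × K) k) y = MonoidAlgebra.single y 1 := by simp
  rw [tensorIndAux, TensorProduct.lift.tmul, ← h, Module.Basis.constr_basis]
  rfl

/-- The canonical map `W ⊗_{kK} (Ind V) → V ⊗ W`. -/
noncomputable def tensorIndHom :
    (midAction σ (Representation.ind (diag K) ρ)).Coinvariants →ₗ[k] V ⊗[k] W :=
  Representation.Coinvariants.lift _ (TensorProduct.lift
    (Representation.Coinvariants.lift _ (tensorIndAux ρ σ) (by
      intro g
      refine TensorProduct.ext (MonoidAlgebra.lhom_ext' fun y => LinearMap.ext_ring ?_)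
      refine LinearMap.ext fun v => LinearMap.ext fun w => ?_
      simp [tensorIndAux_single, mul_assoc])).flip) (by
    intro h
    refine TensorProduct.ext (LinearMap.ext fun w =>
      Representation.IndV.hom_ext (diag K) ρ fun y => LinearMap.ext fun v => ?_)
    simp [midAction, tensorIndAux_single]
    rw [← Module.End.mul_apply, ← map_mul]
    simp [mul_assoc])

theorem tensorIndHom_mk (y : K × K) (v : V) (w : W) :
    tensorIndHom ρ σ (Representation.Coinvariants.mk _
      (w ⊗ₜ[k] Representation.IndV.mk (diag K) ρ y v)) =
      ρ y.2⁻¹ v ⊗ₜ σ (1, y.2⁻¹ * y.1) w :=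
  tensorIndAux_single ρ σ y v w

/-- The map `V ⊗ W → W ⊗_{kK} (Ind V)` inverse to `tensorIndHom`. -/
noncomputable def tensorIndInv :
    V ⊗[k] W →ₗ[k] (midAction σ (Representation.ind (diag K) ρ)).Coinvariants :=
  Representation.Coinvariants.mk _ ∘ₗ
    TensorProduct.map LinearMap.id (Representation.IndV.mk (diag K) ρ 1) ∘ₗ
      (TensorProduct.comm k V W).toLinearMap

theorem tensorIndInv_tmul (v : V) (w : W) :
    tensorIndInv ρ σ (v ⊗ₜ w) = Representation.Coinvariants.mk _
      (w ⊗ₜ[k] Representation.IndV.mk (diag K) ρ 1 v) := rfl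

theorem tensorInd_hom_ext {U : Type*} [AddCommGroup U] [Module k U]
    {f g : (midAction σ (Representation.ind (diag K) ρ)).Coinvariants →ₗ[k] U}
    (h : ∀ w y v, f (Representation.Coinvariants.mk _
      (w ⊗ₜ[k] Representation.IndV.mk (diag K) ρ y v)) = g (Representation.Coinvariants.mk _
      (w ⊗ₜ[k] Representation.IndV.mk (diag K) ρ y v))) : f = g := by
  refine Representation.Coinvariants.hom_ext (TensorProduct.ext (LinearMap.ext fun w => ?_))
  exact Representation.IndV.hom_ext (diag K) ρ fun y => LinearMap.ext fun v => h w y v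

/-- `W ⊗_{kK} (Ind_{ΔK}^{K × K} V)` is isomorphic to `V ⊗ W`, where `G` acts trivially on `V`. -/
theorem nonempty_tensorOver_ind_equiv' :
    Nonempty ((tensorOver σ (Representation.ind (diag K) ρ)).Equiv
      (resTensor (MonoidHom.snd G K) ρ σ)) := by
  refine ⟨Representation.Equiv.mk
    (LinearEquiv.ofLinearMap (tensorIndHom ρ σ) (tensorIndInv ρ σ) ?_ ?_) ?_⟩
  · refine TensorProduct.ext' fun v w => ?_
    rw [LinearMap.comp_apply, tensorIndInv_tmul, tensorIndHom_mk]
    simp [← Prod.one_eq_mk]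
  · refine tensorInd_hom_ext ρ σ fun w y v => ?_
    rw [LinearMap.comp_apply, LinearMap.id_apply, tensorIndHom_mk, tensorIndInv_tmul,
      ← midAction_mk_eq _ _ (y.2⁻¹ * y.1)⁻¹, ← Module.End.mul_apply, ← map_mul]
    rw [Representation.ind_mk, ← indDiag_mk_eq ρ _ y.2, ← Module.End.mul_apply, ← map_mul]
    simp [← Prod.one_eq_mk]
  · rintro ⟨g, x⟩
    refine tensorInd_hom_ext ρ σ fun w y v => ?_
    change tensorIndHom ρ σ (tensorOver _ _ (g, x) (Representation.Coinvariants.mk _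
      (w ⊗ₜ[k] Representation.IndV.mk (diag K) ρ y v))) =
      resTensor (MonoidHom.snd G K) ρ σ (g, x) (tensorIndHom ρ σ (Representation.Coinvariants.mk _
      (w ⊗ₜ[k] Representation.IndV.mk (diag K) ρ y v)))
    rw [tensorOver_mk, Representation.ind_mk, tensorIndHom_mk, tensorIndHom_mk,
      Representation.tprod_apply, TensorProduct.map_tmul, ← Module.End.mul_apply, ← map_mul]
    rw [← Module.End.mul_apply, MonoidHom.comp_apply, ← map_mul, ← Module.End.mul_apply, ← map_mul]
    simp [mul_assoc]

end Right

end IndDiag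

/-! ### The species of a product with induced modules -/

section Species

variable {k G : Type u} [Field k] [Group G] {F : Type v} [Field F]

theorem FT.hom_ext {A : Type*} [AddCommGroup A] [Module F A] {f g : FT k G F →ₗ[F] A}
    (h : ∀ M : PPerm k G, f (M.clsF F) = g (M.clsF F)) : f = g := by
  refine TensorProduct.AlgebraTensorModule.curry_injective (LinearMap.ext_ring ?_)
  refine LinearMap.toAddMonoidHom_injective (T.hom_ext fun M => ?_)
  exact h M

/-- The quotient map by the span agrees with the zero map on all classes of modules, hence is zero.
-/
theorem span_clsF : Submodule.span F (Set.range fun M : PPerm k G => M.clsF F) = ⊤ := by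
  rw [← Submodule.ker_mkQ (Submodule.span F _), LinearMap.ker_eq_top]
  refine FT.hom_ext fun M => ?_
  rw [LinearMap.zero_apply, Submodule.mkQ_apply, Submodule.Quotient.mk_eq_zero]
  exact Submodule.subset_span ⟨M, rfl⟩

theorem tauF_clsF [Finite G] (φ : CommGroup.torsion kˣ →* Fˣ) (P : Subgroup G)
    (u : Subgroup.normalizer (P : Set G)) (M : PPerm k G) :
    tauF φ P u (M.clsF F) = tau φ P u M.ρ := by
  rw [tauF, PPerm.clsF, LinearMap.liftBaseChange_tmul, one_smul]
  exact T.lift_cls _ _ _ M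

theorem tilde_clsF [Finite G] (M : PPerm k G) : tilde (M.clsF F) = M.indDiag.clsF F := by
  rw [tilde, PPerm.clsF, LinearMap.baseChange_tmul, PPerm.clsF]
  congr 1
  exact T.lift_cls _ _ _ M

theorem tensorF_clsF {H K : Type u} [Group H] [Group K] (L : PPerm k (G × H))
    (M : PPerm k (H × K)) : tensorF (L.clsF F) (M.clsF F) = (L.tensor M).clsF F := by
  rw [tensorF, PPerm.clsF, LinearMap.liftBaseChange_tmul, one_smul, PPerm.clsF, PPerm.clsF]
  change LinearMap.baseChange F _ _ = _
  rw [LinearMap.baseChange_tmul]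
  congr 1
  change tensorT L.cls M.cls = _
  rw [tensorT, T.lift_cls, T.lift_cls]

variable {K : Type u} [Group K] [Finite G] [Finite K] [IsAlgClosed k] {p : ℕ} [Fact p.Prime]
  [CharP k p] (φ : CommGroup.torsion kˣ →* Fˣ) {D : Subgroup (G × K)} (hD : IsPGroup p D)
  (d : Subgroup.normalizer (D : Set (G × K))) (hd : (orderOf (d : G × K)).Coprime p)
include hD hd

/-- Both sides are bilinear, so e and ξ may be classes of modules. Then the product is a tensor
product over k in which the group acts on the first factor through the projection to G, and
`tau_resTensor` applies. -/
theorem tauF_tensorF_tilde_left (e : FT k G F) (ξ : FT k (G × K) F) :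
    tauF φ D d (tensorF (tilde e) ξ) =
      tauF φ (D.map (MonoidHom.fst G K)) (mapNormalizer _ D d) e * tauF φ D d ξ := by
  refine LinearMap.congr_fun (f := tauF φ D d ∘ₗ tensorF.flip ξ ∘ₗ tilde)
    (g := (LinearMap.mul F F).flip (tauF φ D d ξ) ∘ₗ tauF φ _ (mapNormalizer _ D d))
    (FT.hom_ext fun M => ?_) e
  change tauF φ D d (tensorF (tilde (M.clsF F)) ξ) = tauF φ _ _ (M.clsF F) * tauF φ D d ξ
  refine LinearMap.congr_fun (f := tauF φ D d ∘ₗ tensorF (tilde (M.clsF F)))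
    (g := LinearMap.mul F F (tauF φ _ (mapNormalizer _ D d) (M.clsF F)) ∘ₗ tauF φ D d)
    (FT.hom_ext fun N => ?_) ξ
  change tauF φ D d (tensorF (tilde (M.clsF F)) (N.clsF F)) =
    tauF φ _ _ (M.clsF F) * tauF φ D d (N.clsF F)
  rw [tilde_clsF, tensorF_clsF, tauF_clsF, tauF_clsF, tauF_clsF,
    ← tau_resTensor _ φ M.isPPermutation N.isPPermutation hD d hd]
  obtain ⟨E⟩ := nonempty_tensorOver_ind_equiv M.ρ N.ρ
  exact tau_equiv φ D d E

theorem tauF_tensorF_tilde_right (e : FT k K F) (ξ : FT k (G × K) F) :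
    tauF φ D d (tensorF ξ (tilde e)) =
      tauF φ (D.map (MonoidHom.snd G K)) (mapNormalizer _ D d) e * tauF φ D d ξ := by
  refine LinearMap.congr_fun (f := tauF φ D d ∘ₗ tensorF ξ ∘ₗ tilde)
    (g := (LinearMap.mul F F).flip (tauF φ D d ξ) ∘ₗ tauF φ _ (mapNormalizer _ D d))
    (FT.hom_ext fun M => ?_) e
  change tauF φ D d (tensorF ξ (tilde (M.clsF F))) = tauF φ _ _ (M.clsF F) * tauF φ D d ξ
  refine LinearMap.congr_fun (f := tauF φ D d ∘ₗ tensorF.flip (tilde (M.clsF F)))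
    (g := LinearMap.mul F F (tauF φ _ (mapNormalizer _ D d) (M.clsF F)) ∘ₗ tauF φ D d)
    (FT.hom_ext fun N => ?_) ξ
  change tauF φ D d (tensorF (N.clsF F) (tilde (M.clsF F))) =
    tauF φ _ _ (M.clsF F) * tauF φ D d (N.clsF F)
  rw [tilde_clsF, tensorF_clsF, tauF_clsF, tauF_clsF, tauF_clsF,
    ← tau_resTensor _ φ M.isPPermutation N.isPPermutation hD d hd]
  obtain ⟨E⟩ := nonempty_tensorOver_ind_equiv' M.ρ N.ρ
  exact tau_equiv φ D d E

end Species

/-! ### Elements of order prime to `p` -/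

section PPart

variable {G : Type*} [Group G] {p : ℕ} [Fact p.Prime]

/-- An element of finite order is the product of two of its powers, one of order a power of `p` and
one of order prime to `p`. -/
theorem exists_pPart_mul {g : G} (hg : IsOfFinOrder g) :
    ∃ a b m : ℕ, g = g ^ a * g ^ b ∧ (g ^ a) ^ p ^ m = 1 ∧ (orderOf (g ^ b)).Coprime p := by
  obtain ⟨m, c, hc, hm⟩ := Nat.exists_eq_pow_mul_and_not_dvd (orderOf_pos_iff.2 hg).ne' p
    (Fact.out : p.Prime).ne_one
  have hpc : (p ^ m).Coprime c :=
    Nat.Coprime.pow_left m (((Fact.out : p.Prime).coprime_iff_not_dvd).2 hc)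
  -- The order is p^m c with p not dividing c. The exponent a is 1 modulo p^m and 0 modulo c, and b
  -- is the reverse, so a + b ≡ 1 modulo the order.
  obtain ⟨a, ha1, ha2⟩ := Nat.chineseRemainder hpc 1 0
  obtain ⟨b, hb1, hb2⟩ := Nat.chineseRemainder hpc 0 1
  have ha3 : c ∣ a := (Nat.modEq_zero_iff_dvd).1 ha2
  have hb3 : p ^ m ∣ b := (Nat.modEq_zero_iff_dvd).1 hb1
  refine ⟨a, b, m, ?_, ?_, ?_⟩
  · rw [← pow_add]
    conv_lhs => rw [← pow_one g]
    rw [pow_eq_pow_iff_modEq, hm]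
    refine (Nat.modEq_and_modEq_iff_modEq_mul hpc).1 ⟨?_, ?_⟩
    · exact (ha1.add hb1).symm
    · exact (ha2.add hb2).symm
  · rw [← pow_mul, ← orderOf_dvd_iff_pow_eq_one, hm, mul_comm a]
    exact mul_dvd_mul_left _ ha3
  · have h1 : orderOf (g ^ b) ∣ c := by
      rw [orderOf_dvd_iff_pow_eq_one, ← pow_mul, ← orderOf_dvd_iff_pow_eq_one, hm]
      exact mul_dvd_mul_right hb3 _
    exact Nat.Coprime.coprime_dvd_left h1
      (((Fact.out : p.Prime).coprime_iff_not_dvd).2 hc).symm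

/-- The elements of order prime to `p` in a coset `sP` of a normalized `p`-subgroup `P` form one
`P`-conjugacy class. -/
theorem exists_conj_of_coprime {P : Subgroup G} [Finite P] (hP : IsPGroup p P) {s t : G}
    (hs : s ∈ Subgroup.normalizer (P : Set G)) (hso : (orderOf s).Coprime p)
    (hto : (orderOf t).Coprime p) (hst : s⁻¹ * t ∈ P) : ∃ a ∈ P, t = a * s * a⁻¹ := by
  classical
  -- Burnside's lemma: P acts by conjugation on the set Ω of p'-elements of sP, and the pairs (a, y)
  -- with a fixing y number |P| times the number of orbits. An injection of these pairs into P
  -- leaves room for only one orbit.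
  let Ω := {y : G // (orderOf y).Coprime p ∧ s⁻¹ * y ∈ P}
  have hfin : Finite Ω := Finite.of_injective (β := P) (fun y => ⟨s⁻¹ * y.1, y.2.2⟩)
    fun y z h => Subtype.ext (mul_left_cancel (congrArg Subtype.val h))
  let act : MulAction P Ω :=
    { smul := fun a y => ⟨a * y * (a : G)⁻¹, by
        constructor
        · have : orderOf ((a : G) * y * (a : G)⁻¹) = orderOf (y : G) :=
            orderOf_injective (MulAut.conj (a : G)).toMonoidHom (MulAut.conj (a : G)).injective y.1
          rw [this]
          exact y.2.1
        · have h1 : s⁻¹ * (a : G) * s ∈ P := (Subgroup.mem_set_normalizer_iff''.1 hs _).1 a.2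
          have h2 : s⁻¹ * ((a : G) * y * (a : G)⁻¹) = (s⁻¹ * a * s) * (s⁻¹ * y) * (a : G)⁻¹ := by
            group
          rw [h2]
          exact mul_mem (mul_mem h1 y.2.2) (inv_mem a.2)⟩
      one_smul := fun y => Subtype.ext (by
        change ((1 : P) : G) * y * ((1 : P) : G)⁻¹ = y
        simp)
      mul_smul := fun a b y => Subtype.ext (by
        change ((a * b : P) : G) * y * ((a * b : P) : G)⁻¹ = a * (b * y * (b : G)⁻¹) * (a : G)⁻¹
        simp [mul_assoc]) }
  have hact : ∀ (a : P) (y : Ω), ((a • y : Ω) : G) = a * y * (a : G)⁻¹ := fun _ _ => rfl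
  have hcomm : ∀ (a : P) (y : Ω), a • y = y → Commute (y : G) a := fun a y h => by
    have h1 := congrArg Subtype.val h
    rw [hact, mul_inv_eq_iff_eq_mul] at h1
    exact h1.symm
  -- Since a and y commute and have coprime orders, both can be recovered from the product ya.
  let f : (Σ a : P, MulAction.fixedBy Ω a) → P := fun z => ⟨s⁻¹ * z.2.1 * z.1,
    mul_mem z.2.1.2.2 z.1.2⟩
  have hf : Function.Injective f := by
    rintro ⟨a, y, hy⟩ ⟨b, z, hz⟩ h
    have h1 : (y : G) * a = z * b := by
      have := congrArg Subtype.val h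
      change s⁻¹ * (y : G) * a = s⁻¹ * z * b at this
      rw [mul_assoc, mul_assoc] at this
      exact mul_left_cancel this
    obtain ⟨r, hr⟩ := IsPGroup.iff_card.1 hP
    have hcop : (Nat.card P).Coprime (orderOf (y : G) * orderOf (z : G)) := by
      rw [hr]
      exact Nat.Coprime.pow_left r (y.2.1.mul_left z.2.1).symm
    -- The m-th power kills P and fixes both y and z, so it extracts y from ya and z from zb.
    obtain ⟨m, hm1, hm2⟩ := Nat.chineseRemainder hcop 0 1
    have hpow : ∀ (c : P) (w : Ω), c • w = w → m ≡ 1 [MOD orderOf (w : G)] →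
        ((w : G) * c) ^ m = w := by
      intro c w hw hmw
      rw [(hcomm c w hw).mul_pow]
      have h2 : (c : G) ^ m = 1 := by
        rw [← orderOf_dvd_iff_pow_eq_one, Subgroup.orderOf_coe]
        exact (orderOf_dvd_natCard c).trans ((Nat.modEq_zero_iff_dvd).1 hm1)
      have h3 : (w : G) ^ m = (w : G) ^ 1 := pow_eq_pow_iff_modEq.2 hmw
      rw [h2, h3, pow_one, mul_one]
    have h4 : (y : G) = z := by
      rw [← hpow a y hy (hm2.of_mul_right _), h1, hpow b z hz (hm2.of_mul_left _)]
    have h5 : y = z := Subtype.ext h4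
    have h6 : a = b := by
      rw [h4] at h1
      exact Subtype.ext (mul_left_cancel h1)
    subst h5 h6
    rfl
  have hcard : Nat.card (MulAction.orbitRel.Quotient P Ω) * Nat.card P ≤ 1 * Nat.card P := by
    rw [← Nat.card_prod, one_mul,
      ← Nat.card_congr (MulAction.sigmaFixedByEquivOrbitsProdGroup P Ω)]
    exact Nat.card_le_card_of_injective f hf
  have hle := Nat.le_of_mul_le_mul_right hcard Nat.card_pos
  have hsub : Subsingleton (MulAction.orbitRel.Quotient P Ω) :=
    (Finite.card_le_one_iff_subsingleton).1 hle
  let ys : Ω := ⟨s, hso, by simp⟩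
  let yt : Ω := ⟨t, hto, hst⟩
  have h7 : (Quotient.mk _ yt : MulAction.orbitRel.Quotient P Ω) = Quotient.mk _ ys :=
    Subsingleton.elim _ _
  obtain ⟨a, ha⟩ := MulAction.orbitRel_apply.1 (Quotient.exact h7)
  exact ⟨a, a.2, (congrArg Subtype.val ha).symm⟩

end PPart

namespace Pair

variable {p : ℕ} {G : Type*} [Group G]

theorem IsConj.refl (x : Pair p G) : x.IsConj x := ⟨1, by ext; simp, by simp⟩

theorem IsConj.symm {x y : Pair p G} (h : x.IsConj y) : y.IsConj x := by
  obtain ⟨g, h1, h2⟩ := h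
  refine ⟨g⁻¹, ?_, by rw [h2]; group⟩
  rw [h1, Subgroup.map_map]
  ext a
  simp [mul_assoc]

theorem IsConj.trans {x y z : Pair p G} (h : x.IsConj y) (h' : y.IsConj z) : x.IsConj z := by
  obtain ⟨g, h1, h2⟩ := h
  obtain ⟨g', h1', h2'⟩ := h'
  refine ⟨g' * g, ?_, by rw [h2', h2]; group⟩
  rw [h1', h1, Subgroup.map_map]
  congr 1
  ext a
  simp [mul_assoc]

theorem IsConj.card_eq {x y : Pair p G} (h : x.IsConj y) : Nat.card y.P = Nat.card x.P := by
  obtain ⟨g, h1, -⟩ := h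
  rw [h1]
  exact Subgroup.card_map_of_injective (MulAut.conj g).injective

variable (p G) in
/-- Conjugacy of pairs as a setoid. -/
def conjSetoid : Setoid (Pair p G) :=
  ⟨IsConj, IsConj.refl, IsConj.symm, IsConj.trans⟩

instance [Finite G] : Finite (Pair p G) :=
  Finite.of_injective (β := Subgroup G × G) (fun x => (x.P, x.s)) fun x y h => by
    cases x; cases y; simp_all

variable (p G) in
/-- The conjugacy classes of pairs. -/
abbrev ConjClass : Type _ := Quotient (conjSetoid p G)

instance [Finite G] : Finite (ConjClass p G) := Quotient.finite _

theorem isConj_out (x : Pair p G) : (Quotient.mk (conjSetoid p G) x).out.IsConj x :=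
  Quotient.exact (s := conjSetoid p G) (Quotient.out_eq _)

end Pair

/-! ### Eigenspaces of endomorphisms of finite order -/

section Eigen

variable {k G : Type*} [Field k] [Group G] {V : Type*} [AddCommGroup V] [Module k V]
  {ρ : Representation k G V}

theorem intertwining_pow_apply (α : ρ.IntertwiningMap ρ) (j : ℕ) (v : V) :
    (α ^ j) v = (α.toLinearMap ^ j) v := by
  induction j generalizing v with
  | zero => rfl
  | succ j ih => rw [pow_succ, pow_succ, Representation.IntertwiningMap.mul_apply, ih]; rfl

/-- The eigenspace of an endomorphism of a module, as a submodule. -/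
def eigenSub (α : ρ.IntertwiningMap ρ) (c : k) : Subrepresentation ρ where
  toSubmodule := Module.End.eigenspace α.toLinearMap c
  apply_mem_toSubmodule g v hv := by
    rw [Module.End.mem_eigenspace_iff] at hv ⊢
    have := α.isIntertwining _ _ g v
    change α (ρ g v) = _
    rw [this]
    change ρ g (α.toLinearMap v) = _
    rw [hv, map_smul]

theorem mem_eigenSub {α : ρ.IntertwiningMap ρ} {c : k} {v : V} :
    v ∈ (eigenSub α c).toSubmodule ↔ α v = c • v :=
  Module.End.mem_eigenspace_iff

/-- The inclusion of a submodule. -/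
def subIncl (A : Subrepresentation ρ) : A.toRepresentation.IntertwiningMap ρ :=
  ⟨A.toSubmodule.subtype, fun _ => rfl⟩

variable (α : ρ.IntertwiningMap ρ) {n : ℕ} (hα : α ^ n = 1)

/-- The multiple of the projection onto an eigenspace of an endomorphism of finite order. -/
noncomputable def eigenSum (n : ℕ) (c : k) : ρ.IntertwiningMap ρ :=
  ∑ j ∈ Finset.range n, c ^ (n - 1 - j) • α ^ j

theorem eigenSum_apply_of_mem (n : ℕ) {c d : k} {v : V} (hv : α v = d • v) :
    eigenSum α n c v = (∑ j ∈ Finset.range n, d ^ j * c ^ (n - 1 - j)) • v := by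
  have h1 : ∀ j : ℕ, (α ^ j) v = d ^ j • v := fun j => by
    induction j with
    | zero => simp
    | succ j ih =>
      rw [pow_succ', Representation.IntertwiningMap.mul_apply, ih, map_smul, hv, smul_smul,
        pow_succ]
  rw [eigenSum, Representation.IntertwiningMap.sum_apply, Finset.sum_smul]
  refine Finset.sum_congr rfl fun j _ => ?_
  rw [Representation.IntertwiningMap.smul_apply, h1, smul_smul, mul_comm]

variable {α}
include hα

/-- The sum is the cofactor of α - c in the factorization of αⁿ - cⁿ, and the latter is zero. -/
theorem eigenSum_mem {c : k} (hc : c ^ n = 1) (v : V) :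
    eigenSum α n c v ∈ (eigenSub α c).toSubmodule := by
  have h0 : α.toLinearMap ^ n = 1 := LinearMap.ext fun v => by
    rw [← intertwining_pow_apply, hα]; rfl
  have hs : (eigenSum α n c).toLinearMap = ∑ j ∈ Finset.range n,
      α.toLinearMap ^ j * (algebraMap k (Module.End k V) c) ^ (n - 1 - j) := by
    refine LinearMap.ext fun v => ?_
    change eigenSum α n c v = _
    rw [eigenSum, Representation.IntertwiningMap.sum_apply, LinearMap.sum_apply]
    refine Finset.sum_congr rfl fun j _ => ?_
    rw [Representation.IntertwiningMap.smul_apply, intertwining_pow_apply, ← map_pow,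
      Algebra.algebraMap_eq_smul_one, mul_smul_comm, mul_one, LinearMap.smul_apply]
  have h : (α.toLinearMap - algebraMap k _ c) * (eigenSum α n c).toLinearMap = 0 := by
    rw [hs, (Algebra.commute_algebraMap_right c α.toLinearMap).mul_geom_sum₂, h0, ← map_pow, hc,
      map_one, sub_self]
  have h1 : α (eigenSum α n c v) - c • eigenSum α n c v = 0 := LinearMap.congr_fun h v
  exact mem_eigenSub.2 (sub_eq_zero.1 h1)

/-- The projection onto an eigenspace of an endomorphism of finite order. -/
noncomputable def eigenProj {c : k} (hc : c ^ n = 1) :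
    ρ.IntertwiningMap (eigenSub α c).toRepresentation :=
  ((n : k) * c ^ (n - 1))⁻¹ •
    ⟨(eigenSum α n c).toLinearMap.codRestrict _ (eigenSum_mem hα hc), fun g =>
      LinearMap.ext fun v => Subtype.ext ((eigenSum α n c).isIntertwining _ _ g v)⟩

theorem eigenProj_coe {c : k} (hc : c ^ n = 1) (v : V) :
    (eigenProj hα hc v : V) = ((n : k) * c ^ (n - 1))⁻¹ • eigenSum α n c v := rfl

/-- On the eigenspace of c each of the n terms acts as c^(n-1); this is the source of the
normalizing factor n c^(n-1). -/
theorem eigenProj_of_mem (hn : (n : k) ≠ 0) {c : k} (hc : c ^ n = 1) {v : V} (hv : α v = c • v) :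
    (eigenProj hα hc v : V) = v := by
  have hc0 : c ≠ 0 := by
    rintro rfl
    rw [zero_pow (by rintro rfl; simp at hn)] at hc
    exact zero_ne_one hc
  have h1 : ∑ j ∈ Finset.range n, c ^ j * c ^ (n - 1 - j) = (n : k) * c ^ (n - 1) := by
    rw [Finset.sum_congr rfl fun j hj => ?_, Finset.sum_const, Finset.card_range, nsmul_eq_mul]
    rw [← pow_add]
    congr 1
    have := Finset.mem_range.1 hj
    omega
  rw [eigenProj_coe, eigenSum_apply_of_mem α n hv, h1, smul_smul,
    inv_mul_cancel₀ (mul_ne_zero hn (pow_ne_zero _ hc0)), one_smul]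

/-- On the eigenspace of d the sum acts as the quotient of dⁿ - cⁿ = 0 by d - c ≠ 0. -/
theorem eigenProj_of_mem_ne {c d : k} (hc : c ^ n = 1) (hd : d ^ n = 1) (hcd : d ≠ c) {v : V}
    (hv : α v = d • v) : eigenProj hα hc v = 0 := by
  refine Subtype.ext ?_
  have h1 : (d - c) * ∑ j ∈ Finset.range n, d ^ j * c ^ (n - 1 - j) = 0 := by
    rw [(Commute.all d c).mul_geom_sum₂, hc, hd, sub_self]
  rw [eigenProj_coe, eigenSum_apply_of_mem α n hv,
    (mul_eq_zero.1 h1).resolve_left (sub_ne_zero.2 hcd), zero_smul, smul_zero]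
  rfl

variable [Module.Finite k V] [IsAlgClosed k]

theorem sum_eigenProj (hn : (n : k) ≠ 0) [Fintype {c : k // c ^ n = 1}] (v : V) :
    ∑ c : {c : k // c ^ n = 1}, (eigenProj hα c.2 v : V) = v := by
  have h0 : α.toLinearMap ^ n = 1 := LinearMap.ext fun v => by
    rw [← intertwining_pow_apply, hα]; rfl
  obtain ⟨b, μ, hb, hμ⟩ := exists_eigenbasis hn h0
  refine LinearMap.congr_fun (f := ∑ c : {c : k // c ^ n = 1},
    (eigenSub α (c : k)).toSubmodule.subtype ∘ₗ (eigenProj hα c.2).toLinearMap) (g := .id) ?_ v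
    |> fun h => by simpa using h
  refine b.ext fun i => ?_
  rw [LinearMap.sum_apply, Finset.sum_eq_single ⟨μ i, hμ i⟩]
  · exact eigenProj_of_mem hα hn (hμ i) (hb i)
  · intro c _ hc
    have : eigenProj hα c.2 (b i) = 0 := eigenProj_of_mem_ne hα c.2 (hμ i)
      (fun h => hc (Subtype.ext h.symm)) (hb i)
    exact congrArg Subtype.val this
  · simp

end Eigen

/-! ### Eigenspaces as p-permutation modules and their species -/

theorem eigenSub_isDirectSummand {k G V : Type u} [Field k] [Group G] [AddCommGroup V] [Module k V]
    {ρ : Representation k G V} {α : ρ.IntertwiningMap ρ} {n : ℕ} (hα : α ^ n = 1)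
    (hn : (n : k) ≠ 0) {c : k} (hc : c ^ n = 1) :
    IsDirectSummand (eigenSub α c).toRepresentation ρ :=
  ⟨subIncl _, eigenProj hα hc, DFunLike.ext _ _ fun v =>
    Subtype.ext (eigenProj_of_mem hα hn hc (mem_eigenSub.1 v.2))⟩

theorem IsDirectSummand.trans {k G U V W : Type u} [Field k] [Group G] [AddCommGroup U] [Module k U]
    [AddCommGroup V] [Module k V] [AddCommGroup W] [Module k W] {ρ : Representation k G U}
    {σ : Representation k G V} {τ : Representation k G W} (h : IsDirectSummand ρ σ)
    (h' : IsDirectSummand σ τ) : IsDirectSummand ρ τ := by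
  obtain ⟨i, q, hq⟩ := h
  obtain ⟨i', q', hq'⟩ := h'
  refine ⟨i'.comp i, q.comp q', DFunLike.ext _ _ fun v => ?_⟩
  have h1 : ∀ w, q' (i' w) = w := fun w => congrArg (fun f => f w) hq'
  have h2 : ∀ w, q (i w) = w := fun w => congrArg (fun f => f w) hq
  simp [h1, h2]

theorem IsPPermutation.of_isDirectSummand {k G V W : Type u} [Field k] [Group G] [AddCommGroup V]
    [Module k V] [AddCommGroup W] [Module k W] {ρ : Representation k G V}
    {σ : Representation k G W} (h : IsDirectSummand ρ σ) (hσ : IsPPermutation σ) :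
    IsPPermutation ρ := by
  obtain ⟨U, _, _, υ, hυ, h'⟩ := hσ
  exact ⟨U, _, _, υ, hυ, h.trans h'⟩

section TauEigen

variable {k G : Type u} [Field k] [Group G] {F : Type v} [Field F]

/-- The permutation module of a finite `G`-set, as a p-permutation module. -/
noncomputable def PPerm.perm (k : Type u) [Field k] (G : Type u) [Group G] (X : Type u) [Finite X]
    [MulAction G X] : PPerm k G where
  V := X → k
  ρ := permRep k X
  isPPermutation := ⟨_, _, _, permRep k X, isPermutation_permRep X, .id _, .id _, rfl⟩

/-- An eigenspace of an endomorphism of finite order, as a p-permutation module. -/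
noncomputable def PPerm.eigen (M : PPerm k G) {α : M.ρ.IntertwiningMap M.ρ} {n : ℕ}
    (hα : α ^ n = 1) (hn : (n : k) ≠ 0) {c : k} (hc : c ^ n = 1) : PPerm k G where
  V := (eigenSub α c).toSubmodule
  ρ := (eigenSub α c).toRepresentation
  isPPermutation := .of_isDirectSummand (eigenSub_isDirectSummand hα hn hc) M.isPPermutation

variable [IsAlgClosed k] [Finite G] (φ : CommGroup.torsion kˣ →* Fˣ)
  {p : ℕ} [Fact p.Prime] [CharP k p]

/-- The inclusions of and projections to the eigenspaces pass to the Brauer construction and split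
M[P] into the constructions of the eigenspaces, on which α acts as a scalar c. Weighting by the
lifts of the c assembles the species of the summands into a single lifted trace on M[P]. -/
theorem sum_tau_eigen (M : PPerm k G) {α : M.ρ.IntertwiningMap M.ρ} {n : ℕ}
    (hα : α ^ n = 1) (hn : (n : k) ≠ 0) [Fintype {c : k // c ^ n = 1}] (P : Subgroup G)
    (u : Subgroup.normalizer (P : Set G)) (hu : (orderOf (u : G)).Coprime p) :
    ∑ c : {c : k // c ^ n = 1}, liftRoot φ (c : k) * tau φ P u (M.eigen hα hn c.2).ρ =
      liftTrace φ ((brauerMap P α).toLinearMap ∘ₗ brauerRep M.ρ P u) := by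
  classical
  have hu' := natCast_ne_zero_of_coprime (k := k) (Fact.out : p.Prime) hu
  -- The product n · |u| is a common exponent of u and of the scalars c, still invertible in k.
  have hN : ((n * orderOf (u : G) : ℕ) : k) ≠ 0 := by
    rw [Nat.cast_mul]; exact mul_ne_zero hn hu'
  let i (c : {c : k // c ^ n = 1}) := brauerMap P (subIncl (eigenSub α (c : k)))
  let q (c : {c : k // c ^ n = 1}) := brauerMap P (eigenProj hα c.2)
  have hqi : ∀ c x, q c (i c x) = x := fun c x => by
    induction x using Submodule.Quotient.induction_on with | H x => ?_
    exact congrArg (Submodule.mkQ _) (Subtype.ext (Subtype.ext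
      (eigenProj_of_mem hα hn c.2 (mem_eigenSub.1 x.1.2))))
  have hqi0 : ∀ c d x, c ≠ d → q c (i d x) = 0 := fun c d x hcd => by
    induction x using Submodule.Quotient.induction_on with | H x => ?_
    exact congrArg (Submodule.mkQ _) (Subtype.ext (eigenProj_of_mem_ne hα c.2 d.2
      (fun h => hcd (Subtype.ext h.symm)) (mem_eigenSub.1 x.1.2)))
  have hiq : ∀ x, ∑ c, i c (q c x) = x := fun x => by
    induction x using Submodule.Quotient.induction_on with | H x => ?_
    change ∑ c, Submodule.mkQ _ _ = _
    rw [← map_sum]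
    refine congrArg (Submodule.mkQ _) (Subtype.ext ?_)
    rw [AddSubmonoidClass.coe_finsetSum]
    exact sum_eigenProj hα hn x.1
  have hsum : ∀ d x, LinearMap.lsum k _ k (fun c => (i c).toLinearMap) (Pi.single d x) = i d x :=
    fun d x => LinearMap.lsum_piSingle _ _ k (fun c => (i c).toLinearMap) d x
  let e : (∀ c : {c : k // c ^ n = 1}, BrauerQuotient (eigenSub α (c : k)).toRepresentation P)
      ≃ₗ[k] BrauerQuotient M.ρ P :=
    LinearEquiv.ofLinearMap (LinearMap.lsum k _ k fun c => (i c).toLinearMap)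
      (LinearMap.pi fun c => (q c).toLinearMap)
      (LinearMap.ext fun x => by
        simp only [LinearMap.comp_apply, LinearMap.lsum_apply, LinearMap.sum_apply]
        exact hiq x)
      (LinearMap.pi_ext' fun d => LinearMap.ext fun x => funext fun c => by
        change q c (LinearMap.lsum k _ k (fun c => (i c).toLinearMap) (Pi.single d x)) =
          (Pi.single d x : ∀ c : {c : k // c ^ n = 1},
            BrauerQuotient (eigenSub α (c : k)).toRepresentation P) c
        rw [hsum]
        by_cases hcd : c = d
        · subst hcd
          rw [Pi.single_eq_same, hqi]
        · rw [Pi.single_eq_of_ne hcd, hqi0 c d x hcd])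
  have he : ∀ d x, e (Pi.single d x) = i d x := hsum
  symm
  refine liftTrace_of_equiv_pi φ e hN (fun c => brauerRep _ P u) (fun c => ?_) (fun c => (c : k))
    (fun c => ?_) ?_
  · rw [mul_comm, pow_mul, brauerRep_pow_orderOf, one_pow]
  · rw [pow_mul, c.2, one_pow]
  · intro c x
    rw [he, he]
    induction x using Submodule.Quotient.induction_on with | H x => ?_
    change Submodule.mkQ _ _ = (c : k) • Submodule.mkQ _ _
    rw [← map_smul]
    refine congrArg (Submodule.mkQ _) (Subtype.ext ?_)
    exact mem_eigenSub.1 ((eigenSub α (c : k)).apply_mem_toSubmodule u x.1.2)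

end TauEigen

/-! ### Existence of the idempotents -/

section RightMul

variable {k : Type*} {G : Type*} [Field k] [Group G]

/-- The endomorphism of a permutation module induced by an equivariant permutation. -/
def permEnd (k : Type*) [Field k] {X : Type*} [MulAction G X] (π : Equiv.Perm X)
    (hπ : ∀ (g : G) x, π (g • x) = g • π x) :
    (permRep (G := G) k X).IntertwiningMap (permRep k X) :=
  ⟨LinearMap.funLeft k k π.symm, fun g => LinearMap.ext fun f => funext fun x => by
    change f (g⁻¹ • π.symm x) = f (π.symm (g⁻¹ • x))
    congr 1
    rw [Equiv.eq_symm_apply, hπ, Equiv.apply_symm_apply]⟩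

theorem permEnd_single {X : Type*} [MulAction G X] [DecidableEq X] (π : Equiv.Perm X)
    (hπ : ∀ (g : G) x, π (g • x) = g • π x) (x : X) (c : k) :
    permEnd k π hπ (Pi.single x c) = Pi.single (π x) c := by
  funext y
  change (Pi.single x c : X → k) (π.symm y) = _
  simp [Pi.single_apply, Equiv.symm_apply_eq]

theorem permEnd_pow {X : Type*} [MulAction G X] (π : Equiv.Perm X)
    (hπ : ∀ (g : G) x, π (g • x) = g • π x) {n : ℕ} (hn : π ^ n = 1) :
    permEnd k π hπ ^ n = 1 := by
  have h : ∀ (m : ℕ) (f : X → k), (permEnd k π hπ ^ m) f = fun x => f ((π ^ m).symm x) := by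
    intro m
    induction m with
    | zero => intro f; rfl
    | succ m ih =>
      intro f
      rw [pow_succ, Representation.IntertwiningMap.mul_apply, ih, pow_succ]
      rfl
  refine DFunLike.ext _ _ fun f => ?_
  rw [h, hn]
  rfl

/-- Right multiplication by an element of the normalizer on the cosets of a subgroup. -/
def rightMul (P : Subgroup G) : Subgroup.normalizer (P : Set G) →* (Equiv.Perm (G ⧸ P))ᵐᵒᵖ where
  toFun n := MulOpposite.op
    { toFun := Quotient.map' (fun g => g * n) fun a b h => by
        rw [QuotientGroup.leftRel_apply] at h ⊢
        have := (Subgroup.mem_set_normalizer_iff''.1 n.2 _).1 h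
        simpa [mul_assoc] using this
      invFun := Quotient.map' (fun g => g * (n : G)⁻¹) fun a b h => by
        rw [QuotientGroup.leftRel_apply] at h ⊢
        have := (Subgroup.mem_set_normalizer_iff.1 n.2 _).1 h
        simpa [mul_assoc] using this
      left_inv := fun x => by
        induction x using QuotientGroup.induction_on with | H x => ?_
        exact congrArg QuotientGroup.mk (mul_inv_cancel_right x (n : G))
      right_inv := fun x => by
        induction x using QuotientGroup.induction_on with | H x => ?_
        exact congrArg QuotientGroup.mk (inv_mul_cancel_right x (n : G)) }
  map_one' := MulOpposite.unop_injective (Equiv.ext fun x => by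
    induction x using QuotientGroup.induction_on with | H x => ?_
    exact congrArg QuotientGroup.mk (mul_one x))
  map_mul' m n := MulOpposite.unop_injective (Equiv.ext fun x => by
    induction x using QuotientGroup.induction_on with | H x => ?_
    exact congrArg QuotientGroup.mk (mul_assoc x m n).symm)

theorem rightMul_mk (P : Subgroup G) (n : Subgroup.normalizer (P : Set G)) (g : G) :
    (rightMul P n).unop (g : G ⧸ P) = ((g * n : G) : G ⧸ P) := rfl

theorem rightMul_smul (P : Subgroup G) (n : Subgroup.normalizer (P : Set G)) (g : G) (x : G ⧸ P) :
    (rightMul P n).unop (g • x) = g • (rightMul P n).unop x := by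
  induction x using QuotientGroup.induction_on with | H x => ?_
  exact congrArg QuotientGroup.mk (mul_assoc g x n)

/-- The endomorphism of `k[G/P]` given by right multiplication by an element of the normalizer. -/
def rightMulEnd (k : Type*) [Field k] (P : Subgroup G) (n : Subgroup.normalizer (P : Set G)) :
    (permRep (G := G) k (G ⧸ P)).IntertwiningMap (permRep k (G ⧸ P)) :=
  permEnd k (rightMul P n).unop (rightMul_smul P n)

theorem rightMulEnd_single (P : Subgroup G) [DecidableEq (G ⧸ P)]
    (n : Subgroup.normalizer (P : Set G)) (g : G) (c : k) :
    rightMulEnd k P n (Pi.single (g : G ⧸ P) c) = Pi.single ((g * n : G) : G ⧸ P) c :=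
  permEnd_single _ (rightMul_smul P n) _ _

end RightMul

/-! ### Cosets fixed by a pair -/

namespace Pair

variable {p : ℕ} {G : Type*} [Group G]

/-- The element of a pair, as an element of the normalizer. -/
def elt (x : Pair p G) : Subgroup.normalizer (x.P : Set G) := ⟨x.s, x.mem_normalizer⟩

/-- The fixed cosets that are counted by the species of the module attached to a pair. -/
def FixedCosets (y x : Pair p G) : Type _ :=
  {z : G ⧸ x.P // (∀ g ∈ y.P, g • z = z) ∧ y.s • (rightMul x.P x.elt⁻¹).unop z = z}

/-- The coset P itself is fixed, since s · 1 · s⁻¹ = 1; this is why the inverse of s multiplies on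
the right in `FixedCosets`. -/
theorem card_fixedCosets_self [Finite G] (x : Pair p G) : Nat.card (FixedCosets x x) ≠ 0 := by
  have : Finite (FixedCosets x x) := Subtype.finite
  have : Nonempty (FixedCosets x x) := by
    refine ⟨⟨((1 : G) : G ⧸ x.P), fun g hg => ?_, ?_⟩⟩
    · refine QuotientGroup.eq.2 ?_
      simpa using hg
    · rw [rightMul_mk]
      refine QuotientGroup.eq.2 ?_
      simp [elt]
  exact Nat.card_pos.ne'

theorem card_fixedCosets_conj {y y' : Pair p G} (h : y.IsConj y') (x : Pair p G) :
    Nat.card (FixedCosets y' x) = Nat.card (FixedCosets y x) := by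
  obtain ⟨g, h1, h2⟩ := h
  refine (Nat.card_congr ((MulAction.toPerm g).subtypeEquiv fun z => ?_)).symm
  refine and_congr ⟨fun h a ha => ?_, fun h a ha => ?_⟩ ?_
  · rw [h1] at ha
    obtain ⟨b, hb, rfl⟩ := ha
    have := h b hb
    change (g * b * g⁻¹) • g • z = g • z
    rw [← mul_smul, inv_mul_cancel_right, mul_smul, this]
  · have h3 := h (g * a * g⁻¹) (by rw [h1]; exact ⟨a, ha, rfl⟩)
    change (g * a * g⁻¹) • g • z = g • z at h3
    rw [← mul_smul, inv_mul_cancel_right, mul_smul] at h3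
    exact MulAction.injective g h3
  · change _ ↔ y'.s • (rightMul x.P x.elt⁻¹).unop (g • z) = g • z
    rw [h2, rightMul_smul, ← mul_smul, inv_mul_cancel_right, mul_smul]
    exact (MulAction.injective g).eq_iff.symm

/-- Write x = (P, s) and y = (Q, t). A fixed coset gP gives Q ≤ gPg⁻¹ and g⁻¹tg ∈ sP. If |P| ≤ |Q|,
then Q = gPg⁻¹, and the p'-elements of sP being conjugate under P makes the pairs conjugate. This is
the triangularity behind the existence of the idempotents. -/
theorem card_le_of_fixedCosets [Fact p.Prime] [Finite G] {y x : Pair p G}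
    (h : Nat.card (FixedCosets y x) ≠ 0) :
    Nat.card y.P ≤ Nat.card x.P ∧ (Nat.card x.P ≤ Nat.card y.P → x.IsConj y) := by
  obtain ⟨⟨z, hz1, hz2⟩⟩ : Nonempty (FixedCosets y x) := by
    by_contra h'
    rw [not_nonempty_iff] at h'
    exact h Nat.card_of_isEmpty
  induction z using QuotientGroup.induction_on with | H g => ?_
  have hle : y.P ≤ x.P.map (MulAut.conj g).toMonoidHom := fun a ha => by
    have h1 := QuotientGroup.eq.1 (hz1 a ha)
    change (a * g)⁻¹ * g ∈ x.P at h1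
    refine ⟨g⁻¹ * a * g, ?_, by simp [mul_assoc]⟩
    have h2 : g⁻¹ * a * g = ((a * g)⁻¹ * g)⁻¹ := by group
    rw [h2]
    exact inv_mem h1
  have hcard : Nat.card (x.P.map (MulAut.conj g).toMonoidHom) = Nat.card x.P :=
    Subgroup.card_map_of_injective (MulAut.conj g).injective
  refine ⟨hcard ▸ Subgroup.card_le_of_le hle, fun hxy => ?_⟩
  have heq : y.P = x.P.map (MulAut.conj g).toMonoidHom :=
    Subgroup.eq_of_le_of_card_ge hle (hcard.trans_le hxy)
  -- The coset equation gives s(g⁻¹t⁻¹g) ∈ P; inverting and conjugating by s, which normalizes P,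
  -- yields the form required by `exists_conj_of_coprime`.
  have h3 : x.s⁻¹ * (g⁻¹ * y.s * g) ∈ x.P := by
    rw [rightMul_mk] at hz2
    have h1 := QuotientGroup.eq.1 hz2
    change (y.s * (g * x.s⁻¹))⁻¹ * g ∈ x.P at h1
    have h2 : (y.s * (g * x.s⁻¹))⁻¹ * g = x.s * (g⁻¹ * y.s⁻¹ * g) := by group
    rw [h2] at h1
    have h4 := (Subgroup.mem_set_normalizer_iff''.1 x.mem_normalizer _).1 (inv_mem h1)
    have h5 : x.s⁻¹ * (x.s * (g⁻¹ * y.s⁻¹ * g))⁻¹ * x.s = x.s⁻¹ * (g⁻¹ * y.s * g) := by group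
    rwa [h5] at h4
  have ho : (orderOf (g⁻¹ * y.s * g)).Coprime p := by
    have : orderOf (g⁻¹ * y.s * g) = orderOf y.s := by
      have := orderOf_injective (MulAut.conj g⁻¹).toMonoidHom (MulAut.conj g⁻¹).injective y.s
      simpa using this
    rw [this]
    exact y.coprime
  obtain ⟨a, ha, hag⟩ := exists_conj_of_coprime x.isPGroup x.mem_normalizer x.coprime ho h3
  refine ⟨g * a, ?_, ?_⟩
  · rw [heq, map_mul]
    change _ = x.P.map ((MulAut.conj g).toMonoidHom.comp (MulAut.conj a).toMonoidHom)
    rw [← Subgroup.map_map]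
    congr 1
    ext b
    constructor
    · intro hb
      exact ⟨a⁻¹ * b * a, mul_mem (mul_mem (inv_mem ha) hb) ha, by simp [mul_assoc]⟩
    · rintro ⟨c, hc, rfl⟩
      exact mul_mem (mul_mem ha hc) (inv_mem ha)
  · have : y.s = g * (g⁻¹ * y.s * g) * g⁻¹ := by group
    rw [this, hag]
    group

end Pair

/-! ### Eigenspaces of k[G/P] attached to a pair -/

section EigenPerm

variable {p : ℕ} {G : Type*} [Group G]

theorem rightMulEnd_inv_pow (k : Type*) [Field k] (x : Pair p G) :
    rightMulEnd k x.P x.elt⁻¹ ^ orderOf x.s = 1 := by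
  refine permEnd_pow _ _ ?_
  have h1 : x.elt⁻¹ ^ orderOf x.s = 1 := Subtype.ext (by simp [Pair.elt, pow_orderOf_eq_one])
  rw [← MulOpposite.unop_pow, ← map_pow, h1, map_one, MulOpposite.unop_one]

theorem Pair.natCast_orderOf_ne_zero (k : Type*) [Field k] [CharP k p] [Fact p.Prime]
    (x : Pair p G) : ((orderOf x.s : ℕ) : k) ≠ 0 :=
  natCast_ne_zero_of_coprime (Fact.out : p.Prime) x.coprime

theorem finite_rootsOfOne {k : Type*} [Field k] {n : ℕ} (hn : 0 < n) :
    Finite {c : k // c ^ n = 1} :=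
  Finite.of_injective (β := {c // c ∈ Polynomial.nthRootsFinset n (1 : k)})
    (fun c => ⟨c.1, (Polynomial.mem_nthRootsFinset hn 1).2 c.2⟩) fun _ _ h =>
      Subtype.ext (Subtype.mk.inj h)

/-- The eigenspaces of right multiplication by `s⁻¹` on `k[G/P]`, for a pair `(P, s)`. -/
noncomputable def Pair.eigenPerm (k : Type u) [Field k] [CharP k p] [Fact p.Prime] {G : Type u}
    [Group G] [Finite G] (x : Pair p G) {c : k} (hc : c ^ orderOf x.s = 1) : PPerm k G :=
  (PPerm.perm k G (G ⧸ x.P)).eigen (α := rightMulEnd k x.P x.elt⁻¹) (rightMulEnd_inv_pow k x)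
    (x.natCast_orderOf_ne_zero k) hc

end EigenPerm

/-! ### Triangularity of the fixed-coset counts and the idempotents -/

section Existence

variable {k G : Type u} [Field k] [IsAlgClosed k] [Group G] [Finite G] {F : Type v} [Field F]
  [IsAlgClosed F] [CharZero F] {p : ℕ} [Fact p.Prime] [CharP k p]
  (φ : CommGroup.torsion kˣ →* Fˣ)

-- With x = (P, s) and y = (Q, t), `sum_tau_eigen` turns the sum into the lifted trace of gP ↦
-- tgs⁻¹P on k[G/P][Q]. This permutes the basis of Q-fixed cosets with order prime to p, so its
-- lifted trace is the number of its fixed points.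
include φ in
theorem sum_tau_eigenPerm (hφ : Function.Injective φ) (x y : Pair p G)
    [Fintype {c : k // c ^ orderOf x.s = 1}] :
    ∑ c : {c : k // c ^ orderOf x.s = 1}, liftRoot φ (c : k) *
      tau φ y.P y.elt (x.eigenPerm k c.2).ρ = Nat.card (Pair.FixedCosets y x) := by
  classical
  refine (sum_tau_eigen φ (PPerm.perm k G (G ⧸ x.P)) (rightMulEnd_inv_pow k x)
    (x.natCast_orderOf_ne_zero k) y.P y.elt y.coprime).trans ?_
  let Z := MulAction.fixedPoints y.P (G ⧸ x.P)
  have hfix : ∀ (n : Subgroup.normalizer (x.P : Set G)) (z : Z),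
      (rightMul x.P n).unop (z : G ⧸ x.P) ∈ Z := fun n z g => by
    change (g : G) • (rightMul x.P n).unop (z : G ⧸ x.P) = _
    rw [← rightMul_smul]
    exact congrArg _ (z.2 g)
  let R : Subgroup.normalizer (x.P : Set G) → Equiv.Perm Z := fun n =>
    { toFun := fun z => ⟨(rightMul x.P n).unop z, hfix n z⟩
      invFun := fun z => ⟨(rightMul x.P n⁻¹).unop z, hfix n⁻¹ z⟩
      left_inv := fun z => Subtype.ext (by
        change (rightMul x.P n⁻¹).unop ((rightMul x.P n).unop (z : G ⧸ x.P)) = z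
        rw [map_inv, MulOpposite.unop_inv]
        exact Equiv.symm_apply_apply _ _)
      right_inv := fun z => Subtype.ext (by
        change (rightMul x.P n).unop ((rightMul x.P n⁻¹).unop (z : G ⧸ x.P)) = z
        rw [map_inv, MulOpposite.unop_inv]
        exact Equiv.apply_symm_apply _ _) }
  let S : Equiv.Perm Z :=
    { toFun := fun z => ⟨y.s • z, smul_mem_fixedPoints _ y.elt z.2⟩
      invFun := fun z => ⟨y.s⁻¹ • z, smul_mem_fixedPoints _ y.elt⁻¹ z.2⟩
      left_inv := fun z => Subtype.ext (inv_smul_smul _ _)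
      right_inv := fun z => Subtype.ext (smul_inv_smul _ _) }
  have hRpow : ∀ m : ℕ, ∀ z, ((R x.elt⁻¹ ^ m) z : G ⧸ x.P) =
      ((rightMul x.P x.elt⁻¹).unop ^ m) (z : G ⧸ x.P) := by
    intro m
    induction m with
    | zero => intro z; rfl
    | succ m ih =>
      intro z
      rw [pow_succ', pow_succ', Equiv.Perm.mul_apply, Equiv.Perm.mul_apply, ← ih]
      rfl
  have hSpow : ∀ m : ℕ, ∀ z, ((S ^ m) z : G ⧸ x.P) = y.s ^ m • (z : G ⧸ x.P) := by
    intro m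
    induction m with
    | zero => intro z; simp
    | succ m ih =>
      intro z
      rw [pow_succ', pow_succ', Equiv.Perm.mul_apply, mul_smul, ← ih]
      rfl
  have hRS : Commute (R x.elt⁻¹) S := Equiv.ext fun z => Subtype.ext (rightMul_smul x.P _ _ _)
  have hR : R x.elt⁻¹ ^ orderOf x.s = 1 := Equiv.ext fun z => Subtype.ext (by
    have h1 : x.elt⁻¹ ^ orderOf x.s = 1 := Subtype.ext (by simp [Pair.elt, pow_orderOf_eq_one])
    rw [hRpow, ← MulOpposite.unop_pow, ← map_pow, h1, map_one, MulOpposite.unop_one]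
    rfl)
  have hS : S ^ orderOf y.s = 1 := Equiv.ext fun z => Subtype.ext (by
    rw [hSpow, pow_orderOf_eq_one, one_smul]; rfl)
  have hN : ((orderOf x.s * orderOf y.s : ℕ) : k) ≠ 0 := by
    rw [Nat.cast_mul]
    exact mul_ne_zero (x.natCast_orderOf_ne_zero k) (y.natCast_orderOf_ne_zero k)
  have hRSpow : (R x.elt⁻¹ * S) ^ (orderOf x.s * orderOf y.s) = 1 := by
    rw [hRS.mul_pow, pow_mul, hR, one_pow, mul_comm, pow_mul, hS, one_pow, mul_one]
  refine (liftTrace_permutation φ hφ (brauerBasis (k := k) (G ⧸ x.P) y.isPGroup) (R x.elt⁻¹ * S) hN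
    ?_ ?_).trans ?_
  · exact hRSpow
  · intro z
    change brauerMap y.P (rightMulEnd k x.P x.elt⁻¹) (brauerRep (permRep k (G ⧸ x.P)) y.P y.elt
      (brauerBasis (k := k) (G ⧸ x.P) y.isPGroup z)) = _
    rw [brauerRep_brauerBasis, brauerMap_brauerBasis, brauerBasis_apply]
    exact congrArg (Submodule.mkQ _) (Subtype.ext (permEnd_single _ (rightMul_smul _ _) _ _))
  · congr 1
    refine Nat.card_congr
      { toFun := fun z => ⟨z.1, fun g hg => z.1.2 ⟨g, hg⟩, ?_⟩
        invFun := fun z => ⟨⟨z.1, fun g => z.2.1 g g.2⟩, Subtype.ext ?_⟩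
        left_inv := fun z => rfl
        right_inv := fun z => rfl }
    · have h1 := congrArg Subtype.val z.2
      change (rightMul x.P x.elt⁻¹).unop (y.s • (z.1 : G ⧸ x.P)) = z.1 at h1
      rwa [rightMul_smul] at h1
    · change (rightMul x.P x.elt⁻¹).unop (y.s • z.1) = z.1
      rw [rightMul_smul]
      exact z.2.2

theorem exists_tauF_eq_card (hφ : Function.Injective φ) (x : Pair p G) :
    ∃ ξ : FT k G F, ∀ y : Pair p G, tauF φ y.P y.elt ξ = Nat.card (Pair.FixedCosets y x) := by
  classical
  have := finite_rootsOfOne (k := k) (orderOf_pos x.s)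
  have := Fintype.ofFinite {c : k // c ^ orderOf x.s = 1}
  refine ⟨∑ c : {c : k // c ^ orderOf x.s = 1}, liftRoot φ (c : k) •
    (x.eigenPerm k c.2).clsF F, fun y => ?_⟩
  rw [map_sum, ← sum_tau_eigenPerm φ hφ x y]
  refine Finset.sum_congr rfl fun c _ => ?_
  rw [map_smul, tauF_clsF, smul_eq_mul]

/-- The weighted sum of these species counts the cosets fixed by x itself and is nonzero in F, so
some term is nonzero. This module serves as the bimodule in the theorem. -/
theorem exists_eigenPerm_tau_ne_zero (hφ : Function.Injective φ) (x : Pair p G) :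
    ∃ (c : k) (hc : c ^ orderOf x.s = 1), tau φ x.P x.elt (x.eigenPerm k hc).ρ ≠ 0 := by
  classical
  have := finite_rootsOfOne (k := k) (orderOf_pos x.s)
  have := Fintype.ofFinite {c : k // c ^ orderOf x.s = 1}
  by_contra! h
  have h1 := sum_tau_eigenPerm φ hφ x x
  rw [Finset.sum_eq_zero fun c _ => by rw [h c c.2, mul_zero]] at h1
  exact x.card_fixedCosets_self (by exact_mod_cast h1.symm)

/-- The idempotents `F_{P,s}` exist. -/
theorem exists_isIdem (hφ : Function.Injective φ) (x : Pair p G) :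
    ∃ e : FT k G F, IsIdem φ x e := by
  classical
  -- The triangular matrix of fixed-coset counts is inverted by induction on the order of the
  -- p-subgroup.
  induction hm : Nat.card x.P using Nat.strong_induction_on generalizing x with | h m ih => ?_
  subst hm
  -- The size condition sits inside the existential so that a function e on all pairs can be chosen.
  have ih' : ∀ y : Pair p G, ∃ e : FT k G F, Nat.card y.P < Nat.card x.P → IsIdem φ y e :=
    fun y => by
      by_cases h : Nat.card y.P < Nat.card x.P
      · obtain ⟨e, he⟩ := ih _ h y rfl
        exact ⟨e, fun _ => he⟩
      · exact ⟨0, fun h' => absurd h' h⟩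
  choose e he using ih'
  obtain ⟨ξ, hξ⟩ := exists_tauF_eq_card φ hφ x
  have := Fintype.ofFinite (Pair.ConjClass p G)
  let c : Pair p G → F := fun y => (Nat.card (Pair.FixedCosets y x) : F)
  have hcc : ∀ {y y' : Pair p G}, y.IsConj y' → c y = c y' := fun h =>
    congrArg Nat.cast (Pair.card_fixedCosets_conj h x).symm
  have hc0 : c x ≠ 0 := Nat.cast_ne_zero.2 x.card_fixedCosets_self
  -- S matches ξ at the pairs with a smaller p-subgroup and vanishes at the others; one
  -- representative for each conjugacy class suffices.
  let S : FT k G F := ∑ q ∈ Finset.univ.filter fun q : Pair.ConjClass p G =>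
    Nat.card q.out.P < Nat.card x.P, c q.out • e q.out
  have hS : ∀ y : Pair p G, tauF φ y.P y.elt S =
      if Nat.card y.P < Nat.card x.P then c y else 0 := by
    intro y
    rw [map_sum]
    have h1 : ∀ q ∈ Finset.univ.filter fun q : Pair.ConjClass p G =>
        Nat.card q.out.P < Nat.card x.P, q ≠ Quotient.mk _ y →
        tauF φ y.P y.elt (c q.out • e q.out) = 0 := by
      intro q hq hqy
      have h2 : tauF φ y.P y.elt (e q.out) = 0 :=
        (he q.out (Finset.mem_filter.1 hq).2 y).2 fun h =>
          hqy ((Quotient.out_eq q).symm.trans (Quotient.sound h))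
      rw [map_smul, h2, smul_zero]
    have hy := y.isConj_out
    split_ifs with h
    · have h2 : Nat.card (Quotient.mk (Pair.conjSetoid p G) y).out.P < Nat.card x.P := by
        rwa [← hy.card_eq]
      rw [Finset.sum_eq_single (Quotient.mk _ y) h1]
      · have h3 : tauF φ y.P y.elt (e (Quotient.mk (Pair.conjSetoid p G) y).out) = 1 :=
          (he _ h2 y).1 hy
        rw [map_smul, h3, smul_eq_mul, mul_one]
        exact hcc hy
      · exact fun h3 => (h3 (Finset.mem_filter.2 ⟨Finset.mem_univ _, h2⟩)).elim
    · refine Finset.sum_eq_zero fun q hq => h1 q hq ?_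
      rintro rfl
      rw [hy.card_eq] at h
      exact h (Finset.mem_filter.1 hq).2
  refine ⟨(c x)⁻¹ • (ξ - S), fun y => ?_⟩
  have hy : tauF φ y.P ⟨y.s, y.mem_normalizer⟩ ((c x)⁻¹ • (ξ - S)) =
      (c x)⁻¹ * (c y - if Nat.card y.P < Nat.card x.P then c y else 0) := by
    change tauF φ y.P y.elt _ = _
    rw [map_smul, map_sub, hξ, hS, smul_eq_mul]
  rw [hy]
  refine ⟨fun h => ?_, fun h => ?_⟩
  · rw [if_neg (by rw [h.card_eq]; exact lt_irrefl _), sub_zero, ← hcc h, inv_mul_cancel₀ hc0]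
  · split_ifs with hlt
    · rw [sub_self, mul_zero]
    -- Here the p-subgroup of y is at least as large as that of x and y is not conjugate to x, so no
    -- coset is fixed.
    · have : c y = 0 := by
        by_contra hne
        have h1 : Nat.card (Pair.FixedCosets y x) ≠ 0 := fun h' => hne (by
          change ((Nat.card (Pair.FixedCosets y x) : ℕ) : F) = 0
          rw [h', Nat.cast_zero])
        exact h ((Pair.card_le_of_fixedCosets h1).2 (not_lt.1 hlt))
      rw [this, sub_zero, mul_zero]

theorem isIdem_idem (hφ : Function.Injective φ) (x : Pair p G) :
    IsIdem φ x (idem φ x : FT k G F) := by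
  have h := exists_isIdem (k := k) (F := F) φ hφ x
  rw [idem, dif_pos h]
  exact h.choose_spec

end Existence

/-! ### Indecomposable modules -/

section Indecomposable

variable {k G V W : Type u} [Field k] [Group G] [AddCommGroup V] [Module k V] [AddCommGroup W]
  [Module k W] {ρ : Representation k G V} {σ : Representation k G W}

theorem Subrepresentation.isCompl_of_toSubmodule {A B : Subrepresentation ρ}
    (h : IsCompl A.toSubmodule B.toSubmodule) : IsCompl A B := by
  refine IsCompl.of_eq (Subrepresentation.toSubmodule_injective ?_)
    (Subrepresentation.toSubmodule_injective ?_)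
  · exact h.inf_eq_bot
  · exact h.sup_eq_top

theorem Subrepresentation.toSubmodule_isCompl {A B : Subrepresentation ρ} (h : IsCompl A B) :
    IsCompl A.toSubmodule B.toSubmodule :=
  IsCompl.of_eq (congrArg Subrepresentation.toSubmodule h.inf_eq_bot)
    (congrArg Subrepresentation.toSubmodule h.sup_eq_top)

/-- Fitting's lemma: for large n the module is the direct sum of ker fⁿ and im fⁿ, and one of them
vanishes. Taking n positive lets injectivity of fⁿ pass to f. -/
theorem IsIndecomposable.bijective_or_isNilpotent [Module.Finite k V] (h : IsIndecomposable ρ)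
    (f : ρ.IntertwiningMap ρ) : Function.Bijective f ∨ IsNilpotent f.toLinearMap := by
  obtain ⟨n, hn, hn0⟩ := (f.toLinearMap.eventually_isCompl_ker_pow_range_pow.and
    (Filter.eventually_gt_atTop 0)).exists
  have hpow : (f ^ n).toLinearMap = f.toLinearMap ^ n :=
    LinearMap.ext fun v => intertwining_pow_apply f n v
  have h1 : IsCompl (f ^ n).ker (f ^ n).range := by
    refine Subrepresentation.isCompl_of_toSubmodule ?_
    change IsCompl (LinearMap.ker (f ^ n).toLinearMap) (LinearMap.range (f ^ n).toLinearMap)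
    rwa [hpow]
  rcases h.2 _ _ h1 with h2 | h2
  · left
    have h3 : LinearMap.ker (f.toLinearMap ^ n) = ⊥ := by
      rw [← hpow]
      exact congrArg Subrepresentation.toSubmodule h2
    have h4 : Function.Injective f.toLinearMap := by
      have h5 := LinearMap.ker_eq_bot.1 h3
      obtain ⟨m, rfl⟩ := Nat.exists_eq_succ_of_ne_zero hn0.ne'
      rw [pow_succ] at h5
      exact Function.Injective.of_comp (f := (f.toLinearMap ^ m)) h5
    exact ⟨h4, LinearMap.injective_iff_surjective.1 h4⟩
  · right
    refine ⟨n, LinearMap.range_eq_bot.1 ?_⟩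
    rw [← hpow]
    exact congrArg Subrepresentation.toSubmodule h2

/-- The endomorphism ring is local: if e = f + g is invertible and f is not, then e⁻¹f is nilpotent
and e⁻¹g = 1 - e⁻¹f is a unit. -/
theorem IsIndecomposable.not_bijective_add [Module.Finite k V] (h : IsIndecomposable ρ)
    {f g : ρ.IntertwiningMap ρ} (hf : ¬ Function.Bijective f) (hg : ¬ Function.Bijective g) :
    ¬ Function.Bijective (f + g) := by
  intro hfg
  let e := Representation.IntertwiningMap.ofBijective (f + g) hfg
  have he : ∀ v, e v = f v + g v := fun v => rfl
  have h1 : ¬ Function.Bijective (e.symm.toIntertwiningMap.comp f) := fun h' => hf (by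
    have := e.bijective.comp h'
    convert this using 1
    funext v
    simp)
  have h2 := ((h.bijective_or_isNilpotent _).resolve_left h1).isUnit_one_sub
  refine hg ?_
  have h3 := e.bijective.comp ((Module.End.isUnit_iff _).1 h2)
  convert h3 using 1
  funext v
  have h4 : (1 - (e.symm.toIntertwiningMap.comp f).toLinearMap) v = v - e.symm (f v) := rfl
  change g v = e ((1 - (e.symm.toIntertwiningMap.comp f).toLinearMap) v)
  rw [h4, map_sub, e.apply_symm_apply, he, add_sub_cancel_left]

/-- Subtracting an eigenvalue creates a kernel. Thus the endomorphism ring modulo its radical is k.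
-/
theorem IsIndecomposable.exists_not_bijective_sub [Module.Finite k V] [IsAlgClosed k]
    (h : IsIndecomposable ρ) (f : ρ.IntertwiningMap ρ) :
    ∃ c : k, ¬ Function.Bijective (f - c • Representation.IntertwiningMap.id ρ) := by
  have := h.1
  obtain ⟨c, hc⟩ := Module.End.exists_eigenvalue f.toLinearMap
  obtain ⟨v, hv⟩ := hc.exists_hasEigenvector
  refine ⟨c, fun h' => hv.2 (h'.1 ?_)⟩
  rw [map_zero]
  change f.toLinearMap v - c • v = 0
  rw [hv.apply_eq_smul, sub_self]

/-- A module is the direct sum of two complementary submodules. -/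
theorem nonempty_equiv_prod_of_isCompl {A B : Subrepresentation ρ} (h : IsCompl A B) :
    Nonempty (ρ.Equiv (A.toRepresentation.prod B.toRepresentation)) := by
  have h1 := Subrepresentation.toSubmodule_isCompl h
  exact ⟨(Representation.Equiv.mk (Submodule.prodEquivOfIsCompl _ _ h1) fun g =>
    LinearMap.ext fun x => by
      change (ρ g x.1 + ρ g x.2 : V) = ρ g (x.1 + x.2)
      rw [map_add]).symm⟩

theorem IsDirectSummand.of_equiv {U : Type u} [AddCommGroup U] [Module k U]
    {τ : Representation k G U} (e : τ.Equiv σ) (h : IsDirectSummand ρ σ) :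
    IsDirectSummand ρ τ := by
  obtain ⟨i, q, hq⟩ := h
  refine ⟨e.symm.toIntertwiningMap.comp i, q.comp e.toIntertwiningMap, DFunLike.ext _ _ fun v => ?_⟩
  have h1 : ∀ w, q (i w) = w := fun w => congrArg (fun f => f w) hq
  simp [h1]

theorem IsIndecomposable.of_equiv (e : ρ.Equiv σ) (h : IsIndecomposable ρ) :
    IsIndecomposable σ := by
  have := h.1
  let c : Subrepresentation σ → Subrepresentation ρ := fun A =>
    { toSubmodule := A.toSubmodule.comap e.toLinearEquiv.toLinearMap
      apply_mem_toSubmodule := fun g v hv => by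
        have h1 : e (ρ g v) = σ g (e v) := e.toIntertwiningMap.isIntertwining _ _ g v
        change e (ρ g v) ∈ A.toSubmodule
        rw [h1]
        exact A.apply_mem_toSubmodule g hv }
  have hc : ∀ A, c A = ⊥ → A = ⊥ := fun A hA =>
    Subrepresentation.toSubmodule_injective
      ((map_eq_bot_iff (Submodule.orderIsoMapComap e.toLinearEquiv).symm).1
        (congrArg Subrepresentation.toSubmodule hA))
  refine ⟨e.injective.nontrivial, fun A B hAB => ?_⟩
  have h1 : IsCompl (c A) (c B) := Subrepresentation.isCompl_of_toSubmodule
    ((Submodule.orderIsoMapComap e.toLinearEquiv).symm.isCompl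
      (Subrepresentation.toSubmodule_isCompl hAB))
  exact (h.2 _ _ h1).imp (hc A) (hc B)

theorem isDirectSummand_prod_left : IsDirectSummand ρ (ρ.prod σ) :=
  ⟨.inl k ρ σ, .fst k ρ σ, rfl⟩

theorem isDirectSummand_prod_right : IsDirectSummand σ (ρ.prod σ) :=
  ⟨.inr k ρ σ, .snd k ρ σ, rfl⟩

theorem IsDirectSummand.refl : IsDirectSummand ρ ρ := ⟨.id ρ, .id ρ, rfl⟩

end Indecomposable

/-! ### Decomposition into indecomposable summands -/

section Induction

variable {k G : Type u} [Field k] [Group G]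

/-- This forces every additive invariant, in particular the class in T(G), to vanish on a zero
module. -/
theorem PPerm.nonempty_equiv_prod_of_subsingleton (M : PPerm k G) (h : Subsingleton M.V) :
    Nonempty (M.ρ.Equiv (M.prod M).ρ) :=
  have : Subsingleton (M.prod M).V := inferInstanceAs (Subsingleton (M.V × M.V))
  ⟨Representation.Equiv.mk 0 fun _ => LinearMap.ext fun _ => Subsingleton.elim _ _⟩

/-- Induction on the decomposition of a p-permutation module into indecomposable summands. -/
theorem PPerm.induction {motive : PPerm k G → Prop}
    (zero : ∀ M : PPerm k G, Subsingleton M.V → motive M)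
    (indecomposable : ∀ M : PPerm k G, IsIndecomposable M.ρ → motive M)
    (prod : ∀ M A B : PPerm k G, Nonempty (M.ρ.Equiv (A.prod B).ρ) → motive A → motive B →
      motive M) (M : PPerm k G) : motive M := by
  induction hm : Module.finrank k M.V using Nat.strong_induction_on generalizing M with | h m ih => ?_
  by_cases h0 : Nontrivial M.V
  swap
  · exact zero M (not_nontrivial_iff_subsingleton.1 h0)
  by_cases h1 : IsIndecomposable M.ρ
  · exact indecomposable M h1
  obtain ⟨A, B, hAB, hA, hB⟩ : ∃ A B : Subrepresentation M.ρ, IsCompl A B ∧ A ≠ ⊥ ∧ B ≠ ⊥ := by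
    by_contra! h
    exact h1 ⟨h0, fun A B hAB => or_iff_not_imp_left.2 (h A B hAB)⟩
  obtain ⟨e⟩ := nonempty_equiv_prod_of_isCompl hAB
  have hc := Subrepresentation.toSubmodule_isCompl hAB
  have hsum := Submodule.finrank_add_eq_of_isCompl hc
  have hpos : ∀ C : Subrepresentation M.ρ, C ≠ ⊥ → 0 < Module.finrank k C.toSubmodule := by
    intro C hC
    refine Module.finrank_pos_iff.2 ((Submodule.nontrivial_iff_ne_bot).2 fun h => hC ?_)
    exact Subrepresentation.toSubmodule_injective h
  have hA' := hpos A hA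
  have hB' := hpos B hB
  let MA : PPerm k G :=
    { V := A.toSubmodule
      ρ := A.toRepresentation
      isPPermutation := M.isPPermutation.of_isDirectSummand (isDirectSummand_prod_left.of_equiv e) }
  let MB : PPerm k G :=
    { V := B.toSubmodule
      ρ := B.toRepresentation
      isPPermutation := M.isPPermutation.of_isDirectSummand (isDirectSummand_prod_right.of_equiv e) }
  exact prod M MA MB ⟨e⟩ 
    (ih (Module.finrank k A.toSubmodule) (by omega) MA rfl)
    (ih (Module.finrank k B.toSubmodule) (by omega) MB rfl)

variable (F : Type v) [Field F]

/-- The classes of the indecomposable p-permutation modules span `F T(G)`. -/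
theorem span_clsF_indecomposable : Submodule.span F (Set.range
    fun i : {i : IsoClass k G // IsIndecomposable i.out.ρ} => (i.1.out).clsF F) = ⊤ := by
  rw [← top_le_iff, ← span_clsF, Submodule.span_le]
  rintro _ ⟨M, rfl⟩
  induction M using PPerm.induction with
  | zero M h =>
    have h1 := M.cls_prod M
    rw [← PPerm.cls_eq (M.nonempty_equiv_prod_of_subsingleton h), left_eq_add] at h1
    change M.clsF F ∈ _
    rw [PPerm.clsF, h1, TensorProduct.tmul_zero]
    exact zero_mem _
  | indecomposable M h =>
    obtain ⟨e⟩ : Nonempty ((IsoClass.mk M).out.ρ.Equiv M.ρ) :=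
      Quotient.exact (s := PPerm.setoid) (Quotient.out_eq (s := PPerm.setoid) (IsoClass.mk M))
    refine Submodule.subset_span ⟨⟨IsoClass.mk M, h.of_equiv e.symm⟩, ?_⟩
    change PPerm.clsF F _ = PPerm.clsF F _
    rw [PPerm.clsF, PPerm.clsF, PPerm.cls_eq ⟨e⟩]
  | prod M A B e hA hB =>
    have h1 : M.clsF F = A.clsF F + B.clsF F := by
      rw [PPerm.clsF, PPerm.cls_eq e, PPerm.cls_prod, TensorProduct.tmul_add]
      rfl
    change M.clsF F ∈ _
    rw [h1]
    exact add_mem hA hB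

theorem exists_indecomposable_tau_ne_zero [Finite G] (φ : CommGroup.torsion kˣ →* Fˣ) (P : Subgroup G)
    (u : Subgroup.normalizer (P : Set G)) (M : PPerm k G) (hM : tau φ P u M.ρ ≠ 0) :
    ∃ N : PPerm k G, IsIndecomposable N.ρ ∧ IsDirectSummand N.ρ M.ρ ∧ tau φ P u N.ρ ≠ 0 := by
  induction M using PPerm.induction with
  | zero M h =>
    obtain ⟨e⟩ := M.nonempty_equiv_prod_of_subsingleton h
    exact absurd (left_eq_add.1 ((tau_equiv φ P u e).trans (tau_prod φ P u M.ρ M.ρ))) hM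
  | indecomposable M h => exact ⟨M, h, .refl, hM⟩
  | prod M A B e hA hB =>
    obtain ⟨e⟩ := e
    have h1 : tau φ P u M.ρ = tau φ P u A.ρ + tau φ P u B.ρ :=
      (tau_equiv φ P u e).trans (tau_prod φ P u A.ρ B.ρ)
    by_cases h : tau φ P u A.ρ = 0
    · obtain ⟨N, h2, h3, h4⟩ := hB (fun h' => hM (by rw [h1, h, h', add_zero]))
      exact ⟨N, h2, (h3.trans isDirectSummand_prod_right).of_equiv e, h4⟩
    · obtain ⟨N, h2, h3, h4⟩ := hA h
      exact ⟨N, h2, (h3.trans isDirectSummand_prod_left).of_equiv e, h4⟩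

end Induction

/-! ### Multiplicity characters -/

section Multiplicity

variable {k G U V W X : Type u} [Field k] [Group G] [AddCommGroup U] [Module k U]
  [AddCommGroup V] [Module k V] [AddCommGroup W] [Module k W] [AddCommGroup X] [Module k X]
  [Module.Finite k U]
  {ρ : Representation k G U} (hρ : IsIndecomposable ρ) {σ : Representation k G V}
  {τ : Representation k G W} {υ : Representation k G X}

/-- The morphisms from an indecomposable module that are not split injective. -/
def radHom (hρ : IsIndecomposable ρ) (σ : Representation k G V) :
    Submodule k (ρ.IntertwiningMap σ) where
  carrier := {h | ∀ q : σ.IntertwiningMap ρ, ¬ Function.Bijective (q.comp h)}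
  add_mem' {f g} hf hg q := by
    have h : q.comp (f + g) = q.comp f + q.comp g := DFunLike.ext _ _ fun v => map_add q _ _
    rw [h]
    exact hρ.not_bijective_add (hf q) (hg q)
  zero_mem' q h := by
    have := hρ.1
    obtain ⟨v, hv⟩ := exists_ne (0 : U)
    exact hv (h.1 ((map_zero q).trans (map_zero q).symm))
  smul_mem' c f hf q := by
    rw [Representation.IntertwiningMap.comp_smul, ← Representation.IntertwiningMap.smul_comp]
    exact hf (c • q)

/-- The multiplicity space of an indecomposable module. -/
abbrev MultSpace (hρ : IsIndecomposable ρ) (σ : Representation k G V) : Type u :=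
  ρ.IntertwiningMap σ ⧸ radHom hρ σ

/-- Functoriality of the multiplicity space. -/
def multMap (f : σ.IntertwiningMap τ) : MultSpace hρ σ →ₗ[k] MultSpace hρ τ :=
  Submodule.mapQ _ _ (Representation.IntertwiningMap.llcomp ρ σ τ f) fun _ hh q => hh (q.comp f)

theorem multMap_id : multMap hρ (.id σ) = LinearMap.id :=
  Submodule.linearMap_qext _ (LinearMap.ext fun _ => rfl)

theorem multMap_comp (f : τ.IntertwiningMap υ) (g : σ.IntertwiningMap τ) :
    multMap hρ (f.comp g) = multMap hρ f ∘ₗ multMap hρ g :=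
  Submodule.linearMap_qext _ (LinearMap.ext fun _ => rfl)

theorem multMap_add (f g : σ.IntertwiningMap τ) :
    multMap hρ (f + g) = multMap hρ f + multMap hρ g :=
  Submodule.linearMap_qext _ (LinearMap.ext fun _ => rfl)

theorem multMap_smul (c : k) (f : σ.IntertwiningMap τ) :
    multMap hρ (c • f) = c • multMap hρ f :=
  Submodule.linearMap_qext _ (LinearMap.ext fun _ => rfl)

/-- The trace of an endomorphism on the multiplicity space of an indecomposable module. -/
noncomputable def multTrace : σ.IntertwiningMap σ →ₗ[k] k where
  toFun f := LinearMap.trace k _ (multMap hρ f)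
  map_add' f g := by rw [multMap_add, map_add]
  map_smul' c f := by rw [multMap_smul, map_smul, RingHom.id_apply]

/-- Cyclicity of the trace moves an endomorphism to any module through which it factors; all the
later reductions rest on this. -/
theorem multTrace_comp_comm [Module.Finite k V] [Module.Finite k W] (f : τ.IntertwiningMap σ)
    (g : σ.IntertwiningMap τ) : multTrace hρ (f.comp g) = multTrace hρ (g.comp f) := by
  change LinearMap.trace k _ _ = LinearMap.trace k _ _
  rw [multMap_comp, multMap_comp, LinearMap.trace_comp_comm']

/-- In characteristic p the map A induced by f satisfies (A - 1)^(p^m) = A^(p^m) - 1 = 0. With B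
induced by g, which commutes with A, the product (A - 1)B is nilpotent and has trace zero. -/
theorem multTrace_mul_of_pow_eq_one {p : ℕ} [Fact p.Prime] [CharP k p] [Module.Finite k V]
    {f g : σ.IntertwiningMap σ} (hfg : Commute f g) {m : ℕ} (hf : f ^ p ^ m = 1) :
    multTrace hρ (f * g) = multTrace hρ g := by
  have hpow : ∀ j : ℕ, multMap hρ (f ^ j) = multMap hρ f ^ j := fun j => by
    induction j with
    | zero => exact multMap_id hρ
    | succ j ih =>
      rw [pow_succ, pow_succ, ← ih]
      exact multMap_comp hρ _ _
  set A : Module.End k (MultSpace hρ σ) := multMap hρ f with hA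
  set B : Module.End k (MultSpace hρ σ) := multMap hρ g with hB
  have hAB : multMap hρ (f * g) = A * B := multMap_comp hρ f g
  have hcomm : Commute A B := by
    rw [Commute, SemiconjBy, ← hAB, hfg.eq]
    exact multMap_comp hρ g f
  have hA1 : A ^ p ^ m = 1 := by
    rw [hA, ← hpow, hf]
    exact multMap_id hρ
  have hnil : IsNilpotent (A - 1) := by
    refine ⟨p ^ m, ?_⟩
    have h := congrArg (Polynomial.aeval A)
      (sub_pow_expChar_pow (Polynomial.X : Polynomial k) 1 (p := p) (n := m))
    simpa [hA1] using h
  have h1 : IsNilpotent ((A - 1) * B) :=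
    (hcomm.sub_left (Commute.one_left B)).isNilpotent_mul_right hnil
  have h2 := (LinearMap.isNilpotent_trace_of_isNilpotent h1).eq_zero
  rw [sub_mul, one_mul, map_sub, sub_eq_zero] at h2
  change LinearMap.trace k _ (multMap hρ (f * g)) = LinearMap.trace k _ B
  rw [hAB, h2]

/-- A split injection of ρ into the indecomposable σ would be an isomorphism, so every morphism lies
in the radical and the multiplicity space is zero. -/
theorem multTrace_id_of_not_equiv [Module.Finite k V] (hσ : IsIndecomposable σ)
    (h : IsEmpty (ρ.Equiv σ)) : multTrace hρ (.id σ) = 0 := by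
  have h0 : ∀ f : ρ.IntertwiningMap σ, f ∈ radHom hρ σ := by
    intro f q hq
    have hf : Function.Injective f := Function.Injective.of_comp hq.1
    let e := Representation.IntertwiningMap.ofBijective (q.comp f) hq
    have he : ∀ v, e v = q (f v) := fun v => rfl
    -- π is the projection of σ onto the image of f. It fixes that nonzero image, so it is not
    -- nilpotent; hence it is bijective and f is surjective.
    let π := f.comp (e.symm.toIntertwiningMap.comp q)
    have hπ : ∀ v, π v = f (e.symm (q v)) := fun v => rfl
    have hπf : ∀ v, π (f v) = f v := fun v => by
      rw [hπ, ← he, e.symm_apply_apply]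
    rcases hσ.bijective_or_isNilpotent π with h1 | ⟨n, hn⟩
    · have h2 : Function.Surjective f := fun w => by
        obtain ⟨v, rfl⟩ := h1.2 w
        exact ⟨_, rfl⟩
      exact h.false (f.ofBijective ⟨hf, h2⟩)
    · have := hρ.1
      obtain ⟨v, hv⟩ := exists_ne (0 : U)
      have h2 : ∀ n : ℕ, (π.toLinearMap ^ n) (f v) = f v := fun n => by
        induction n with
        | zero => rfl
        | succ n ih =>
          rw [pow_succ, Module.End.mul_apply]
          exact (congrArg _ (hπf v)).trans ih
      refine hv (hf ?_)
      rw [map_zero, ← h2 n, hn]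
      rfl
  have : Subsingleton (MultSpace hρ σ) :=
    Submodule.Quotient.subsingleton_iff.2 (Submodule.eq_top_iff'.2 h0)
  change LinearMap.trace k _ _ = 0
  rw [Subsingleton.elim (multMap hρ (.id σ)) 0, map_zero]

/-- By cyclicity this is the dimension of the multiplicity space of ρ in itself, the residue field
of its endomorphism ring, which is k. -/
theorem multTrace_id_of_equiv [IsAlgClosed k] [Module.Finite k V] (e : ρ.Equiv σ) :
    multTrace hρ (.id σ) = 1 := by
  have h1 : Representation.IntertwiningMap.id σ =
      e.toIntertwiningMap.comp e.symm.toIntertwiningMap := DFunLike.ext _ _ fun x => by simp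
  have h2 : e.symm.toIntertwiningMap.comp e.toIntertwiningMap = .id ρ :=
    DFunLike.ext _ _ fun x => by simp
  rw [h1, multTrace_comp_comm, h2]
  change LinearMap.trace k _ _ = 1
  rw [multMap_id, LinearMap.trace_id]
  have h3 : Module.finrank k (MultSpace hρ ρ) = 1 := by
    refine finrank_eq_one (Submodule.Quotient.mk (.id ρ)) ?_ ?_
    · intro h
      exact (Submodule.Quotient.mk_eq_zero _).1 h (.id ρ) Function.bijective_id
    · intro w
      induction w using Submodule.Quotient.induction_on with | H f => ?_
      obtain ⟨c, hc⟩ := hρ.exists_not_bijective_sub f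
      refine ⟨c, ?_⟩
      rw [← Submodule.Quotient.mk_smul, eq_comm, Submodule.Quotient.eq]
      intro q hq
      have h4 : Function.Injective (f - c • Representation.IntertwiningMap.id ρ) :=
        Function.Injective.of_comp hq.1
      exact hc ⟨h4, (LinearMap.injective_iff_surjective
        (f := (f - c • Representation.IntertwiningMap.id ρ).toLinearMap)).1 h4⟩
  rw [h3, Nat.cast_one]

end Multiplicity

/-! ### Morphisms of permutation modules as invariant matrices -/

section MatHom

variable {k G X Y Z : Type*} [Field k] [Group G] [MulAction G X] [MulAction G Y] [MulAction G Z]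

/-- The morphism of permutation modules given by an invariant matrix. -/
def matHom [Fintype X] (m : Matrix Y X k) (hm : ∀ (g : G) y x, m (g • y) (g • x) = m y x) :
    (permRep (G := G) k X).IntertwiningMap (permRep k Y) :=
  ⟨m.mulVecLin, fun g => LinearMap.ext fun f => funext fun y => by
    change ∑ x, m y x * f (g⁻¹ • x) = ∑ x, m (g⁻¹ • y) x * f x
    refine Fintype.sum_equiv (MulAction.toPerm g⁻¹) _ _ fun x => ?_
    rw [MulAction.toPerm_apply, hm]⟩

theorem matHom_comp [Fintype X] [Fintype Y] {m : Matrix Z Y k} {n : Matrix Y X k}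
    (hm : ∀ (g : G) y x, m (g • y) (g • x) = m y x)
    (hn : ∀ (g : G) y x, n (g • y) (g • x) = n y x)
    (hmn : ∀ (g : G) y x, (m * n) (g • y) (g • x) = (m * n) y x) :
    (matHom m hm).comp (matHom n hn) = matHom (m * n) hmn :=
  Representation.IntertwiningMap.ext (Matrix.mulVecLin_mul m n).symm

theorem matHom_single [Fintype X] [DecidableEq X] {m : Matrix Y X k}
    (hm : ∀ (g : G) y x, m (g • y) (g • x) = m y x) (x : X) (y : Y) :
    matHom m hm (Pi.single x 1) y = m y x := by
  change (m.mulVec (Pi.single x 1)) y = _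
  simp

theorem permRep_hom_ext [Finite X] [DecidableEq X] {V : Type*} [AddCommGroup V] [Module k V]
    {ρ : Representation k G V} {f g : (permRep (G := G) k X).IntertwiningMap ρ}
    (h : ∀ x, f (Pi.single x 1) = g (Pi.single x 1)) : f = g :=
  Representation.IntertwiningMap.ext ((Pi.basisFun k X).ext fun x => by
    rw [Pi.basisFun_apply]; exact h x)

theorem rightMulEnd_mul (P : Subgroup G) [Finite (G ⧸ P)] (m n : Subgroup.normalizer (P : Set G)) :
    rightMulEnd k P (m * n) = rightMulEnd k P n * rightMulEnd k P m := by
  classical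
  refine permRep_hom_ext fun z => ?_
  induction z using QuotientGroup.induction_on with | H z => ?_
  rw [Representation.IntertwiningMap.mul_apply, rightMulEnd_single, rightMulEnd_single,
    rightMulEnd_single, Subgroup.coe_mul, mul_assoc]

theorem rightMulEnd_pow (P : Subgroup G) (n : Subgroup.normalizer (P : Set G)) {m : ℕ}
    (h : n ^ m = 1) : rightMulEnd k P n ^ m = 1 := by
  refine permEnd_pow _ _ ?_
  rw [← MulOpposite.unop_pow, ← map_pow, h, map_one, MulOpposite.unop_one]

end MatHom

/-! ### Traces of endomorphisms of permutation modules on multiplicity spaces -/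

section PairTraces

variable {k G : Type u} [Field k] [Group G] {V W : Type u} [AddCommGroup V] [Module k V]
  [AddCommGroup W] [Module k W] {σ : Representation k G V} {τ : Representation k G W}

variable (p : ℕ)

/-- The endomorphisms whose traces on multiplicity spaces are a fixed combination of those of the
endomorphisms attached to pairs. -/
def pairTraces (σ : Representation k G V) [Fintype (Pair.ConjClass p G)] :
    Submodule k (σ.IntertwiningMap σ) where
  -- The coefficients c do not depend on M. This uniformity is what bounds the number of
  -- indecomposable modules.
  carrier := {f | ∃ c : Pair.ConjClass p G → k, ∀ (M : PPerm k G) (hM : IsIndecomposable M.ρ),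
    multTrace hM f = ∑ q, c q * multTrace hM (rightMulEnd k q.out.P q.out.elt)}
  add_mem' := by
    rintro f g ⟨c, hc⟩ ⟨d, hd⟩
    refine ⟨c + d, fun M hM => ?_⟩
    simp only [map_add, hc, hd, Pi.add_apply, add_mul, Finset.sum_add_distrib]
  zero_mem' := ⟨0, fun M hM => by simp⟩
  smul_mem' := by
    rintro a f ⟨c, hc⟩
    refine ⟨a • c, fun M hM => ?_⟩
    simp only [map_smul, hc, Pi.smul_apply, smul_eq_mul, Finset.mul_sum, mul_assoc]

variable {p} [Fintype (Pair.ConjClass p G)]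

theorem mem_pairTraces_of_multTrace_eq {f : σ.IntertwiningMap σ} {g : τ.IntertwiningMap τ}
    (h : ∀ (M : PPerm k G) (hM : IsIndecomposable M.ρ), multTrace hM f = multTrace hM g)
    (hg : g ∈ pairTraces p τ) : f ∈ pairTraces p σ := by
  obtain ⟨c, hc⟩ := hg
  exact ⟨c, fun M hM => (h M hM).trans (hc M hM)⟩

theorem comp_mem_pairTraces [Module.Finite k V] [Module.Finite k W] {f : τ.IntertwiningMap σ}
    {g : σ.IntertwiningMap τ} (h : g.comp f ∈ pairTraces p τ) : f.comp g ∈ pairTraces p σ :=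
  mem_pairTraces_of_multTrace_eq (fun _ hM => multTrace_comp_comm hM f g) h

theorem multTrace_permEnd_congr {X Y : Type u} [Finite X] [Finite Y] [MulAction G X] [MulAction G Y]
    {π : Equiv.Perm X} (hπ : ∀ (g : G) x, π (g • x) = g • π x) {π' : Equiv.Perm Y}
    (hπ' : ∀ (g : G) x, π' (g • x) = g • π' x) (e : X ≃ Y) (he : ∀ (g : G) x, e (g • x) = g • e x)
    (h : ∀ x, e (π x) = π' (e x)) (M : PPerm k G) (hM : IsIndecomposable M.ρ) :
    multTrace hM (permEnd k π hπ) = multTrace hM (permEnd k π' hπ') := by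
  let E : (permRep (G := G) k Y).IntertwiningMap (permRep k X) :=
    ⟨LinearMap.funLeft k k e, fun g => LinearMap.ext fun f => funext fun x => by
      change f (g⁻¹ • e x) = f (e (g⁻¹ • x))
      rw [he]⟩
  let E' : (permRep (G := G) k X).IntertwiningMap (permRep k Y) :=
    ⟨LinearMap.funLeft k k e.symm, fun g => LinearMap.ext fun f => funext fun x => by
      change f (g⁻¹ • e.symm x) = f (e.symm (g⁻¹ • x))
      congr 1
      rw [Equiv.eq_symm_apply, he, Equiv.apply_symm_apply]⟩
  have h1 : permEnd k π hπ = (permEnd k π hπ).comp (E.comp E') :=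
    DFunLike.ext _ _ fun f => funext fun x => by
      change f (π.symm x) = f (e.symm (e (π.symm x)))
      rw [Equiv.symm_apply_apply]
  have h2 : permEnd k π' hπ' = E'.comp ((permEnd k π hπ).comp E) :=
    DFunLike.ext _ _ fun f => funext fun x => by
      change f (π'.symm x) = f (e (π.symm (e.symm x)))
      congr 1
      rw [Equiv.symm_apply_eq, ← h, Equiv.apply_symm_apply, Equiv.apply_symm_apply]
  rw [h2, multTrace_comp_comm]
  conv_lhs => rw [h1]
  rfl

/-- Only chosen representatives of classes of pairs occur in `pairTraces`. Right multiplication by a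
conjugating element identifies the cosets for x with those for its representative. -/
theorem rightMulEnd_pair_mem [Finite G] (x : Pair p G) :
    rightMulEnd k x.P x.elt ∈ pairTraces p (permRep (G := G) k (G ⧸ x.P)) := by
  classical
  refine ⟨Pi.single (Quotient.mk _ x) 1, fun M hM => ?_⟩
  rw [Finset.sum_eq_single (Quotient.mk _ x), Pi.single_eq_same, one_mul]
  · obtain ⟨g, h1, h2⟩ := x.isConj_out
    set y := (Quotient.mk (Pair.conjSetoid p G) x).out
    have hmem : ∀ a : G, a ∈ x.P ↔ g⁻¹ * a * g ∈ y.P := fun a => by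
      rw [h1]
      constructor
      · rintro ⟨b, hb, rfl⟩
        simpa [mul_assoc] using hb
      · intro h
        exact ⟨_, h, by simp [mul_assoc]⟩
    let e : G ⧸ x.P ≃ G ⧸ y.P :=
      { toFun := Quotient.map' (fun a => a * g) fun a b h => by
          rw [QuotientGroup.leftRel_apply] at h ⊢
          have := (hmem _).1 h
          simpa [mul_assoc] using this
        invFun := Quotient.map' (fun a => a * g⁻¹) fun a b h => by
          rw [QuotientGroup.leftRel_apply] at h ⊢
          refine (hmem _).2 ?_
          simpa [mul_assoc] using h
        left_inv := fun z => by
          induction z using QuotientGroup.induction_on with | H z => ?_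
          exact congrArg QuotientGroup.mk (mul_inv_cancel_right z g)
        right_inv := fun z => by
          induction z using QuotientGroup.induction_on with | H z => ?_
          exact congrArg QuotientGroup.mk (inv_mul_cancel_right z g) }
    refine multTrace_permEnd_congr _ _ e (fun a z => ?_) (fun z => ?_) M hM
    · induction z using QuotientGroup.induction_on with | H z => ?_
      exact congrArg QuotientGroup.mk (mul_assoc a z g)
    · induction z using QuotientGroup.induction_on with | H z => ?_
      refine congrArg (QuotientGroup.mk (s := y.P)) ?_
      change z * x.s * g = z * g * y.s
      rw [h2]
      group
  · intro q _ hq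
    rw [Pi.single_eq_of_ne hq, zero_mul]
  · simp

/-- The endomorphisms of a permutation module are combinations of those attached to the orbits on
pairs of points. -/
theorem mem_pairTraces_of_orbits {X : Type u} [Finite X] [MulAction G X]
    (h : ∀ w : X × X, ∀ m : Matrix X X k, (∀ y x, (y, x) ∈ MulAction.orbit G w → m y x = 1) →
      (∀ y x, (y, x) ∉ MulAction.orbit G w → m y x = 0) →
      ∀ [Fintype X] (hm : ∀ (g : G) y x, m (g • y) (g • x) = m y x),
      matHom m hm ∈ pairTraces p (permRep (G := G) k X))
    (f : (permRep (G := G) k X).IntertwiningMap (permRep k X)) :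
    f ∈ pairTraces p (permRep (G := G) k X) := by
  classical
  have := Fintype.ofFinite X
  have := Fintype.ofFinite (MulAction.orbitRel.Quotient G (X × X))
  -- By equivariance the matrix of f is constant on the G-orbits of X × X, so f is a combination of
  -- orbit indicator matrices.
  let m : Matrix X X k := fun y x => f (Pi.single x 1) y
  have hm : ∀ (g : G) y x, m (g • y) (g • x) = m y x := fun g y x => by
    change f (Pi.single (g • x) 1) (g • y) = _
    rw [← permRep_single, f.isIntertwining, permRep_apply, inv_smul_smul]
  let n (w : X × X) : Matrix X X k := fun y x => if (y, x) ∈ MulAction.orbit G w then 1 else 0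
  have hn : ∀ (w) (g : G) y x, n w (g • y) (g • x) = n w y x := fun w g y x => by
    have : ((g • y, g • x) : X × X) ∈ MulAction.orbit G w ↔ (y, x) ∈ MulAction.orbit G w := by
      change g • ((y, x) : X × X) ∈ _ ↔ _
      rw [← MulAction.orbit_eq_iff, ← MulAction.orbit_eq_iff, MulAction.orbit_smul]
    simp only [n, this]
  have hf : f = ∑ o : MulAction.orbitRel.Quotient G (X × X),
      m o.out.1 o.out.2 • matHom (n o.out) (hn o.out) := by
    refine permRep_hom_ext fun x => funext fun y => ?_
    rw [Representation.IntertwiningMap.sum_apply, Finset.sum_apply,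
      Finset.sum_eq_single (Quotient.mk _ (y, x))]
    · have h1 : ((y, x) : X × X) ∈ MulAction.orbit G
          (Quotient.mk (MulAction.orbitRel G (X × X)) (y, x)).out :=
        MulAction.orbitRel_apply.1
          (Quotient.exact (s := MulAction.orbitRel G (X × X)) (Quotient.out_eq _).symm)
      obtain ⟨g, hg⟩ := id h1
      rw [Representation.IntertwiningMap.smul_apply, Pi.smul_apply, matHom_single, smul_eq_mul]
      change f (Pi.single x 1) y = _ * n _ y x
      simp only [n, if_pos h1, mul_one]
      have h2 := congrArg Prod.fst hg
      have h3 := congrArg Prod.snd hg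
      change g • (Quotient.mk (MulAction.orbitRel G (X × X)) (y, x)).out.1 = y at h2
      change g • (Quotient.mk (MulAction.orbitRel G (X × X)) (y, x)).out.2 = x at h3
      rw [← hm g, h2, h3]
    · intro o _ ho
      rw [Representation.IntertwiningMap.smul_apply, Pi.smul_apply, matHom_single, smul_eq_mul]
      have h1 : ((y, x) : X × X) ∉ MulAction.orbit G o.out := fun h1 => ho
        ((Quotient.out_eq o).symm.trans
          (Quotient.sound (s := MulAction.orbitRel G (X × X)) (MulAction.orbitRel_apply.2 h1)).symm)
      simp only [n, if_neg h1, mul_zero]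
    · simp
  rw [hf]
  refine Submodule.sum_mem _ fun o _ => Submodule.smul_mem _ _ ?_
  exact h o.out (n o.out) (fun y x h => if_pos h) (fun y x h => if_neg h) (hn o.out)

variable [Finite G] [Fact p.Prime] [CharP k p]

/-- Split n into commuting factors of p-power order and of order prime to p. The first acts
unipotently and does not affect the traces; the second forms a pair with P. -/
theorem rightMulEnd_mem_of_isPGroup {P : Subgroup G} (hP : IsPGroup p P)
    (n : Subgroup.normalizer (P : Set G)) :
    rightMulEnd k P n ∈ pairTraces p (permRep (G := G) k (G ⧸ P)) := by
  obtain ⟨a, b, m, h1, h2, h3⟩ := exists_pPart_mul (p := p) (isOfFinOrder_of_finite n)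
  let x : Pair p G :=
    { P := P
      s := ((n ^ b : Subgroup.normalizer (P : Set G)) : G)
      isPGroup := hP
      mem_normalizer := (n ^ b).2
      coprime := by rwa [Subgroup.orderOf_coe] }
  refine mem_pairTraces_of_multTrace_eq (fun M hM => ?_) (rightMulEnd_pair_mem (k := k) x)
  have h4 : rightMulEnd k P n = rightMulEnd k P (n ^ a) * rightMulEnd k P (n ^ b) := by
    rw [← rightMulEnd_mul, ← pow_add, add_comm, pow_add, ← h1]
  have h5 : Commute (rightMulEnd k P (n ^ a)) (rightMulEnd k P (n ^ b)) := by
    rw [Commute, SemiconjBy, ← rightMulEnd_mul, ← rightMulEnd_mul, ← pow_add, ← pow_add, add_comm]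
  rw [h4]
  exact multTrace_mul_of_pow_eq_one hM h5 (rightMulEnd_pow P _ h2)

end PairTraces

/-! ### Reduction from arbitrary G-sets to cosets of p-subgroups -/

section Transitive

variable {k G : Type u} [Field k] [Group G] {p : ℕ} [Fintype (Pair.ConjClass p G)]

/-- The indicator matrix of an orbit O in X × X factors as k[X] → k[O] → k[X] along the two
projections, so its traces can be computed on k[O]. -/
theorem matHom_orbit_mem {X : Type u} [Fintype X] [MulAction G X] (w : X × X) {m : Matrix X X k}
    (h1 : ∀ y x, (y, x) ∈ MulAction.orbit G w → m y x = 1)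
    (h0 : ∀ y x, (y, x) ∉ MulAction.orbit G w → m y x = 0)
    (hm : ∀ (g : G) y x, m (g • y) (g • x) = m y x)
    (hO : ∀ f, f ∈ pairTraces p (permRep (G := G) k (MulAction.orbit G w))) :
    matHom m hm ∈ pairTraces p (permRep (G := G) k X) := by
  classical
  have := Fintype.ofFinite (MulAction.orbit G w)
  let A : Matrix X (MulAction.orbit G w) k := fun y o => if y = o.1.1 then 1 else 0
  let B : Matrix (MulAction.orbit G w) X k := fun o x => if x = o.1.2 then 1 else 0
  have hA : ∀ (g : G) y x, A (g • y) (g • x) = A y x := fun g y o => by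
    have : g • y = (g • o).1.1 ↔ y = o.1.1 := MulAction.injective g |>.eq_iff
    simp only [A, this]
  have hB : ∀ (g : G) y x, B (g • y) (g • x) = B y x := fun g o x => by
    have : g • x = (g • o).1.2 ↔ x = o.1.2 := MulAction.injective g |>.eq_iff
    simp only [B, this]
  have hAB : m = A * B := by
    ext y x
    rw [Matrix.mul_apply]
    by_cases h : (y, x) ∈ MulAction.orbit G w
    · rw [h1 y x h, Finset.sum_eq_single ⟨(y, x), h⟩]
      · simp [A, B]
      · intro o _ ho
        by_cases hy : y = o.1.1
        · have hx : x ≠ o.1.2 := fun hx => ho (Subtype.ext (Prod.ext hy.symm hx.symm))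
          simp [B, hx]
        · simp [A, hy]
      · simp
    · rw [h0 y x h, Finset.sum_eq_zero]
      intro o _
      by_cases hy : y = o.1.1
      · have hx : x ≠ o.1.2 := fun hx => h (by rw [hy, hx]; exact o.2)
        simp [B, hx]
      · simp [A, hy]
  subst hAB
  rw [← matHom_comp hA hB]
  exact comp_mem_pairTraces (hO _)

/-- By transitivity all fibres of a have d elements, so pull-back to k[Y] followed by summation over
fibres is multiplication by d. As d is invertible in k, every endomorphism of k[X] factors through
k[Y]. -/
theorem permEnd_mem_of_surjective {X Y : Type u} [Fintype X] [Fintype Y] [MulAction G X]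
    [MulAction G Y] [MulAction.IsPretransitive G X] [Nonempty X] {π : Equiv.Perm X}
    (hπ : ∀ (g : G) x, π (g • x) = g • π x) (a : Y → X) (ha : ∀ (g : G) y, a (g • y) = g • a y)
    {d : ℕ} (hd : (d : k) ≠ 0) (hcard : Nat.card Y = d * Nat.card X)
    (hY : ∀ f, f ∈ pairTraces p (permRep (G := G) k Y)) :
    permEnd k π hπ ∈ pairTraces p (permRep (G := G) k X) := by
  classical
  have hfib : ∀ x, Fintype.card {y // a y = x} = d := by
    obtain ⟨x₀⟩ := ‹Nonempty X›
    have h1 : ∀ x, Fintype.card {y // a y = x} = Fintype.card {y // a y = x₀} := fun x => by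
      obtain ⟨g, rfl⟩ := MulAction.exists_smul_eq G x₀ x
      refine (Fintype.card_congr ((MulAction.toPerm g).subtypeEquiv fun y => ?_)).symm
      rw [MulAction.toPerm_apply, ha]
      exact (MulAction.injective g).eq_iff.symm
    have h2 : Fintype.card Y = ∑ x, Fintype.card {y // a y = x} := by
      rw [← Fintype.card_sigma, Fintype.card_congr (Equiv.sigmaFiberEquiv a)]
    have h3 : 0 < Fintype.card X := Fintype.card_pos_iff.2 ⟨x₀⟩
    rw [Finset.sum_congr rfl fun x _ => h1 x, Finset.sum_const, Finset.card_univ, smul_eq_mul] at h2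
    rw [Nat.card_eq_fintype_card, Nat.card_eq_fintype_card, h2, mul_comm] at hcard
    have h4 := Nat.eq_of_mul_eq_mul_right h3 hcard
    exact fun x => (h1 x).trans h4
  let A : Matrix X Y k := fun x y => if x = a y then 1 else 0
  have hA : ∀ (g : G) x y, A (g • x) (g • y) = A x y := fun g x y => by
    have : g • x = a (g • y) ↔ x = a y := by rw [ha]; exact (MulAction.injective g).eq_iff
    simp only [A, this]
  let B : Matrix Y X k := fun y x => if x = a y then 1 else 0
  have hB : ∀ (g : G) y x, B (g • y) (g • x) = B y x := fun g y x => hA g x y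
  have hAA : A * B = (d : k) • (1 : Matrix X X k) := by
    ext x x'
    rw [Matrix.mul_apply, Matrix.smul_apply, Matrix.one_apply]
    by_cases hx : x = x'
    · subst hx
      rw [if_pos rfl, smul_eq_mul, mul_one, ← hfib x, Fintype.card_subtype, ← Finset.sum_boole]
      refine Finset.sum_congr rfl fun y _ => ?_
      by_cases hy : x = a y
      · simp [A, B, hy]
      · simp [A, B, hy, Ne.symm hy]
    · rw [if_neg hx, smul_zero, Finset.sum_eq_zero]
      intro y _
      by_cases hy : x = a y
      · have : x' ≠ a y := fun h => hx (hy.trans h.symm)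
        simp [B, this]
      · simp [A, hy]
  have hAA' : ∀ (g : G) y x, (A * B) (g • y) (g • x) = (A * B) y x := by
    intro g y x
    rw [hAA]
    simp [Matrix.one_apply]
  have h1 : (matHom A hA).comp (matHom B hB) =
      (d : k) • .id (permRep (G := G) k X) := by
    rw [matHom_comp hA hB hAA']
    refine permRep_hom_ext fun x => funext fun y => ?_
    rw [matHom_single, hAA, Representation.IntertwiningMap.smul_apply]
    simp [Matrix.one_apply, Pi.single_apply]
  have h2 : permEnd k π hπ = (d : k)⁻¹ • ((permEnd k π hπ).comp (matHom A hA)).comp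
      (matHom B hB) := by
    refine DFunLike.ext _ _ fun f => ?_
    have h3 := congrArg (fun q => permEnd k π hπ (q f)) h1
    change permEnd k π hπ _ = permEnd k π hπ ((d : k) • f) at h3
    have h4 : ((d : k)⁻¹ • ((permEnd k π hπ).comp (matHom A hA)).comp (matHom B hB)) f =
        (d : k)⁻¹ • permEnd k π hπ ((matHom A hA).comp (matHom B hB) f) := rfl
    rw [h4, h3, map_smul, smul_smul, inv_mul_cancel₀ hd, one_smul]
  rw [h2]
  exact Submodule.smul_mem _ _ (comp_mem_pairTraces (hY _))

variable [Finite G] [Fact p.Prime] [CharP k p]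

/-- Choose n with n x₀ = π(x₀). The points x₀ and π(x₀) have the same stabilizer, so n normalizes
it, and π is right multiplication by n on cosets. -/
theorem permEnd_mem_of_isPGroup {X : Type u} [Finite X] [MulAction G X]
    [MulAction.IsPretransitive G X] {π : Equiv.Perm X} (hπ : ∀ (g : G) x, π (g • x) = g • π x)
    (x₀ : X) (hx : IsPGroup p (MulAction.stabilizer G x₀)) :
    permEnd k π hπ ∈ pairTraces p (permRep (G := G) k X) := by
  obtain ⟨n, hn⟩ := MulAction.exists_smul_eq G x₀ (π x₀)
  have hstab : ∀ g : G, g • π x₀ = π x₀ ↔ g • x₀ = x₀ := fun g => by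
    rw [← hπ, π.injective.eq_iff]
  have hnorm : n ∈ Subgroup.normalizer (MulAction.stabilizer G x₀ : Set G) := by
    rw [Subgroup.mem_set_normalizer_iff'']
    intro g
    change g • x₀ = x₀ ↔ (n⁻¹ * g * n) • x₀ = x₀
    rw [← hstab, ← hn, mul_smul, mul_smul, inv_smul_eq_iff]
  have hbij : Function.Bijective (MulAction.ofQuotientStabilizer G x₀) := by
    refine ⟨MulAction.injective_ofQuotientStabilizer G x₀, fun x => ?_⟩
    obtain ⟨g, rfl⟩ := MulAction.exists_smul_eq G x₀ x
    exact ⟨g, rfl⟩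
  refine mem_pairTraces_of_multTrace_eq (fun M hM => (multTrace_permEnd_congr _ _
    (Equiv.ofBijective _ hbij) (fun g z => MulAction.ofQuotientStabilizer_smul G x₀ g z)
    (fun z => ?_) M hM).symm) (rightMulEnd_mem_of_isPGroup (k := k) hx ⟨n, hnorm⟩)
  induction z using QuotientGroup.induction_on with | H z => ?_
  change (z * n) • x₀ = π (z • x₀)
  rw [mul_smul, hn, hπ]

/-- Induction towards larger transitive sets, which are bounded by |G|. An orbit on X × X larger
than X is covered by induction; any other orbit is the graph of an equivariant permutation. Such a
permutation is handled directly when the stabilizers are p-groups, and otherwise through the larger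
set G/P with P a Sylow p-subgroup of a stabilizer. -/
theorem mem_pairTraces_of_isPretransitive {X : Type u} [Finite X] [MulAction G X]
    [MulAction.IsPretransitive G X] [Nonempty X]
    (f : (permRep (G := G) k X).IntertwiningMap (permRep k X)) :
    f ∈ pairTraces p (permRep (G := G) k X) := by
  classical
  induction hn : Nat.card G - Nat.card X using Nat.strong_induction_on generalizing X with
  | h n ih => ?_
  subst hn
  have hle : ∀ (Y : Type u) [MulAction G Y] [MulAction.IsPretransitive G Y] [Nonempty Y],
      Nat.card Y ≤ Nat.card G := fun Y _ _ ⟨y⟩ =>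
    Nat.card_le_card_of_surjective _ (MulAction.surjective_smul G y)
  have ih' : ∀ (Y : Type u) [Finite Y] [MulAction G Y] [MulAction.IsPretransitive G Y] [Nonempty Y],
      Nat.card X < Nat.card Y → ∀ f, f ∈ pairTraces p (permRep (G := G) k Y) :=
    fun Y _ _ _ _ hXY f => ih _ (by have := hle Y; omega) f rfl
  have hperm : ∀ (π : Equiv.Perm X) (hπ : ∀ (g : G) x, π (g • x) = g • π x),
      permEnd k π hπ ∈ pairTraces p (permRep (G := G) k X) := by
    intro π hπ
    obtain ⟨x₀⟩ := id ‹Nonempty X›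
    by_cases hx : IsPGroup p (MulAction.stabilizer G x₀)
    · exact permEnd_mem_of_isPGroup hπ x₀ hx
    · have := Fintype.ofFinite X
      -- The fibres of G/P → X have as cardinality the index of S: prime to p, hence invertible in
      -- k, and larger than 1 because the stabilizer is not a p-group.
      let S : Sylow p (MulAction.stabilizer G x₀) := default
      let P : Subgroup G := (S : Subgroup (MulAction.stabilizer G x₀)).map
        (MulAction.stabilizer G x₀).subtype
      have := Fintype.ofFinite (G ⧸ P)
      have hcard : Nat.card (G ⧸ P) =
          (S : Subgroup (MulAction.stabilizer G x₀)).index * Nat.card X := by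
        change P.index = _
        rw [Subgroup.index_map_subtype, MulAction.index_stabilizer_of_transitive]
      have hPle : P ≤ MulAction.stabilizer G x₀ := Subgroup.map_subtype_le _
      let a : G ⧸ P → X := Quotient.lift (fun g : G => g • x₀) fun g h hgh => by
        have h1 := hPle (QuotientGroup.leftRel_apply.1 hgh)
        rw [MulAction.mem_stabilizer_iff, mul_smul, inv_smul_eq_iff] at h1
        exact h1.symm
      refine permEnd_mem_of_surjective hπ a (fun g y => ?_)
        (d := (S : Subgroup (MulAction.stabilizer G x₀)).index) ?_ hcard (ih' _ ?_)
      · induction y using QuotientGroup.induction_on with | H y => ?_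
        exact mul_smul g y x₀
      · rw [Ne, CharP.cast_eq_zero_iff k p]
        exact S.not_dvd_index
      · have h1 : (S : Subgroup (MulAction.stabilizer G x₀)).index ≠ 1 := fun h => hx <| by
          have h2 := S.isPGroup'
          rw [Subgroup.index_eq_one.1 h] at h2
          exact h2.of_equiv Subgroup.topEquiv
        have h2 : (S : Subgroup (MulAction.stabilizer G x₀)).index ≠ 0 :=
          Subgroup.index_ne_zero_of_finite
        rw [hcard]
        exact lt_mul_of_one_lt_left Nat.card_pos (by omega)
  refine mem_pairTraces_of_orbits (fun w m h1 h0 _ hm => ?_) f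
  have : Nonempty (MulAction.orbit G w) := ⟨⟨w, MulAction.mem_orbit_self w⟩⟩
  by_cases hw : Nat.card X < Nat.card (MulAction.orbit G w)
  · exact matHom_orbit_mem w h1 h0 hm (ih' _ hw)
  -- The orbit now has at most |X| points, so both of its projections to the transitive set X are
  -- bijective.
  let q₁ : MulAction.orbit G w → X := fun o => o.1.1
  let q₂ : MulAction.orbit G w → X := fun o => o.1.2
  have hq : ∀ q : MulAction.orbit G w → X, (∀ (g : G) o, q (g • o) = g • q o) →
      Function.Bijective q := by
    intro q hq
    have h2 : Function.Surjective q := fun x => by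
      obtain ⟨o⟩ := ‹Nonempty (MulAction.orbit G w)›
      obtain ⟨g, hg⟩ := MulAction.exists_smul_eq G (q o) x
      exact ⟨g • o, (hq g o).trans hg⟩
    exact (Nat.bijective_iff_surjective_and_card q).2
      ⟨h2, le_antisymm (not_lt.1 hw) (Nat.card_le_card_of_surjective q h2)⟩
  have hq₁ := hq q₁ fun _ _ => rfl
  have hq₂ := hq q₂ fun _ _ => rfl
  let e₁ := Equiv.ofBijective q₁ hq₁
  let e₂ := Equiv.ofBijective q₂ hq₂
  let π : Equiv.Perm X := e₂.symm.trans e₁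
  have he₂ : ∀ (g : G) x, e₂.symm (g • x) = g • e₂.symm x := fun g x => by
    rw [Equiv.symm_apply_eq]
    change _ = g • e₂ (e₂.symm x)
    rw [e₂.apply_symm_apply]
  have hπ : ∀ (g : G) x, π (g • x) = g • π x := fun g x => by
    change e₁ (e₂.symm (g • x)) = _
    rw [he₂]
    rfl
  have hmem : ∀ y x, (y, x) ∈ MulAction.orbit G w ↔ y = π x := fun y x => by
    constructor
    · intro h
      have h2 : e₂.symm x = ⟨(y, x), h⟩ := e₂.symm_apply_eq.2 rfl
      change y = e₁ (e₂.symm x)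
      rw [h2]
      rfl
    · rintro rfl
      have h2 : (e₂.symm x).1 = (π x, x) := Prod.ext rfl (e₂.apply_symm_apply x)
      rw [← h2]
      exact (e₂.symm x).2
  have heq : matHom m hm = permEnd k π hπ := by
    refine permRep_hom_ext fun x => funext fun y => ?_
    rw [matHom_single, permEnd_single]
    by_cases h : (y, x) ∈ MulAction.orbit G w
    · rw [h1 y x h, (hmem y x).1 h, Pi.single_eq_same]
    · rw [h0 y x h, Pi.single_eq_of_ne fun h' => h ((hmem y x).2 h')]
  rw [heq]
  exact hperm π hπ

/-- On the endomorphism ring of every permutation module, the traces on multiplicity spaces are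
combinations of those attached to pairs. -/
theorem mem_pairTraces_permRep {X : Type u} [Finite X] [MulAction G X]
    (f : (permRep (G := G) k X).IntertwiningMap (permRep k X)) :
    f ∈ pairTraces p (permRep (G := G) k X) := by
  refine mem_pairTraces_of_orbits (fun w m h1 h0 _ hm => ?_) f
  have : Nonempty (MulAction.orbit G w) := ⟨⟨w, MulAction.mem_orbit_self w⟩⟩
  exact matHom_orbit_mem w h1 h0 hm fun f => mem_pairTraces_of_isPretransitive f

end Transitive

/-! ### The species separate the elements of `F T(G)` -/

section Separation

variable {k G : Type u} [Field k] [Group G] [Finite G] {p : ℕ} [Fact p.Prime] [CharP k p]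

/-- For a retract N of k[X] with inclusion i and projection q, the identity q i of N has the same
traces as the endomorphism i q of k[X]. -/
theorem exists_multTrace_id_eq [Fintype (Pair.ConjClass p G)] (N : PPerm k G) :
    ∃ c : Pair.ConjClass p G → k, ∀ (M : PPerm k G) (hM : IsIndecomposable M.ρ),
      multTrace hM (.id N.ρ) = ∑ q, c q * multTrace hM (rightMulEnd k q.out.P q.out.elt) := by
  obtain ⟨X, _, _, i, q, hiq⟩ := N.isPPermutation.exists_permRep
  have h : q.comp i = .id N.ρ := DFunLike.ext _ _ hiq
  have := comp_mem_pairTraces (mem_pairTraces_permRep (k := k) (p := p) (i.comp q))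
  rwa [h] at this

variable [IsAlgClosed k]

/-- Each indecomposable M defines a functional on coefficient vectors, through the traces attached
to pairs on its multiplicity space. On the coefficient vector of an indecomposable N it takes the
value 1 if M ≅ N and 0 otherwise, so the functionals are dual to the vectors. -/
theorem linearIndependent_indecomposable [Fintype (Pair.ConjClass p G)] :
    ∃ c : {i : IsoClass k G // IsIndecomposable i.out.ρ} → Pair.ConjClass p G → k,
      LinearIndependent k c := by
  classical
  choose c hc using fun N : PPerm k G => exists_multTrace_id_eq (p := p) N
  refine ⟨fun i => c i.1.out, LinearIndependent.of_pairwise_dual_eq_zero_one _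
    (fun i => ∑ q, multTrace i.2 (rightMulEnd k q.out.P q.out.elt) • LinearMap.proj q) ?_ ?_⟩
  · intro i j hij
    have h1 := hc j.1.out i.1.out i.2
    rw [multTrace_id_of_not_equiv i.2 j.2] at h1
    · simpa [mul_comm] using h1.symm
    · refine ⟨fun e => hij (Subtype.ext ?_)⟩
      rw [← Quotient.out_eq i.1, ← Quotient.out_eq j.1]
      exact Quotient.sound ⟨e⟩
  · intro i
    have h1 := hc i.1.out i.1.out i.2
    rw [multTrace_id_of_equiv i.2 (.refl _)] at h1
    simpa [mul_comm] using h1.symm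

variable {F : Type v} [Field F] [IsAlgClosed F] [CharZero F] (φ : CommGroup.torsion kˣ →* Fˣ)

/-- An element of `F T(G)` on which all the species vanish is zero. -/
theorem eq_zero_of_tauF_eq_zero (hφ : Function.Injective φ) {ξ : FT k G F}
    (h : ∀ y : Pair p G, tauF φ y.P ⟨y.s, y.mem_normalizer⟩ ξ = 0) : ξ = 0 := by
  classical
  have := Fintype.ofFinite (Pair.ConjClass p G)
  obtain ⟨c, hc⟩ := linearIndependent_indecomposable (k := k) (G := G) (p := p)
  have hfin : Finite {i : IsoClass k G // IsIndecomposable i.out.ρ} := hc.finite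
  have := Fintype.ofFinite {i : IsoClass k G // IsIndecomposable i.out.ρ}
  have hcard := hc.fintype_card_le_finrank
  rw [Module.finrank_fintype_fun_eq_card] at hcard
  have hspan := span_clsF_indecomposable (k := k) (G := G) F
  have hfinite : Module.Finite F (FT k G F) := ⟨⟨(Set.finite_range _).toFinset, by
    rw [Set.Finite.coe_toFinset]; exact hspan⟩⟩
  have hrank : Module.finrank F (FT k G F) ≤ Fintype.card (Pair.ConjClass p G) := by
    rw [← finrank_top F (FT k G F), ← hspan]
    exact (finrank_range_le_card _).trans hcard
  let Φ : FT k G F →ₗ[F] Pair.ConjClass p G → F :=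
    LinearMap.pi fun q => tauF φ q.out.P ⟨q.out.s, q.out.mem_normalizer⟩
  -- The idempotents map to the standard basis. With the upper bound on the dimension of FT(G), this
  -- surjection is between spaces of equal dimension and hence injective.
  have hsurj : Function.Surjective Φ := by
    rw [← LinearMap.range_eq_top, eq_top_iff, ← (Pi.basisFun F (Pair.ConjClass p G)).span_eq,
      Submodule.span_le]
    rintro _ ⟨q, rfl⟩
    refine ⟨idem φ q.out, ?_⟩
    funext q'
    have h1 := isIdem_idem (k := k) (F := F) φ hφ q.out q'.out
    rw [Pi.basisFun_apply]
    by_cases hq : q' = q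
    · subst hq
      rw [Pi.single_eq_same]
      exact h1.1 (Pair.IsConj.refl _)
    · rw [Pi.single_eq_of_ne hq]
      refine h1.2 fun h2 => hq ?_
      rw [← Quotient.out_eq q, ← Quotient.out_eq q']
      exact (Quotient.sound h2).symm
  have hdim : Module.finrank F (FT k G F) = Module.finrank F (Pair.ConjClass p G → F) := by
    refine le_antisymm (by rwa [Module.finrank_fintype_fun_eq_card]) ?_
    exact LinearMap.finrank_le_finrank_of_surjective hsurj
  have hinj := (LinearMap.injective_iff_surjective_of_finrank_eq_finrank hdim).2 hsurj
  refine hinj ?_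
  rw [map_zero]
  exact funext fun q => h q.out

end Separation

/-! ### Relative projectivity -/

section IndLift

variable {k Q G W U : Type*} [Field k] [Group Q] [Group G] [AddCommGroup W] [Module k W]
  [AddCommGroup U] [Module k U] (φ : Q →* G) (σ : Representation k Q W)

theorem IndV_mk_mul (q : Q) (y : G) (w : W) :
    Representation.IndV.mk φ σ (φ q * y) (σ q w) = Representation.IndV.mk φ σ y w := by
  have := Representation.Coinvariants.mk_self_apply
    (Representation.tprod ((Representation.leftRegular k G).comp φ) σ) q
    (MonoidAlgebra.single y 1 ⊗ₜ[k] w)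
  simpa using this

/-- The linear maps on `k[G] ⊗ W` given on elementary tensors. -/
noncomputable def indLiftAux {G : Type*} (f : G → W →ₗ[k] U) : MonoidAlgebra k G ⊗[k] W →ₗ[k] U :=
  TensorProduct.lift ((MonoidAlgebra.basis G k).constr k f)

theorem indLiftAux_single {G : Type*} (f : G → W →ₗ[k] U) (y : G) (w : W) :
    indLiftAux f (MonoidAlgebra.single y 1 ⊗ₜ w) = f y w := by
  have h : (MonoidAlgebra.basis G k) y = MonoidAlgebra.single y 1 := by simp
  rw [indLiftAux, TensorProduct.lift.tmul, ← h, Module.Basis.constr_basis]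

/-- The linear maps on an induced module. -/
noncomputable def indLift (f : G → W →ₗ[k] U) (hf : ∀ q y w, f (φ q * y) (σ q w) = f y w) :
    Representation.IndV φ σ →ₗ[k] U :=
  Representation.Coinvariants.lift _ (indLiftAux f) fun q =>
    TensorProduct.ext (MonoidAlgebra.lhom_ext' fun y => LinearMap.ext_ring (LinearMap.ext fun w => by
      simpa [indLiftAux_single] using hf q y w))

theorem indLift_mk (f : G → W →ₗ[k] U) (hf : ∀ q y w, f (φ q * y) (σ q w) = f y w) (y : G) (w : W) :
    indLift φ σ f hf (Representation.IndV.mk φ σ y w) = f y w :=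
  indLiftAux_single f y w

variable {φ σ} in
theorem indHom_ext {f g : Representation.IndV φ σ →ₗ[k] U}
    (h : ∀ y w, f (Representation.IndV.mk φ σ y w) = g (Representation.IndV.mk φ σ y w))
    (x : Representation.IndV φ σ) : f x = g x :=
  LinearMap.congr_fun (Representation.IndV.hom_ext φ σ fun y => LinearMap.ext (h y)) x

end IndLift

/-! ### Decompositions of the identity over a G-set -/

section Decomposition

variable {k G V W : Type*} [Field k] [Group G] [AddCommGroup V] [Module k V] [AddCommGroup W]
  [Module k W]

/-- The identity of the module is a sum of linear endomorphisms that are indexed by a `G`-set and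
permuted accordingly by `G`. -/
def HasDecomposition (Z : Type*) [Fintype Z] [MulAction G Z] (ρ : Representation k G V) : Prop :=
  ∃ Ψ : Z → Module.End k V, (∀ g z v, Ψ (g • z) (ρ g v) = ρ g (Ψ z v)) ∧ ∀ v, ∑ z, Ψ z v = v

variable {Z Z' : Type*} [Fintype Z] [MulAction G Z] [Fintype Z'] [MulAction G Z']
  {ρ : Representation k G V} {σ : Representation k G W}

theorem HasDecomposition.of_retract (h : HasDecomposition Z σ) (i : ρ.IntertwiningMap σ)
    (q : σ.IntertwiningMap ρ) (hq : ∀ v, q (i v) = v) : HasDecomposition Z ρ := by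
  obtain ⟨Ψ, h1, h2⟩ := h
  refine ⟨fun z => q.toLinearMap ∘ₗ Ψ z ∘ₗ i.toLinearMap, fun g z v => ?_, fun v => ?_⟩
  · change q (Ψ (g • z) (i (ρ g v))) = ρ g (q (Ψ z (i v)))
    rw [i.isIntertwining, h1, q.isIntertwining]
  · change ∑ z, q (Ψ z (i v)) = v
    rw [← map_sum, h2, hq]

/-- The composites Ψ_z Ψ'_{z'} work. This takes the place of the Mackey formula in the argument on
vertices. -/
theorem HasDecomposition.prod (h : HasDecomposition Z ρ) (h' : HasDecomposition Z' ρ) :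
    HasDecomposition (Z × Z') ρ := by
  obtain ⟨Ψ, h1, h2⟩ := h
  obtain ⟨Ψ', h1', h2'⟩ := h'
  refine ⟨fun z => Ψ z.1 ∘ₗ Ψ' z.2, fun g z v => ?_, fun v => ?_⟩
  · change Ψ (g • z.1) (Ψ' (g • z.2) (ρ g v)) = _
    rw [h1', h1]
    rfl
  · rw [Fintype.sum_prod_type]
    change ∑ z, ∑ z', Ψ z (Ψ' z' v) = v
    simp only [← map_sum, h2', h2]

theorem hasDecomposition_permRep : HasDecomposition Z (permRep (G := G) k Z) := by
  classical
  refine ⟨fun z => LinearMap.single k (fun _ => k) z ∘ₗ LinearMap.proj z, fun g z v => ?_,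
    fun v => ?_⟩
  · change Pi.single (g • z) (permRep k Z g v (g • z)) = permRep k Z g (Pi.single z (v z))
    rw [permRep_apply, inv_smul_smul, permRep_single]
  · exact Finset.univ_sum_single v

theorem hasDecomposition_of_subsingleton [Subsingleton Z] [Nonempty Z] : HasDecomposition Z ρ := by
  obtain ⟨z⟩ := ‹Nonempty Z›
  have : Unique Z := ⟨⟨z⟩, fun _ => Subsingleton.elim _ _⟩
  exact ⟨fun _ => LinearMap.id, fun _ _ _ => rfl, fun v => by simp⟩

/-- If the Brauer construction at `P` does not vanish, then `P` has a fixed point. -/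
theorem HasDecomposition.exists_fixed [Finite G] (h : HasDecomposition Z ρ) (P : Subgroup G)
    (hP : Nontrivial (BrauerQuotient ρ P)) : ∃ z : Z, ∀ g ∈ P, g • z = z := by
  by_contra! h0
  obtain ⟨Ψ, h1, h2⟩ := h
  refine not_subsingleton (BrauerQuotient ρ P) (Submodule.Quotient.subsingleton_iff.2 ?_)
  refine Submodule.eq_top_iff'.2 fun m => ?_
  change (m : V) ∈ traceSubmodule ρ P
  rw [← h2 (m : V)]
  -- P permutes the terms Ψ_z(m) as it permutes Z, and without fixed points only proper stabilizers
  -- occur.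
  refine sum_mem_traceSubmodule ρ P (fun z => Ψ z (m : V)) (fun g z => ?_) fun z hz => ?_
  · change Ψ ((g : G) • z) (m : V) = _
    rw [← h1, mem_fixedPoints.1 m.2 g g.2]
  · obtain ⟨g, hg, hgz⟩ := h0 z
    exact absurd (hz ⟨g, hg⟩) hgz

/-- Ψ_z projects onto the part of the induced module supported on one coset. The inverse of y
appears because g acts on the group algebra factor by y ↦ yg⁻¹. -/
theorem hasDecomposition_ind {Q : Subgroup G} [Fintype (G ⧸ Q)] (σ : Representation k Q W) :
    HasDecomposition (G ⧸ Q) (Representation.ind Q.subtype σ) := by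
  classical
  have hz : ∀ (q : Q) (y : G), (((Q.subtype q * y)⁻¹ : G) : G ⧸ Q) = ((y⁻¹ : G) : G ⧸ Q) :=
    fun q y => QuotientGroup.eq.2 (by simp)
  let P (z : G ⧸ Q) : Module.End k (Representation.IndV Q.subtype σ) :=
    indLift Q.subtype σ (fun y => if ((y⁻¹ : G) : G ⧸ Q) = z then
      Representation.IndV.mk Q.subtype σ y else 0) (fun q y w => by
      rw [hz]
      split_ifs
      · exact IndV_mk_mul Q.subtype σ q y w
      · rfl)
  have hP : ∀ z y w, P z (Representation.IndV.mk Q.subtype σ y w) =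
      if ((y⁻¹ : G) : G ⧸ Q) = z then Representation.IndV.mk Q.subtype σ y w else 0 :=
    fun z y w => (indLift_mk _ _ _ _ _ _).trans (by split_ifs <;> rfl)
  refine ⟨P, fun g z v => ?_, fun v => ?_⟩
  · refine indHom_ext (f := P (g • z) ∘ₗ Representation.ind Q.subtype σ g)
      (g := Representation.ind Q.subtype σ g ∘ₗ P z) (fun y w => ?_) v
    change P (g • z) (Representation.ind Q.subtype σ g (Representation.IndV.mk Q.subtype σ y w)) =
      Representation.ind Q.subtype σ g (P z (Representation.IndV.mk Q.subtype σ y w))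
    rw [Representation.ind_mk, hP, hP]
    have h1 : (((y * g⁻¹)⁻¹ : G) : G ⧸ Q) = g • z ↔ ((y⁻¹ : G) : G ⧸ Q) = z := by
      have h2 : (((y * g⁻¹)⁻¹ : G) : G ⧸ Q) = g • ((y⁻¹ : G) : G ⧸ Q) := by
        rw [mul_inv_rev, inv_inv]
        rfl
      rw [h2]
      exact (MulAction.injective g).eq_iff
    by_cases h : ((y⁻¹ : G) : G ⧸ Q) = z
    · rw [if_pos h, if_pos (h1.2 h), Representation.ind_mk]
    · rw [if_neg h, if_neg fun h' => h (h1.1 h'), map_zero]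
  · rw [← LinearMap.sum_apply]
    refine indHom_ext (g := LinearMap.id) (fun y w => ?_) v
    rw [LinearMap.sum_apply, Finset.sum_congr rfl fun z _ => hP z y w, Finset.sum_ite_eq,
      if_pos (Finset.mem_univ _)]
    rfl

/-- The inclusion sends v to the sum over cosets gQ of g⁻¹ ⊗ g⁻¹Ψ_{gQ}(v), and the retraction sends
y ⊗ w to y⁻¹w; the composite is ∑ Ψ_z, the identity. -/
theorem HasDecomposition.exists_retract_ind {Q : Subgroup G} [Fintype (G ⧸ Q)]
    (h : HasDecomposition (G ⧸ Q) ρ) :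
    ∃ (i : ρ.IntertwiningMap (Representation.ind Q.subtype (ρ.comp Q.subtype)))
      (q : (Representation.ind Q.subtype (ρ.comp Q.subtype)).IntertwiningMap ρ),
      q.comp i = .id ρ := by
  obtain ⟨Ψ, h1, h2⟩ := h
  let t : G ⧸ Q → V →ₗ[k] Representation.IndV Q.subtype (ρ.comp Q.subtype) := fun z =>
    Quotient.liftOn z (fun g => Representation.IndV.mk Q.subtype (ρ.comp Q.subtype) g⁻¹ ∘ₗ ρ g⁻¹ ∘ₗ
      Ψ (g : G ⧸ Q)) fun g h hgh => by
        obtain ⟨q, hq⟩ : ∃ q : Q, h = g * q :=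
          ⟨⟨g⁻¹ * h, QuotientGroup.leftRel_apply.1 hgh⟩, by simp⟩
        subst hq
        refine LinearMap.ext fun v => ?_
        have h3 : ((g * q : G) : G ⧸ Q) = (g : G ⧸ Q) := QuotientGroup.eq.2 (by simp)
        have h4 := IndV_mk_mul Q.subtype (ρ.comp Q.subtype) q⁻¹ g⁻¹ (ρ g⁻¹ (Ψ (g : G ⧸ Q) v))
        change Representation.IndV.mk Q.subtype (ρ.comp Q.subtype) g⁻¹ (ρ g⁻¹ (Ψ (g : G ⧸ Q) v)) =
          Representation.IndV.mk Q.subtype (ρ.comp Q.subtype) (g * q)⁻¹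
            (ρ (g * q)⁻¹ (Ψ ((g * q : G) : G ⧸ Q) v))
        rw [h3, mul_inv_rev, map_mul]
        exact h4.symm
  have ht : ∀ (g : G) v, t (g : G ⧸ Q) v = Representation.IndV.mk Q.subtype (ρ.comp Q.subtype) g⁻¹
      (ρ g⁻¹ (Ψ (g : G ⧸ Q) v)) := fun _ _ => rfl
  have ht' : ∀ (g : G) z v, t (g • z) (ρ g v) =
      Representation.ind Q.subtype (ρ.comp Q.subtype) g (t z v) := by
    intro g z v
    induction z using QuotientGroup.induction_on with | H z => ?_
    have h3 : g • (z : G ⧸ Q) = ((g * z : G) : G ⧸ Q) := rfl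
    rw [ht, Representation.ind_mk, h3, ht, ← h3, h1, mul_inv_rev, map_mul, Module.End.mul_apply,
      Representation.inv_self_apply]
  let i : ρ.IntertwiningMap (Representation.ind Q.subtype (ρ.comp Q.subtype)) :=
    ⟨∑ z, t z, fun g => LinearMap.ext fun v => by
      rw [LinearMap.comp_apply, LinearMap.comp_apply, LinearMap.sum_apply, LinearMap.sum_apply,
        map_sum, ← Fintype.sum_equiv (MulAction.toPerm g) _ _ fun z => rfl]
      exact Finset.sum_congr rfl fun z _ => ht' g z v⟩
  have hinv : ∀ (q : Q) (y : G) (w : V),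
      ρ (Q.subtype q * y)⁻¹ (ρ.comp Q.subtype q w) = ρ y⁻¹ w := fun q y w => by
    rw [mul_inv_rev, map_mul, Module.End.mul_apply]
    exact congrArg _ (Representation.inv_self_apply ρ (q : G) w)
  let q : (Representation.ind Q.subtype (ρ.comp Q.subtype)).IntertwiningMap ρ :=
    ⟨indLift Q.subtype (ρ.comp Q.subtype) (fun y => ρ y⁻¹) hinv, fun g =>
      LinearMap.ext (indHom_ext fun y w => by
        rw [LinearMap.comp_apply, Representation.ind_mk, indLift_mk, LinearMap.comp_apply,
          indLift_mk, mul_inv_rev, inv_inv, map_mul]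
        rfl)⟩
  have hq : ∀ y w, q (Representation.IndV.mk Q.subtype (ρ.comp Q.subtype) y w) = ρ y⁻¹ w :=
    fun y w => indLift_mk Q.subtype (ρ.comp Q.subtype) (fun y => ρ y⁻¹) hinv y w
  refine ⟨i, q, DFunLike.ext _ _ fun v => ?_⟩
  change q ((∑ z, t z) v) = v
  rw [LinearMap.sum_apply, map_sum]
  conv_rhs => rw [← h2 v]
  refine Finset.sum_congr rfl fun z _ => ?_
  induction z using QuotientGroup.induction_on with | H z => ?_
  rw [ht, hq, inv_inv, Representation.self_inv_apply]

end Decomposition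

/-! ### Higman's criterion and vertices -/

section RelProjective

variable {k G V W : Type u} [Field k] [Group G] [AddCommGroup V] [Module k V] [AddCommGroup W]
  [Module k W] {ρ : Representation k G V} {σ : Representation k G W}

/-- Higman's criterion for relative projectivity. -/
theorem isRelProjective_iff [Module.Finite k V] {Q : Subgroup G} [Fintype (G ⧸ Q)] :
    IsRelProjective Q ρ ↔ HasDecomposition (G ⧸ Q) ρ := by
  constructor
  · rintro ⟨W, _, _, _, σ, i, q, h⟩
    exact (hasDecomposition_ind σ).of_retract i q fun v => congrArg (fun f => f v) h
  · intro h
    obtain ⟨i, q, hq⟩ := h.exists_retract_ind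
    exact ⟨V, _, _, inferInstance, ρ.comp Q.subtype, i, q, hq⟩

/-- An indecomposable module with a decomposition over a `G`-set is projective relative to all
stabilizers of the points of some orbit. -/
theorem IsIndecomposable.exists_isRelProjective [Finite G] [Module.Finite k V]
    (hρ : IsIndecomposable ρ) {Z : Type*} [Fintype Z] [MulAction G Z] (h : HasDecomposition Z ρ) :
    ∃ z : Z, ∀ g : G, IsRelProjective (MulAction.stabilizer G (g • z)) ρ := by
  classical
  obtain ⟨Ψ, h1, h2⟩ := h
  -- The sums of Ψ over single orbits commute with G, and together they add up to the identity. As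
  -- the endomorphism ring is local, one of them is bijective.
  let E (z : Z) : ρ.IntertwiningMap ρ :=
    ⟨∑ z' ∈ Finset.univ.filter (· ∈ MulAction.orbit G z), Ψ z', fun g => LinearMap.ext fun v => by
      rw [LinearMap.comp_apply, LinearMap.comp_apply, LinearMap.sum_apply, LinearMap.sum_apply,
        map_sum, Finset.sum_filter, Finset.sum_filter,
        ← Fintype.sum_equiv (MulAction.toPerm g) _ _ fun z => rfl]
      refine Finset.sum_congr rfl fun z' _ => ?_
      have h3 : g • z' ∈ MulAction.orbit G z ↔ z' ∈ MulAction.orbit G z := by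
        rw [← MulAction.orbit_eq_iff, ← MulAction.orbit_eq_iff, MulAction.orbit_smul]
      rw [MulAction.toPerm_apply]
      simp only [h3, h1]⟩
  have hE : ∀ z v, E z v = ∑ z' ∈ Finset.univ.filter (· ∈ MulAction.orbit G z), Ψ z' v :=
    fun z v => LinearMap.sum_apply _ _ _
  obtain ⟨z, hz⟩ : ∃ z, Function.Bijective (E z) := by
    by_contra! hE'
    have := Fintype.ofFinite (MulAction.orbitRel.Quotient G Z)
    have h3 : ∀ s : Finset (MulAction.orbitRel.Quotient G Z),
        ¬ Function.Bijective (∑ o ∈ s, E o.out : ρ.IntertwiningMap ρ) := by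
      intro s
      induction s using Finset.induction_on with
      | empty =>
        intro h
        have := hρ.1
        obtain ⟨v, hv⟩ := exists_ne (0 : V)
        exact hv (h.1 rfl)
      | insert o s ho ih =>
        rw [Finset.sum_insert ho]
        exact hρ.not_bijective_add (hE' _) ih
    refine h3 Finset.univ ?_
    have h4 : ∀ v, (∑ o, E (Quotient.out o) : ρ.IntertwiningMap ρ) v = v := fun v => by
      rw [Representation.IntertwiningMap.sum_apply]
      conv_rhs => rw [← h2 v, ← Finset.sum_fiberwise Finset.univ
        (fun z => (Quotient.mk _ z : MulAction.orbitRel.Quotient G Z))]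
      refine Finset.sum_congr rfl fun o _ => ?_
      rw [hE]
      refine Finset.sum_congr (Finset.filter_congr fun z _ => ?_) fun _ _ => rfl
      rw [← MulAction.orbitRel_apply]
      constructor
      · exact fun h => (Quotient.sound (s := MulAction.orbitRel G Z) h).trans (Quotient.out_eq o)
      · exact fun h => Quotient.exact (s := MulAction.orbitRel G Z)
          (h.trans (Quotient.out_eq o).symm)
    have h5 : ⇑(∑ o, E (Quotient.out o) : ρ.IntertwiningMap ρ) = id := funext h4
    rw [h5]
    exact Function.bijective_id
  refine ⟨z, fun g => ?_⟩
  have := Fintype.ofFinite (G ⧸ MulAction.stabilizer G (g • z))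
  refine isRelProjective_iff.2 ?_
  -- Composing with the inverse of the orbit sum makes the Ψ of this one orbit add up to the
  -- identity.
  let e := Representation.IntertwiningMap.ofBijective (E z) hz
  let a : G ⧸ MulAction.stabilizer G (g • z) → Z := MulAction.ofQuotientStabilizer G (g • z)
  have ha : Function.Injective a := MulAction.injective_ofQuotientStabilizer G (g • z)
  refine ⟨fun z' => Ψ (a z') ∘ₗ e.symm.toIntertwiningMap.toLinearMap, fun h z' v => ?_, fun v => ?_⟩
  · change Ψ (a (h • z')) (e.symm (ρ h v)) = ρ h (Ψ (a z') (e.symm v))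
    have h3 : e.symm (ρ h v) = ρ h (e.symm v) := e.symm.toIntertwiningMap.isIntertwining _ _ h v
    have h4 : a (h • z') = h • a z' := MulAction.ofQuotientStabilizer_smul G _ _ _
    rw [h3, h4, h1]
  · change ∑ z', Ψ (a z') (e.symm v) = v
    have h3 : E z (e.symm v) = v := e.apply_symm_apply v
    conv_rhs => rw [← h3, hE]
    refine Finset.sum_bij (fun z' _ => a z') (fun z' _ => ?_) (fun _ _ _ _ h => ha h)
      (fun z' hz' => ?_) fun _ _ => rfl
    · induction z' using QuotientGroup.induction_on with | H h => ?_
      refine Finset.mem_filter.2 ⟨Finset.mem_univ _, h * g, ?_⟩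
      exact mul_smul h g z
    · obtain ⟨h, rfl⟩ := (Finset.mem_filter.1 hz').2
      refine ⟨((h * g⁻¹ : G) : G ⧸ _), Finset.mem_univ _, ?_⟩
      change (h * g⁻¹) • g • z = h • z
      rw [← mul_smul, inv_mul_cancel_right]

theorem exists_isVertex [Finite G] [Module.Finite k V] (ρ : Representation k G V) :
    ∃ Q : Subgroup G, IsVertex Q ρ := by
  have := Fintype.ofFinite (G ⧸ (⊤ : Subgroup G))
  have : Subsingleton (G ⧸ (⊤ : Subgroup G)) := QuotientGroup.subsingleton_quotient_top
  have h : IsRelProjective (⊤ : Subgroup G) ρ :=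
    isRelProjective_iff.2 hasDecomposition_of_subsingleton
  obtain ⟨Q, -, hQ⟩ := exists_minimal_le_of_wellFoundedLT (fun R : Subgroup G => IsRelProjective R ρ) ⊤ h
  exact ⟨Q, hQ⟩

/-- The vertices of an indecomposable module with a decomposition over a `G`-set fix a point. -/
theorem IsVertex.exists_fixed [Finite G] [Module.Finite k V] (hρ : IsIndecomposable ρ)
    {Q : Subgroup G} (hQ : IsVertex Q ρ) {Z : Type*} [Fintype Z] [MulAction G Z]
    (h : HasDecomposition Z ρ) : ∃ z : Z, ∀ g ∈ Q, g • z = z := by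
  have := Fintype.ofFinite (G ⧸ Q)
  -- Translating by y⁻¹ makes the second coordinate the coset Q, so the stabilizer lies in Q. By
  -- minimality of the vertex it is all of Q, which therefore fixes y⁻¹z.
  obtain ⟨⟨z, y⟩, hz⟩ := hρ.exists_isRelProjective (h.prod (isRelProjective_iff.1 hQ.prop))
  induction y using QuotientGroup.induction_on with | H y => ?_
  have h1 : MulAction.stabilizer G (y⁻¹ • ((z, (y : G ⧸ Q)) : Z × (G ⧸ Q))) ≤ Q := by
    intro g hg
    have h2 : g • (y⁻¹ • (y : G ⧸ Q)) = y⁻¹ • (y : G ⧸ Q) := congrArg Prod.snd hg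
    have h3 : y⁻¹ • (y : G ⧸ Q) = ((1 : G) : G ⧸ Q) := congrArg _ (inv_mul_cancel y)
    rw [h3] at h2
    have h4 := QuotientGroup.eq.1 h2.symm
    simpa using h4
  have h2 := hQ.le_of_le (hz y⁻¹) h1
  exact ⟨y⁻¹ • z, fun g hg => congrArg Prod.fst (h2 hg)⟩

end RelProjective

/-! ### Isomorphisms between the `p`-subgroups of pairs -/

namespace Pair

variable {p : ℕ} {G H K : Type*} [Group G] [Group H] [Group K]

/-- Conjugation by the element of a pair on the `p`-subgroup. -/
def conj (x : Pair p G) : MulAut x.P := x.P.normalizerMonoidHom x.elt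

/-- The `p`-subgroups of two pairs are isomorphic, compatibly with the actions of the
elements of the pairs. -/
def SubgroupIso (x : Pair p G) (y : Pair p K) : Prop :=
  ∃ γ : x.P ≃* y.P, ∀ w, γ (x.conj w) = y.conj (γ w)

theorem SubgroupIso.symm {x : Pair p G} {y : Pair p K} (h : x.SubgroupIso y) : y.SubgroupIso x := by
  obtain ⟨γ, hγ⟩ := h
  refine ⟨γ.symm, fun w => ?_⟩
  rw [MulEquiv.symm_apply_eq, hγ, MulEquiv.apply_symm_apply]

theorem SubgroupIso.trans {x : Pair p G} {y : Pair p K} {z : Pair p H} (h : x.SubgroupIso y)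
    (h' : y.SubgroupIso z) : x.SubgroupIso z := by
  obtain ⟨γ, hγ⟩ := h
  obtain ⟨γ', hγ'⟩ := h'
  exact ⟨γ.trans γ', fun w => by
    rw [MulEquiv.trans_apply, MulEquiv.trans_apply, hγ, hγ']⟩

theorem SubgroupIso.of_hom {x : Pair p G} {y : Pair p K} (a : x.P →* K)
    (hinj : Function.Injective a) (hrange : a.range = y.P)
    (h : ∀ w, a (x.conj w) = y.s * a w * y.s⁻¹) : x.SubgroupIso y :=
  ⟨(MonoidHom.ofInjective hinj).trans (MulEquiv.subgroupCongr hrange),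
    fun w => Subtype.ext (h w)⟩

theorem IsConj.subgroupIso {x y : Pair p G} (h : x.IsConj y) : x.SubgroupIso y := by
  obtain ⟨g, h1, h2⟩ := h
  refine .of_hom ((MulAut.conj g).toMonoidHom.comp x.P.subtype)
    ((MulAut.conj g).injective.comp x.P.subtype_injective) ?_ fun w => ?_
  · rw [MonoidHom.range_comp, Subgroup.range_subtype, h1]
  · change g * (x.s * w * x.s⁻¹) * g⁻¹ = y.s * (g * w * g⁻¹) * y.s⁻¹
    rw [h2]
    group

/-- The image of a pair under a homomorphism. -/
def map (f : G →* K) (x : Pair p G) : Pair p K where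
  P := x.P.map f
  s := f x.s
  isPGroup := x.isPGroup.map f
  mem_normalizer := Subgroup.le_normalizer_map f ⟨x.s, x.mem_normalizer, rfl⟩
  coprime := Nat.Coprime.coprime_dvd_left (orderOf_map_dvd f x.s) x.coprime

theorem subgroupIso_map (x : Pair p G) (f : G →* K) (hf : ∀ w ∈ x.P, f w = 1 → w = 1) :
    x.SubgroupIso (x.map f) := by
  refine .of_hom (f.comp x.P.subtype) ((injective_iff_map_eq_one _).2 fun w hw =>
    Subtype.ext (hf w w.2 hw)) ?_ fun w => ?_
  · rw [MonoidHom.range_comp, Subgroup.range_subtype]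
    rfl
  · change f (x.s * w * x.s⁻¹) = f x.s * f w * (f x.s)⁻¹
    rw [map_mul, map_mul, map_inv]

theorem exists_mul_zpow_of_mem_grp (x : Pair p G) {g : G} (hg : g ∈ x.grp) :
    ∃ a ∈ x.P, ∃ i : ℤ, g = a * x.s ^ i := by
  let S : Subgroup G :=
    { carrier := {g | ∃ a ∈ x.P, ∃ i : ℤ, g = a * x.s ^ i}
      mul_mem' := by
        rintro _ _ ⟨a, ha, i, rfl⟩ ⟨b, hb, j, rfl⟩
        have h1 := (Subgroup.mem_set_normalizer_iff.1 (zpow_mem x.mem_normalizer i) b).1 hb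
        refine ⟨_, mul_mem ha h1, i + j, ?_⟩
        rw [zpow_add]
        group
      one_mem' := ⟨1, one_mem _, 0, by simp⟩
      inv_mem' := by
        rintro _ ⟨a, ha, i, rfl⟩
        have h1 := (Subgroup.mem_set_normalizer_iff.1 (zpow_mem x.mem_normalizer (-i)) a⁻¹).1
          (inv_mem ha)
        refine ⟨_, h1, -i, ?_⟩
        group }
  have h1 : x.grp ≤ S := sup_le (fun a ha => ⟨a, ha, 0, by simp⟩)
    ((Subgroup.zpowers_le (H := S)).2 ⟨1, one_mem _, 1, by simp⟩)
  exact h1 hg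

theorem le_grp (x : Pair p G) : x.P ≤ x.grp := le_sup_left

theorem assoc_grp (x : Pair p G) : x.assoc.grp = ⊤ := by
  refine eq_top_iff.2 fun z _ => ?_
  induction z using QuotientGroup.induction_on with | H z => ?_
  obtain ⟨a, ha, i, hi⟩ := x.exists_mul_zpow_of_mem_grp z.2
  have h1 : z = ⟨a, x.le_grp ha⟩ * x.gen ^ i := Subtype.ext hi
  rw [h1]
  change QuotientGroup.mk' x.cent (_ * _) ∈ _
  rw [map_mul, map_zpow]
  refine mul_mem ((le_sup_left : x.assoc.P ≤ x.assoc.grp) ⟨⟨a, x.le_grp ha⟩, ha, rfl⟩) ?_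
  exact zpow_mem ((le_sup_right : Subgroup.zpowers x.assoc.s ≤ x.assoc.grp)
    (Subgroup.mem_zpowers x.assoc.s)) i

theorem conj_zpow_coe (x : Pair p G) (i : ℤ) (w : x.P) :
    ((x.conj ^ i) w : G) = x.s ^ i * w * (x.s ^ i)⁻¹ := by
  rw [conj, ← map_zpow]
  rfl

/-- P meets ⟨s⟩ trivially, since an element of the intersection has order both a power of p and
prime to p. -/
theorem zpow_eq_one_of_mem (x : Pair p G) {i : ℤ} (h : x.s ^ i ∈ x.P) : x.s ^ i = 1 := by
  obtain ⟨n, hn⟩ := x.isPGroup ⟨_, h⟩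
  have h1 : (x.s ^ i) ^ p ^ n = 1 := congrArg Subtype.val hn
  have h2 : orderOf (x.s ^ i) ∣ p ^ n := orderOf_dvd_of_pow_eq_one h1
  have h3 : orderOf (x.s ^ i) ∣ orderOf x.s := orderOf_dvd_of_mem_zpowers ⟨i, rfl⟩
  exact orderOf_eq_one_iff.1 (Nat.eq_one_of_dvd_coprimes (x.coprime.pow_right n) h3 h2)

/-- The elements of `P⟨s⟩` of order a power of `p` are those of `P`. -/
theorem mem_of_pow_eq_one (x : Pair p G) {g : G} (hg : g ∈ x.grp) {n : ℕ} (h : g ^ p ^ n = 1) :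
    g ∈ x.P := by
  obtain ⟨a, ha, i, rfl⟩ := x.exists_mul_zpow_of_mem_grp hg
  -- The m-th power of as^i lies in P s^(im). For m = pⁿ this puts a power of s in P, which forces
  -- s^i = 1.
  have h1 : ∀ m : ℕ, (a * x.s ^ i) ^ m * ((x.s ^ i) ^ m)⁻¹ ∈ x.P := by
    intro m
    induction m with
    | zero => simp
    | succ m ih =>
      have h2 : (x.s ^ i) ^ m * a * ((x.s ^ i) ^ m)⁻¹ ∈ x.P :=
        (Subgroup.mem_set_normalizer_iff.1 (pow_mem (zpow_mem x.mem_normalizer i) m) a).1 ha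
      have h3 : (a * x.s ^ i) ^ (m + 1) * ((x.s ^ i) ^ (m + 1))⁻¹ =
          ((a * x.s ^ i) ^ m * ((x.s ^ i) ^ m)⁻¹) * ((x.s ^ i) ^ m * a * ((x.s ^ i) ^ m)⁻¹) := by
        rw [pow_succ, pow_succ]
        group
      rw [h3]
      exact mul_mem ih h2
  have h2 := h1 (p ^ n)
  rw [h, one_mul, inv_mem_iff, ← zpow_natCast, ← zpow_mul] at h2
  have h3 := x.zpow_eq_one_of_mem h2
  have h4 : (x.s ^ i) ^ p ^ n = 1 := by rw [← zpow_natCast, ← zpow_mul, h3]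
  have h5 : x.s ^ i = 1 := orderOf_eq_one_iff.1 (Nat.eq_one_of_dvd_coprimes
    (x.coprime.pow_right n) (orderOf_dvd_of_mem_zpowers ⟨i, rfl⟩) (orderOf_dvd_of_pow_eq_one h4))
  rwa [h5, mul_one]

/-- P ∩ ⟨s⟩ = 1 forces w = 1, and s^i centralizes P when the i-th power of conjugation is trivial.
This describes `cent` in terms that an equivariant isomorphism of the p-subgroups preserves. -/
theorem mul_zpow_mem_iff (x : Pair p G) (w : x.P) (i : ℤ) :
    (w : G) * x.s ^ i ∈ Subgroup.zpowers x.s ⊓ Subgroup.centralizer (x.P : Set G) ↔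
      w = 1 ∧ ∀ v : x.P, (x.conj ^ i) v = v := by
  have h1 : ∀ v : x.P, (x.conj ^ i) v = v ↔ (v : G) * x.s ^ i = x.s ^ i * v := fun v => by
    rw [Subtype.ext_iff, conj_zpow_coe, mul_inv_eq_iff_eq_mul, eq_comm]
  constructor
  · rintro ⟨h2, h3⟩
    have h4 : (w : G) ∈ Subgroup.zpowers x.s := by
      have h2' : (w : G) * x.s ^ i ∈ Subgroup.zpowers x.s := h2
      have h4 := (Subgroup.zpowers x.s).mul_mem h2'
        ((Subgroup.zpowers x.s).inv_mem (Subgroup.zpow_mem_zpowers x.s i))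
      rwa [mul_inv_cancel_right] at h4
    obtain ⟨j, hj⟩ := Subgroup.mem_zpowers_iff.1 h4
    have h5 : w = 1 := Subtype.ext (hj.symm.trans (x.zpow_eq_one_of_mem (by rw [hj]; exact w.2)))
    subst h5
    refine ⟨rfl, fun v => (h1 v).2 ?_⟩
    have h6 := Subgroup.mem_centralizer_iff.1 h3 v v.2
    simpa using h6
  · rintro ⟨rfl, h2⟩
    rw [Subgroup.coe_one, one_mul]
    exact ⟨Subgroup.zpow_mem_zpowers x.s i, Subgroup.mem_centralizer_iff.2 fun v hv =>
      (h1 ⟨v, hv⟩).1 (h2 ⟨v, hv⟩)⟩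

/-- After composing with an inner automorphism the generator maps to the generator. The p-subgroup
is carried along because it consists of all elements of p-power order. -/
theorem Iso.subgroupIso {x : Pair p G} {y : Pair p K} (h : x.Iso y) : x.SubgroupIso y := by
  obtain ⟨f, hf⟩ := h
  obtain ⟨c, hc⟩ := isConj_iff.1 hf
  let F : x.grp ≃* y.grp := f.trans (MulAut.conj c)
  have hF : F x.gen = y.gen := hc
  refine .of_hom ((y.grp.subtype.comp F.toMonoidHom).comp (Subgroup.inclusion x.le_grp))
    ((y.grp.subtype_injective.comp F.injective).comp (Subgroup.inclusion_injective _)) ?_ fun w => ?_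
  · ext v
    constructor
    · rintro ⟨w, rfl⟩
      obtain ⟨n, hn⟩ := x.isPGroup w
      refine y.mem_of_pow_eq_one (F (Subgroup.inclusion x.le_grp w)).2 (n := n) ?_
      have h1 := congrArg ((y.grp.subtype.comp F.toMonoidHom).comp (Subgroup.inclusion x.le_grp)) hn
      rwa [map_pow, map_one] at h1
    · intro hv
      obtain ⟨n, hn⟩ := y.isPGroup ⟨v, hv⟩
      have h1 : ((F.symm ⟨v, y.le_grp hv⟩ : x.grp) : G) ^ p ^ n = 1 := by
        have hn' : v ^ p ^ n = 1 := congrArg Subtype.val hn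
        have h2 : (⟨v, y.le_grp hv⟩ : y.grp) ^ p ^ n = 1 := Subtype.ext hn'
        rw [← Subgroup.coe_pow, ← map_pow, h2, map_one]
        rfl
      refine ⟨⟨_, x.mem_of_pow_eq_one (F.symm ⟨v, y.le_grp hv⟩).2 h1⟩, ?_⟩
      exact congrArg Subtype.val (F.apply_symm_apply ⟨v, y.le_grp hv⟩)
  · have h1 : Subgroup.inclusion x.le_grp (x.conj w) =
        x.gen * Subgroup.inclusion x.le_grp w * x.gen⁻¹ := Subtype.ext rfl
    change ((F (Subgroup.inclusion x.le_grp (x.conj w)) : y.grp) : K) = _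
    rw [h1, map_mul, map_mul, map_inv, hF]
    rfl

/-- The quotient map is injective on P, since the subgroup divided out lies in ⟨s⟩ and so meets P
trivially. -/
theorem subgroupIso_assoc (x : Pair p G) : x.SubgroupIso x.assoc := by
  refine .of_hom ((QuotientGroup.mk' x.cent).comp (Subgroup.inclusion x.le_grp))
    ((injective_iff_map_eq_one _).2 fun w hw => ?_) ?_ fun w => ?_
  · obtain ⟨i, hi⟩ := Subgroup.mem_zpowers_iff.1 ((QuotientGroup.eq_one_iff _).1 hw).1
    have h1 : x.s ^ i = w := hi
    refine Subtype.ext (h1.symm.trans (x.zpow_eq_one_of_mem ?_))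
    rw [h1]
    exact w.2
  · rw [MonoidHom.range_comp, Subgroup.inclusion_range]
    rfl
  · have h1 : Subgroup.inclusion x.le_grp (x.conj w) =
        x.gen * Subgroup.inclusion x.le_grp w * x.gen⁻¹ := Subtype.ext rfl
    change QuotientGroup.mk' x.cent (Subgroup.inclusion x.le_grp (x.conj w)) = _
    rw [h1, map_mul, map_mul, map_inv]
    rfl

end Pair

/-- Two quotients of a group with the same kernel are isomorphic. -/
theorem exists_quotient_mulEquiv {A B Γ : Type*} [Group A] [Group B] [Group Γ] {N : Subgroup A}
    [N.Normal] {M : Subgroup B} [M.Normal] (a : Γ →* A) (b : Γ →* B) (ha : Function.Surjective a)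
    (hb : Function.Surjective b) (h : ∀ g, a g ∈ N ↔ b g ∈ M) :
    ∃ f : A ⧸ N ≃* B ⧸ M, ∀ g, f (a g : A ⧸ N) = (b g : B ⧸ M) := by
  let a' := (QuotientGroup.mk' N).comp a
  let b' := (QuotientGroup.mk' M).comp b
  have hker : a'.ker = b'.ker := by
    ext g
    change ((a g : A) : A ⧸ N) = 1 ↔ ((b g : B) : B ⧸ M) = 1
    rw [QuotientGroup.eq_one_iff, QuotientGroup.eq_one_iff, h]
  let ea := QuotientGroup.quotientKerEquivOfSurjective a' ((QuotientGroup.mk'_surjective N).comp ha)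
  let eb := QuotientGroup.quotientKerEquivOfSurjective b' ((QuotientGroup.mk'_surjective M).comp hb)
  refine ⟨(ea.symm.trans (QuotientGroup.quotientMulEquivOfEq hker)).trans eb, fun g => ?_⟩
  have h1 : ea.symm (a g : A ⧸ N) = (g : Γ ⧸ a'.ker) := (MulEquiv.symm_apply_eq ea).2 rfl
  rw [MulEquiv.trans_apply, MulEquiv.trans_apply, h1]
  rfl

/-! ### The associated pair is determined by the action on the p-subgroup -/

namespace Pair

variable {p : ℕ} {G K : Type*} [Group G] [Group K]

/-- With x = (P, s) and y = (Q, t), the rule ws^i ↦ γ(w)t^i need not be well defined, since s and t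
may have different orders. Its graph Γ is still a subgroup that surjects onto P⟨s⟩ and Q⟨t⟩. The two
subgroups to be divided out have the same preimage in Γ, given by w = 1 and trivial i-th power of
the action. -/
theorem SubgroupIso.assoc_iso {x : Pair p G} {y : Pair p K} (h : x.SubgroupIso y) :
    x.assoc.Iso y.assoc := by
  obtain ⟨γ, hγ⟩ := h
  have hz : ∀ (i : ℤ) (w : x.P), γ ((x.conj ^ i) w) = (y.conj ^ i) (γ w) := fun i w => by
    have h1 : MulAut.congr γ x.conj = y.conj := MulEquiv.ext fun w => by
      change γ (x.conj (γ.symm w)) = _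
      rw [hγ, MulEquiv.apply_symm_apply]
    rw [← h1, ← map_zpow]
    change _ = γ ((x.conj ^ i) (γ.symm (γ w)))
    rw [MulEquiv.symm_apply_apply]
  let Γ : Subgroup (x.grp × y.grp) :=
    { carrier := {g | ∃ (w : x.P) (i : ℤ), (g.1 : G) = w * x.s ^ i ∧ (g.2 : K) = γ w * y.s ^ i}
      mul_mem' := by
        rintro g h ⟨w, i, h1, h2⟩ ⟨w', j, h3, h4⟩
        refine ⟨w * (x.conj ^ i) w', i + j, ?_, ?_⟩
        · change (g.1 : G) * h.1 = _
          rw [h1, h3, Subgroup.coe_mul, conj_zpow_coe, zpow_add]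
          group
        · change (g.2 : K) * h.2 = _
          rw [h2, h4, map_mul, hz, Subgroup.coe_mul, conj_zpow_coe, zpow_add]
          group
      one_mem' := ⟨1, 0, by simp, by simp⟩
      inv_mem' := by
        rintro g ⟨w, i, h1, h2⟩
        refine ⟨(x.conj ^ (-i)) w⁻¹, -i, ?_, ?_⟩
        · change (g.1 : G)⁻¹ = _
          rw [h1, conj_zpow_coe, Subgroup.coe_inv]
          group
        · change (g.2 : K)⁻¹ = _
          rw [h2, hz, conj_zpow_coe, map_inv, Subgroup.coe_inv]
          group }
  have hsurj₁ : Function.Surjective ((MonoidHom.fst x.grp y.grp).comp Γ.subtype) := fun g => by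
    obtain ⟨a, ha, i, hi⟩ := x.exists_mul_zpow_of_mem_grp g.2
    exact ⟨⟨(g, ⟨γ ⟨a, ha⟩, y.le_grp (γ ⟨a, ha⟩).2⟩ * y.gen ^ i), ⟨a, ha⟩, i, hi, rfl⟩, rfl⟩
  have hsurj₂ : Function.Surjective ((MonoidHom.snd x.grp y.grp).comp Γ.subtype) := fun g => by
    obtain ⟨a, ha, i, hi⟩ := y.exists_mul_zpow_of_mem_grp g.2
    refine ⟨⟨(⟨γ.symm ⟨a, ha⟩, x.le_grp (γ.symm ⟨a, ha⟩).2⟩ * x.gen ^ i, g), γ.symm ⟨a, ha⟩, i, rfl,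
      ?_⟩, rfl⟩
    rw [MulEquiv.apply_symm_apply]
    exact hi
  have hcent : ∀ i : ℤ, (∀ w : x.P, (x.conj ^ i) w = w) ↔ ∀ w : y.P, (y.conj ^ i) w = w := by
    intro i
    constructor
    · intro h w
      rw [← γ.apply_symm_apply w, ← hz, h]
    · intro h w
      refine γ.injective ?_
      rw [hz, h]
  have hker : ∀ g : Γ, (MonoidHom.fst x.grp y.grp).comp Γ.subtype g ∈ x.cent ↔
      (MonoidHom.snd x.grp y.grp).comp Γ.subtype g ∈ y.cent := by
    rintro ⟨g, w, i, h1, h2⟩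
    change (g.1 : G) ∈ Subgroup.zpowers x.s ⊓ Subgroup.centralizer (x.P : Set G) ↔
      (g.2 : K) ∈ Subgroup.zpowers y.s ⊓ Subgroup.centralizer (y.P : Set K)
    rw [h1, h2, x.mul_zpow_mem_iff, y.mul_zpow_mem_iff, hcent,
      EmbeddingLike.map_eq_one_iff]
  obtain ⟨f, hf⟩ := exists_quotient_mulEquiv _ _ hsurj₁ hsurj₂ hker
  let e : x.assoc.grp ≃* y.assoc.grp :=
    (((MulEquiv.subgroupCongr x.assoc_grp).trans Subgroup.topEquiv).trans f).trans
      ((MulEquiv.subgroupCongr y.assoc_grp).trans Subgroup.topEquiv).symm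
  refine ⟨e, isConj_iff.2 ⟨1, ?_⟩⟩
  rw [one_mul, inv_one, mul_one]
  refine Subtype.ext ?_
  exact hf ⟨(x.gen, y.gen), 1, 1, by simp [gen], by simp [gen]⟩

end Pair

/-! ### Twisted diagonal subgroups -/

section TwistedDiagonal

variable {G K : Type*} [Group G] [Group K]

/-- Both projections are injective on the subgroup. -/
def InjectiveProjections (D : Subgroup (G × K)) : Prop :=
  (∀ a ∈ D, a.1 = 1 → a = 1) ∧ ∀ a ∈ D, a.2 = 1 → a = 1

theorem injectiveProjections_twistedDiagonal (U : Subgroup G) (W : Subgroup K) (γ : W ≃* U) :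
    InjectiveProjections (twistedDiagonal U W γ) := by
  constructor
  · rintro _ ⟨w, rfl⟩ h
    have h1 : γ w = 1 := Subtype.ext h
    rw [(EmbeddingLike.map_eq_one_iff (f := γ)).1 h1, map_one]
  · rintro _ ⟨w, rfl⟩ h
    have h1 : w = 1 := Subtype.ext h
    rw [h1, map_one]

theorem InjectiveProjections.exists_eq_twistedDiagonal {D : Subgroup (G × K)}
    (hD : InjectiveProjections D) :
    ∃ (U : Subgroup G) (W : Subgroup K) (γ : W ≃* U), D = twistedDiagonal U W γ := by
  let a := (MonoidHom.fst G K).comp D.subtype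
  let b := (MonoidHom.snd G K).comp D.subtype
  have ha : Function.Injective a :=
    (injective_iff_map_eq_one _).2 fun d hd => Subtype.ext (hD.1 d d.2 hd)
  have hb : Function.Injective b :=
    (injective_iff_map_eq_one _).2 fun d hd => Subtype.ext (hD.2 d d.2 hd)
  refine ⟨a.range, b.range, (MonoidHom.ofInjective hb).symm.trans (MonoidHom.ofInjective ha), ?_⟩
  ext d
  constructor
  · intro hd
    refine ⟨MonoidHom.ofInjective hb ⟨d, hd⟩, ?_⟩
    change (((MonoidHom.ofInjective ha) ((MonoidHom.ofInjective hb).symm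
      (MonoidHom.ofInjective hb ⟨d, hd⟩)) : G), d.2) = d
    rw [MulEquiv.symm_apply_apply]
    rfl
  · rintro ⟨w, rfl⟩
    obtain ⟨d, rfl⟩ := (MonoidHom.ofInjective hb).surjective w
    change (((MonoidHom.ofInjective ha) ((MonoidHom.ofInjective hb).symm
      (MonoidHom.ofInjective hb d)) : G), (d : G × K).2) ∈ D
    rw [MulEquiv.symm_apply_apply]
    exact d.2

/-- A subgroup that fixes a coset of `R` is conjugate to a subgroup of `R`. -/
theorem InjectiveProjections.of_fixed {D R : Subgroup (G × K)} (hR : InjectiveProjections R)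
    {z : (G × K) ⧸ R} (h : ∀ g ∈ D, g • z = z) : InjectiveProjections D := by
  induction z using QuotientGroup.induction_on with | H z => ?_
  have h1 : ∀ g ∈ D, z⁻¹ * g * z ∈ R := fun g hg => by
    rw [mul_assoc]
    exact QuotientGroup.eq.1 (h g hg).symm
  have h2 : ∀ g : G × K, z⁻¹ * g * z = 1 → g = 1 := fun g hg => by
    rwa [mul_assoc, inv_mul_eq_one, right_eq_mul] at hg
  exact ⟨fun g hg hg1 => h2 g (hR.1 _ (h1 g hg) (by simp [hg1])),
    fun g hg hg1 => h2 g (hR.2 _ (h1 g hg) (by simp [hg1]))⟩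

variable {p : ℕ}

/-- The pair `({(γ w, w)}, (s, t))` of `G × K` attached to an equivariant isomorphism between the
`p`-subgroups of two pairs. -/
def Pair.twisted (x : Pair p G) (y : Pair p K) (γ : y.P ≃* x.P)
    (hγ : ∀ w, γ (y.conj w) = x.conj (γ w)) : Pair p (G × K) where
  P := twistedDiagonal x.P y.P γ
  s := (x.s, y.s)
  isPGroup := y.isPGroup.of_surjective _ (MonoidHom.rangeRestrict_surjective _)
  mem_normalizer := by
    have hz : ∀ w, γ (y.conj⁻¹ w) = x.conj⁻¹ (γ w) := fun w => by
      have h1 := hγ (y.conj⁻¹ w)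
      rw [MulAut.apply_inv_self] at h1
      rw [h1, MulAut.inv_apply_self]
    refine Subgroup.mem_set_normalizer_iff.2 fun a => ⟨?_, ?_⟩
    · rintro ⟨w, rfl⟩
      exact ⟨y.conj w, Prod.ext (congrArg Subtype.val (hγ w)) rfl⟩
    · rintro ⟨w, hw⟩
      refine ⟨y.conj⁻¹ w, ?_⟩
      have h1 : ∀ b c : G × K, (x.s, y.s) * b * (x.s, y.s)⁻¹ = (x.s, y.s) * c * (x.s, y.s)⁻¹ →
          b = c := fun b c h => mul_left_cancel (mul_right_cancel h)
      refine h1 _ _ (Eq.trans ?_ hw)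
      refine Prod.ext ?_ ?_
      · change ((x.conj (γ (y.conj⁻¹ w)) : x.P) : G) = (γ w : x.P)
        rw [hz, MulAut.apply_inv_self]
      · change ((y.conj (y.conj⁻¹ w) : y.P) : K) = w
        rw [MulAut.apply_inv_self]
  coprime := by
    rw [Prod.orderOf]
    exact Nat.Coprime.coprime_dvd_left (Nat.lcm_dvd_mul _ _)
      (Nat.Coprime.mul_left x.coprime y.coprime)

theorem Pair.isConj_of_eq {x y : Pair p G} (hP : y.P = x.P) (hs : y.s = x.s) : x.IsConj y := by
  refine ⟨1, ?_, by rw [hs, one_mul, inv_one, mul_one]⟩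
  rw [hP, map_one]
  exact (Subgroup.map_id _).symm

theorem Pair.isConj_map_fst_twisted (x : Pair p G) (y : Pair p K) (γ : y.P ≃* x.P)
    (hγ : ∀ w, γ (y.conj w) = x.conj (γ w)) :
    x.IsConj ((x.twisted y γ hγ).map (MonoidHom.fst G K)) := by
  refine isConj_of_eq ?_ rfl
  ext a
  constructor
  · rintro ⟨_, ⟨w, rfl⟩, rfl⟩
    exact (γ w).2
  · intro ha
    refine ⟨_, ⟨γ.symm ⟨a, ha⟩, rfl⟩, ?_⟩
    exact congrArg Subtype.val (γ.apply_symm_apply ⟨a, ha⟩)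

theorem Pair.isConj_map_snd_twisted (x : Pair p G) (y : Pair p K) (γ : y.P ≃* x.P)
    (hγ : ∀ w, γ (y.conj w) = x.conj (γ w)) :
    y.IsConj ((x.twisted y γ hγ).map (MonoidHom.snd G K)) := by
  refine isConj_of_eq ?_ rfl
  ext a
  constructor
  · rintro ⟨_, ⟨w, rfl⟩, rfl⟩
    exact w.2
  · intro ha
    exact ⟨_, ⟨⟨a, ha⟩, rfl⟩, rfl⟩

end TwistedDiagonal

/-! ### Twisted diagonal vertices and species -/

section Vertices

variable {k G K : Type u} [Field k] [Group G] [Group K] [Finite G] [Finite K]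

/-- A vertex of a summand fixes a coset of R, hence is conjugate into R and inherits the injectivity
of both projections. -/
theorem hasTwistedDiagonalVertices_of_isDirectSummand {V : Type u} [AddCommGroup V] [Module k V]
    {ρ : Representation k (G × K) V} {R : Subgroup (G × K)} (hR : InjectiveProjections R)
    (h : IsDirectSummand ρ (permRep k ((G × K) ⧸ R))) : HasTwistedDiagonalVertices ρ := by
  intro W _ _ σ hσ hσρ D hD
  obtain ⟨i, q, hq⟩ := hσρ.trans h
  have hq' : ∀ w, q (i w) = w := fun w => congrArg (fun f => f w) hq
  have := Fintype.ofFinite ((G × K) ⧸ R)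
  have : Module.Finite k W := Module.Finite.of_injective i.toLinearMap
    (Function.LeftInverse.injective hq')
  obtain ⟨z, hz⟩ := IsVertex.exists_fixed hσ hD (hasDecomposition_permRep.of_retract i q hq')
  exact (hR.of_fixed hz).exists_eq_twistedDiagonal

theorem liftTrace_of_subsingleton {k : Type*} [Field k] {F : Type*} [Field F]
    (φ : CommGroup.torsion kˣ →* Fˣ) {V : Type*} [AddCommGroup V] [Module k V] [Module.Finite k V]
    [Subsingleton V] (f : Module.End k V) : liftTrace φ f = 0 := by
  have h : f.charpoly.natDegree = 0 := by
    rw [LinearMap.charpoly_natDegree, Module.finrank_zero_of_subsingleton]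
  rw [liftTrace, Polynomial.eq_C_of_natDegree_eq_zero h, Polynomial.roots_C, Multiset.map_zero,
    Multiset.sum_zero]

/-- Some indecomposable summand N has a nonzero species, so N[P] ≠ 0. By Higman's criterion for a
vertex R of N, the subgroup P then fixes a coset of R, and R is twisted diagonal. -/
theorem HasTwistedDiagonalVertices.injectiveProjections {F : Type v} [Field F]
    (φ : CommGroup.torsion kˣ →* Fˣ) {M : PPerm k (G × K)} (hM : HasTwistedDiagonalVertices M.ρ)
    {P : Subgroup (G × K)} {u : Subgroup.normalizer (P : Set (G × K))} (h : tau φ P u M.ρ ≠ 0) :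
    InjectiveProjections P := by
  obtain ⟨N, hN, hNM, hN0⟩ := exists_indecomposable_tau_ne_zero F φ P u M h
  obtain ⟨R, hR⟩ := exists_isVertex N.ρ
  obtain ⟨U, W, γ, hRγ⟩ := hM N.V N.ρ hN hNM R hR
  have := Fintype.ofFinite ((G × K) ⧸ R)
  have hnt : Nontrivial (BrauerQuotient N.ρ P) := by
    by_contra hs
    have := not_nontrivial_iff_subsingleton.1 hs
    exact hN0 (liftTrace_of_subsingleton φ _)
  obtain ⟨z, hz⟩ := HasDecomposition.exists_fixed (isRelProjective_iff.1 hR.prop) P hnt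
  subst hRγ
  exact (injectiveProjections_twistedDiagonal U W γ).of_fixed hz

end Vertices

end PPermutation

/-! ### The main theorem -/

open PPermutation in
theorem theorem3p7 {p : ℕ} [Fact p.Prime]
    {k : Type u} [Field k] [IsAlgClosed k] [CharP k p]
    {F : Type v} [Field F] [IsAlgClosed F] [CharZero F]
    (φ : CommGroup.torsion kˣ →* Fˣ) (hφ : Function.Injective φ)
    {G K : Type u} [Group G] [Finite G] [Group K] [Finite K]
    (x : PPermutation.Pair p G) (y : PPermutation.Pair p K) :
    (∃ M : PPermutation.PPerm k (G × K),
      PPermutation.HasTwistedDiagonalVertices M.ρ ∧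
      PPermutation.tensorF
        (PPermutation.tensorF (PPermutation.tilde (PPermutation.idem φ x)) (M.clsF F))
        (PPermutation.tilde (PPermutation.idem φ y)) ≠ 0) ↔
    x.assoc.Iso y.assoc := by
  have key : ∀ (z : Pair p (G × K)) (M : PPerm k (G × K)),
      tauF φ z.P z.elt (tensorF (tensorF (tilde (idem φ x)) (M.clsF F)) (tilde (idem φ y))) =
        tauF φ (z.map (MonoidHom.snd G K)).P (z.map (MonoidHom.snd G K)).elt (idem φ y) *
          (tauF φ (z.map (MonoidHom.fst G K)).P (z.map (MonoidHom.fst G K)).elt (idem φ x) *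
            tau φ z.P z.elt M.ρ) := fun z M => by
    rw [tauF_tensorF_tilde_right φ z.isPGroup z.elt z.coprime,
      tauF_tensorF_tilde_left φ z.isPGroup z.elt z.coprime, tauF_clsF]
    rfl
  constructor
  · rintro ⟨M, hM, h⟩
    obtain ⟨z, hz⟩ : ∃ z : Pair p (G × K), tauF φ z.P z.elt (tensorF (tensorF (tilde (idem φ x))
        (M.clsF F)) (tilde (idem φ y))) ≠ 0 := by
      by_contra! h0
      exact h (eq_zero_of_tauF_eq_zero φ hφ h0)
    rw [key] at hz
    -- All three factors are nonzero: the outer two make the projections of z conjugate to x and y,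
    -- and the middle one makes both projections injective on the p-subgroup of z.
    have h1 : x.IsConj (z.map (MonoidHom.fst G K)) := by
      by_contra h1
      exact left_ne_zero_of_mul (right_ne_zero_of_mul hz) ((isIdem_idem φ hφ x _).2 h1)
    have h2 : y.IsConj (z.map (MonoidHom.snd G K)) := by
      by_contra h2
      exact left_ne_zero_of_mul hz ((isIdem_idem φ hφ y _).2 h2)
    have h3 := hM.injectiveProjections φ (right_ne_zero_of_mul (right_ne_zero_of_mul hz))
    have h4 := h1.subgroupIso.trans (z.subgroupIso_map _ h3.1).symm
    have h5 := h2.subgroupIso.trans (z.subgroupIso_map _ h3.2).symm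
    exact (h4.trans h5.symm).assoc_iso
  · intro h
    obtain ⟨γ, hγ⟩ := ((x.subgroupIso_assoc.trans h.subgroupIso).trans y.subgroupIso_assoc.symm).symm
    -- The graph of γ, with the elements of x and y as coordinates, is a pair whose two projections
    -- are x and y. At this pair the idempotents take the value 1, so the species of the triple
    -- product is that of the chosen summand.
    let z := x.twisted y γ hγ
    obtain ⟨c, hc, hz⟩ := exists_eigenPerm_tau_ne_zero φ hφ z
    refine ⟨z.eigenPerm k hc, hasTwistedDiagonalVertices_of_isDirectSummand
      (injectiveProjections_twistedDiagonal x.P y.P γ) (eigenSub_isDirectSummand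
        (rightMulEnd_inv_pow k z) (z.natCast_orderOf_ne_zero k) hc), fun h0 => hz ?_⟩
    have h1 := key z (z.eigenPerm k hc)
    rw [h0, map_zero] at h1
    have h2 : tauF φ (z.map (MonoidHom.fst G K)).P (z.map (MonoidHom.fst G K)).elt (idem φ x) =
      (1 : F) := (isIdem_idem (k := k) φ hφ x _).1 (x.isConj_map_fst_twisted y γ hγ)
    have h3 : tauF φ (z.map (MonoidHom.snd G K)).P (z.map (MonoidHom.snd G K)).elt (idem φ y) =
      (1 : F) := (isIdem_idem (k := k) φ hφ y _).1 (x.isConj_map_snd_twisted y γ hγ)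
    rw [h2, h3, one_mul, one_mul] at h1
    exact h1.symm
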